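/- Model. The machines are random access machines (RAM) with registers $R_0,R_1,\dots$ holding unbounded natural numbers, with the instructions: loading a constant, copying, indirect load and store, addition, (truncated) subtraction, multiplication, jump, comparison with conditional jump, and $\mathtt{Output}$, which outputs the word $R_a R_{a+1}\cdots R_b$, where the bounds $a,b$ are read from registers (the empty word if $b<a$). An arithmetic instruction (including comparison) costs the number of binary digits of the sum of its arguments; every other instruction costs $1$. The space in use at some point of the computation is the sum of the lengths (numbers of binary digits, the length of $0$ being $1$) of the contents of all registers up to the last one accessed so far. The words are over a finite alphabet $\Sigma=\{0,\dots,k-1\}$; on input $x$, initially $R_0=|x|$, the letters of $x$ are in $R_1,\dots,R_{|x|}$ (these registers count as accessed), and all other registers are $0$. Problems. For $A\subseteq\Sigma^*\times\Sigma^*$ let $A(x)=\{y : (x,y)\in A\}$. The problem of enumerating $A$ is in $\mathrm{EnumP}$ if there is a polynomial $p$ with $|y|\le p(|x|)$ for all $x$ and $y\in A(x)$, and it can be decided in polynomial time, given $x$ and $y$, whether $y\in A(x)$. A machine solves it if on every input $x$ it halts, outputs exactly the elements of $A(x)$, each once, and stops as soon as the last one has been output. Let $T(x,i)$ be the time at which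 the $i$th output on input $x$ is completed; if $A(x)=\emptyset$, let $T(x,1)$ be the time at which the machine halts. Classes. $\mathrm{IncP}_1^{poly}$ is the class of the problems in $\mathrm{EnumP}$ that are solved by a machine for which there are polynomials $p,s$ and constants $b,C$ such that on every input $x$, with $n=|x|$: $T(x,1)\le p(n)$; $T(x,i)-T(x,1)\le C\, i\,(n+1)^b$ for all $1\le i\le |A(x)|$; and the space in use is at most $s(n)$ at every point of the computation. $\mathrm{DelayP}^{poly}$ is the class of the problems in $\mathrm{EnumP}$ that are solved by a machine for which there are polynomials $p,d,s$ such that on every input $x$, with $n=|x|$: $T(x,1)\le p(n)$; $T(x,i+1)-T(x,i)\le d(n)$ for all $1\le i<|A(x)|$; and the space in use is at most $s(n)$ at every point of the computation. Corollary. Over every finite alphabet, $\mathrm{IncP}_1^{poly}=\mathrm{DelayP}^{poly}$. -/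

import Mathlib

namespace EnumRAM

/-- Instructions of a random access machine whose registers `R 0, R 1, …` hold unbounded natural
numbers.  The arguments `i j l` are register numbers, `c` is a constant and `t` is a program line. -/
inductive Instr where
  /-- `R i := c` -/
  | const (i c : ℕ)
  /-- `R i := R j` -/
  | copy (i j : ℕ)
  /-- `R i := R (R j)` -/
  | load (i j : ℕ)
  /-- `R (R i) := R j` -/
  | store (i j : ℕ)
  /-- `R i := R j + R l` -/
  | add (i j l : ℕ)
  /-- `R i := R j - R l`, or `0` if this difference is negative -/
  | sub (i j l : ℕ)
  /-- `R i := R j * R l` -/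
  | mul (i j l : ℕ)
  /-- continue with line `t` -/
  | goto (t : ℕ)
  /-- if `R i ≤ R j` then continue with line `t` -/
  | jle (i j t : ℕ)
  /-- output the word `R a, R (a + 1), …, R b` where `a = R i` and `b = R j`
  (the empty word if `b < a`) -/
  | output (i j : ℕ)

/-- A machine is a finite program. -/
abbrev Machine := List Instr

/-- The length of a natural number: its number of binary digits (the length of `0` is `1`). -/
def len (v : ℕ) : ℕ := Nat.log 2 v + 1

/-- A configuration of a machine, together with the bookkeeping that the complexity measures need. -/
structure Config where
  /-- the current line of the program -/
  pc : ℕ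
  /-- the contents of the registers -/
  reg : ℕ → ℕ
  /-- the largest number of a register accessed so far -/
  top : ℕ
  /-- the time used so far -/
  time : ℕ
  /-- the words output so far, in order, each with the time at which its output was completed -/
  out : List (List ℕ × ℕ)

/-- The cost of an instruction on the given register contents: arithmetic instructions (including
comparison) cost the length of the sum of the numbers they are applied to, others cost `1`. -/
def Instr.cost (R : ℕ → ℕ) : Instr → ℕ
  | .add _ j l => len (R j + R l)
  | .sub _ j l => len (R j + R l)
  | .mul _ j l => len (R j + R l)
  | .jle i j _ => len (R i + R j)
  | _ => 1

/-- The largest number of a register accessed by an instruction (`0` if there is none). -/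
def Instr.maxAccess (R : ℕ → ℕ) : Instr → ℕ
  | .const i _ => i
  | .copy i j => max i j
  | .load i j => max (max i j) (R j)
  | .store i j => max (max i j) (R i)
  | .add i j l => max (max i j) l
  | .sub i j l => max (max i j) l
  | .mul i j l => max (max i j) l
  | .goto _ => 0
  | .jle i j _ => max i j
  | .output i j => if R i ≤ R j then max (max i j) (R j) else max i j

/-- The register contents after an instruction. -/
def Instr.write (R : ℕ → ℕ) : Instr → (ℕ → ℕ)
  | .const i c => Function.update R i c
  | .copy i j => Function.update R i (R j)
  | .load i j => Function.update R i (R (R j))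
  | .store i j => Function.update R (R i) (R j)
  | .add i j l => Function.update R i (R j + R l)
  | .sub i j l => Function.update R i (R j - R l)
  | .mul i j l => Function.update R i (R j * R l)
  | _ => R

/-- The program line that follows line `pc` when that line holds the given instruction. -/
def Instr.next (R : ℕ → ℕ) (pc : ℕ) : Instr → ℕ
  | .goto t => t
  | .jle i j t => if R i ≤ R j then t else pc + 1
  | _ => pc + 1

/-- The words (none or one) output by an instruction. -/
def Instr.emit (R : ℕ → ℕ) : Instr → List (List ℕ)
  | .output i j => [(List.range' (R i) (R j + 1 - R i)).map R]
  | _ => []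

/-- The effect of an instruction on a configuration. -/
def Instr.exec (I : Instr) (c : Config) : Config where
  pc := I.next c.reg c.pc
  reg := I.write c.reg
  top := max c.top (I.maxAccess c.reg)
  time := c.time + I.cost c.reg
  out := c.out ++ (I.emit c.reg).map fun w => (w, c.time + I.cost c.reg)

/-- A machine has halted when the current line is outside the program. -/
def Machine.Halted (M : Machine) (c : Config) : Prop := M.length ≤ c.pc

/-- One step of a machine; nothing happens once it has halted. -/
def Machine.step (M : Machine) (c : Config) : Config :=
  match M[c.pc]? with
  | some I => I.exec c
  | none => c

/-- The initial configuration on input `w`: the length of `w` is in register `0`, its letters are in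
the registers `1, …, w.length`, and all other registers are `0`. -/
def init (w : List ℕ) : Config where
  pc := 0
  reg := fun i => if i = 0 then w.length else w.getD (i - 1) 0
  top := w.length
  time := 0
  out := []

/-- The configuration of `M` on input `w` after `t` steps. -/
def Machine.run (M : Machine) (w : List ℕ) (t : ℕ) : Config := (M.step)^[t] (init w)

/-- `M` halts on input `w`, and `c` is its final configuration. -/
def Machine.HaltsOn (M : Machine) (w : List ℕ) (c : Config) : Prop :=
  ∃ t, M.run w t = c ∧ M.Halted c

/-- The space in use: the sum of the lengths of the numbers in the registers, up to the last register
accessed so far. -/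
def Config.space (c : Config) : ℕ := ∑ i ∈ Finset.range (c.top + 1), len (c.reg i)

/-- The words output so far. -/
def Config.words (c : Config) : List (List ℕ) := c.out.map Prod.fst

/-- For a final configuration, `c.T i` is the time at which the `i`th output was completed (`i ≥ 1`);
if there are fewer than `i` outputs, it is the time at which the machine halted. -/
def Config.T (c : Config) (i : ℕ) : ℕ := (c.out.map Prod.snd).getD (i - 1) c.time

/-- Words over the alphabet `{0, …, k - 1}`. -/
abbrev Word (k : ℕ) := List (Fin k)

/-- A word as a sequence of register contents, one letter per register. -/
def code {k : ℕ} (x : Word k) : List ℕ := x.map Fin.val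

/-- A binary predicate on words, given by the set `A x` of solutions of each instance `x`; it stands
for the problem of enumerating `A x` on input `x`. -/
abbrev Problem (k : ℕ) := Word k → Set (Word k)

/-- Solutions have a length polynomial in the length of the instance. -/
def PolyBalanced {k : ℕ} (A : Problem k) : Prop :=
  ∃ p : Polynomial ℕ, ∀ x, ∀ y ∈ A x, y.length ≤ p.eval x.length

/-- It is decidable in polynomial time, given `x` and `y`, whether `y ∈ A x`.  The pair is presented as
the word `x`, a separator letter `k`, the word `y`; the machine accepts by halting with `1` in
register `0`. -/
def TestInP {k : ℕ} (A : Problem k) : Prop :=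
  ∃ (M : Machine) (p : Polynomial ℕ), ∀ x y : Word k, ∃ c,
    M.HaltsOn (code x ++ k :: code y) c ∧
    c.time ≤ p.eval (x.length + y.length) ∧
    (c.reg 0 = 1 ↔ y ∈ A x)

/-- The class of enumeration problems with polynomially balanced and polynomial time testable
solutions. -/
def EnumP (k : ℕ) : Set (Problem k) := {A | PolyBalanced A ∧ TestInP A}

/-- `M` solves `A`: on every instance `x` it halts, it outputs exactly the elements of `A x`, without
repetition, and it stops as soon as it has output the last one. -/
def Machine.Solves {k : ℕ} (M : Machine) (A : Problem k) : Prop :=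
  ∀ x, ∃ c, M.HaltsOn (code x) c ∧
    c.words.Nodup ∧ {w | w ∈ c.words} = code '' A x ∧
    (∀ w t, (w, t) ∈ c.out.getLast? → t = c.time)

/-- On instances of size `n`, `M` uses at every point of its computation space at most `p n`, for
some polynomial `p`. -/
def Machine.PolySpace (k : ℕ) (M : Machine) : Prop :=
  ∃ p : Polynomial ℕ, ∀ (x : Word k) (t : ℕ), (M.run (code x) t).space ≤ p.eval x.length

/-- The preprocessing time of `M` is polynomial: the first solution is output (or, if there is none,
`M` halts) in time polynomial in the size of the instance. -/
def Machine.PolyPreprocessing (k : ℕ) (M : Machine) : Prop :=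
  ∃ p : Polynomial ℕ, ∀ (x : Word k) (c : Config), M.HaltsOn (code x) c → c.T 1 ≤ p.eval x.length

/-- `M` has incremental time `O(i ^ a * n ^ b)` for some `b`: the first `i` solutions on an instance of
size `n` are output in this time after the first one.  (`n + 1` instead of `n` only matters for the
empty instance.) -/
def Machine.IncTime {k : ℕ} (a : ℕ) (M : Machine) (A : Problem k) : Prop :=
  ∃ b C : ℕ, ∀ (x : Word k) (c : Config), M.HaltsOn (code x) c →
    ∀ i, 1 ≤ i → i ≤ (A x).ncard → c.T i ≤ c.T 1 + C * (i ^ a * (x.length + 1) ^ b)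

/-- The delay of `M`, the time between two consecutive outputs, is polynomial in the size of the
instance. -/
def Machine.PolyDelay {k : ℕ} (M : Machine) (A : Problem k) : Prop :=
  ∃ p : Polynomial ℕ, ∀ (x : Word k) (c : Config), M.HaltsOn (code x) c →
    ∀ i, 1 ≤ i → i < (A x).ncard → c.T (i + 1) ≤ c.T i + p.eval x.length

/-- The problems of `EnumP` solved by a machine with polynomial preprocessing, incremental time
`O(i ^ a * n ^ b)` for some `b`, and polynomial space. -/
def IncPPoly (k a : ℕ) : Set (Problem k) :=
  {A | A ∈ EnumP k ∧
    ∃ M : Machine, M.Solves A ∧ M.PolyPreprocessing k ∧ M.IncTime a A ∧ M.PolySpace k}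

/-- The problems of `EnumP` solved by a machine with polynomial preprocessing, polynomial delay and
polynomial space. -/
def DelayPPoly (k : ℕ) : Set (Problem k) :=
  {A | A ∈ EnumP k ∧
    ∃ M : Machine, M.Solves A ∧ M.PolyPreprocessing k ∧ M.PolyDelay A ∧ M.PolySpace k}

end EnumRAM

/-!
A machine with polynomial delay trivially has incremental time linear in the number of outputs
(`EnumRAM.delayPPoly_subset`). The converse is geometric amortization. Let `M` be a machine that
has made its first `i` outputs after at most `i * D` steps, for all `i`. A machine with polynomial
delay cannot store the outputs that come early, since there may be exponentially many; instead, it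
runs several copies of `M` side by side, and every output of `M` is the duty of one of them.

Let `B` be a polynomial upper bound for `2 * D`, the space used by `M`, and other quantities.
After the first output of `M` has been found (and held back), the processes `p = 2, …, B - 1` are
started from the configuration reached. Process `p` outputs the words that `M` produces in its
zone of steps, from about `2 ^ (B - 1 - p) * B` to about `2 ^ (B - p) * B` (`EnumRAM.Zone`). The
processes are run in the order `p = 2, 3, …`, that is, starting with the highest zone, each for
`2 * B` steps; as soon as a word is output, this starts again with process `2`. So a word is
output at least once in `B` shares of `2 * B` steps, which bounds the delay, and when all
processes have had their share without an output, the enumeration ends with the word held back, so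
that the machine halts with its last output.

The heart of the matter is that no output is missed (`EnumRAM.Sched.complete`). Every output made
in a zone below that of process `p` has brought process `p` a full share of `2 * B` steps, because
the processes of higher zones come first. By induction, when the loop ends, all outputs of the
lower zones have been made. As the number of outputs in the first `y` steps is at least about
`y / D`, process `p` has then made at least `2 * B` times `2 ^ (B - 1 - p)` steps, which carries
it to the end of its zone. There are fewer than `2 ^ (B - 2)` outputs, as solutions have
polynomial length, and hence the zones cover all outputs.

The rest is the implementation on the random access machine. Programs are written as structured
programs `EnumRAM.Prog`, which are compiled to instruction lists and have a semantics
`EnumRAM.Prog.eval` on registers. Memory is divided into regions of `B` cells; region `p` holds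
the program line, the step counter and the registers of process `p`, and region `1` those of the
first output. Time and space of the new machine are estimated along paths of checkpoints, at most
a constant number `q` of steps apart (`EnumRAM.Path`): invariants bound the registers at the
checkpoints by some `V = 2 ^ O(B)`, hence by `V ^ 2 ^ q` between them, the lengths of which are
polynomial.
-/

namespace EnumRAM

/-! ### Structured programs -/

/-- Structured programs, to be compiled to the instruction lists of the machine model. -/
inductive Prog where
  /-- the empty program -/
  | nop
  /-- a single instruction, meant to be neither `goto` nor `jle` -/
  | ins (I : Instr)
  /-- sequential composition -/
  | seq (P Q : Prog)
  /-- if `R i ≤ R j` then `P` else `Q` -/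
  | ite (i j : ℕ) (P Q : Prog)
  /-- do `P` while `R i ≤ R j` -/
  | rep (P : Prog) (i j : ℕ)

namespace Prog

/-- The number of instructions of the compiled program. -/
def size : Prog → ℕ
  | nop => 0
  | ins _ => 1
  | seq P Q => P.size + Q.size
  | ite _ _ P Q => Q.size + P.size + 2
  | rep P _ _ => P.size + 1

/-- The compiled program, when its first instruction is placed on line `a`.  The `P`-branch of a
conditional comes last, so that a program ending with such a branch halts right after it. -/
def code : Prog → ℕ → List Instr
  | nop, _ => []
  | ins I, _ => [I]
  | seq P Q, a => P.code a ++ Q.code (a + P.size)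
  | ite i j P Q, a => .jle i j (a + 1 + Q.size + 1) ::
      (Q.code (a + 1) ++ (.goto (a + 1 + Q.size + 1 + P.size) :: P.code (a + 1 + Q.size + 1)))
  | rep P i j, a => P.code a ++ [.jle i j a]

theorem length_code (P : Prog) (a : ℕ) : (P.code a).length = P.size := by
  induction P generalizing a with
  | nop => rfl
  | ins I => rfl
  | seq P Q hP hQ => simp [code, size, hP, hQ]
  | ite i j P Q hP hQ => simp [code, size, hP, hQ]; omega
  | rep P i j hP => simp [code, size, hP]

/-- Loop-free programs without explicit jumps. -/
def Flat : Prog → Prop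
  | nop => True
  | ins (.goto _) => False
  | ins (.jle _ _ _) => False
  | ins _ => True
  | seq P Q => P.Flat ∧ Q.Flat
  | ite _ _ P Q => P.Flat ∧ Q.Flat
  | rep _ _ _ => False

end Prog

/-- The part of a configuration that structured programs act on: registers, largest register number
accessed, and the words output. -/
structure St where
  /-- the contents of the registers -/
  reg : ℕ → ℕ
  /-- the largest number of a register accessed so far -/
  top : ℕ
  /-- the words output so far -/
  out : List (List ℕ)

/-- The structured state underlying a configuration. -/
def Config.st (c : Config) : St := ⟨c.reg, c.top, c.words⟩

/-- The effect of an instruction on a structured state. -/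
def Instr.eff (I : Instr) (σ : St) : St :=
  ⟨I.write σ.reg, max σ.top (I.maxAccess σ.reg), σ.out ++ I.emit σ.reg⟩

/-- The access of two registers by a comparison. -/
def St.touch (σ : St) (i j : ℕ) : St := ⟨σ.reg, max σ.top (max i j), σ.out⟩

/-- The effect of a loop-free program. -/
def Prog.eval : Prog → St → St
  | .nop, σ => σ
  | .ins I, σ => I.eff σ
  | .seq P Q, σ => Q.eval (P.eval σ)
  | .ite i j P Q, σ => if σ.reg i ≤ σ.reg j then P.eval (σ.touch i j) else Q.eval (σ.touch i j)
  | .rep _ _ _, σ => σ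

@[simp] theorem Prog.eval_nop (σ : St) : Prog.nop.eval σ = σ := rfl

@[simp] theorem Prog.eval_seq (P Q : Prog) (σ : St) : (P.seq Q).eval σ = Q.eval (P.eval σ) := rfl

theorem Prog.eval_ite_pos {i j : ℕ} {P Q : Prog} {σ : St} (h : σ.reg i ≤ σ.reg j) :
    (Prog.ite i j P Q).eval σ = P.eval (σ.touch i j) := if_pos h

theorem Prog.eval_ite_neg {i j : ℕ} {P Q : Prog} {σ : St} (h : ¬ σ.reg i ≤ σ.reg j) :
    (Prog.ite i j P Q).eval σ = Q.eval (σ.touch i j) := if_neg h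

@[simp] theorem St.touch_reg (σ : St) (i j : ℕ) : (σ.touch i j).reg = σ.reg := rfl

theorem St.touch_top {σ : St} {i j T : ℕ} (h : σ.top ≤ T) (hi : i ≤ T) (hj : j ≤ T) :
    (σ.touch i j).top ≤ T := max_le h (max_le hi hj)

/-- The states `σ` and `σ'` differ in that the number `v` has been written to register `d`, which
has involved no access beyond `T`. -/
structure Upd (T : ℕ) (σ σ' : St) (d v : ℕ) : Prop where
  self : σ'.reg d = v
  ne : ∀ e, e ≠ d → σ'.reg e = σ.reg e
  top : σ.top ≤ T → σ'.top ≤ T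
  out : σ'.out = σ.out

section Upd
variable {T : ℕ} (σ : St)

theorem Upd.of_write {I : Instr} {d v : ℕ} (hw : I.write σ.reg = Function.update σ.reg d v)
    (ha : I.maxAccess σ.reg ≤ T) (he : I.emit σ.reg = []) : Upd T σ (I.eff σ) d v where
  self := by show I.write σ.reg d = v; rw [hw, Function.update_self]
  ne e h := by show I.write σ.reg e = _; rw [hw, Function.update_of_ne h]
  top h := max_le h ha
  out := by simp [Instr.eff, he]

theorem Upd.const {i c : ℕ} (hi : i ≤ T) : Upd T σ ((Instr.const i c).eff σ) i c :=
  .of_write σ rfl hi rfl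

theorem Upd.copy {i j : ℕ} (hi : i ≤ T) (hj : j ≤ T) :
    Upd T σ ((Instr.copy i j).eff σ) i (σ.reg j) :=
  .of_write σ rfl (max_le hi hj) rfl

theorem Upd.load {i j : ℕ} (hi : i ≤ T) (hj : j ≤ T) (h : σ.reg j ≤ T) :
    Upd T σ ((Instr.load i j).eff σ) i (σ.reg (σ.reg j)) :=
  .of_write σ rfl (max_le (max_le hi hj) h) rfl

theorem Upd.store {i j : ℕ} (hi : i ≤ T) (hj : j ≤ T) (h : σ.reg i ≤ T) :
    Upd T σ ((Instr.store i j).eff σ) (σ.reg i) (σ.reg j) :=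
  .of_write σ rfl (max_le (max_le hi hj) h) rfl

theorem Upd.add {i j l : ℕ} (hi : i ≤ T) (hj : j ≤ T) (hl : l ≤ T) :
    Upd T σ ((Instr.add i j l).eff σ) i (σ.reg j + σ.reg l) :=
  .of_write σ rfl (max_le (max_le hi hj) hl) rfl

theorem Upd.sub {i j l : ℕ} (hi : i ≤ T) (hj : j ≤ T) (hl : l ≤ T) :
    Upd T σ ((Instr.sub i j l).eff σ) i (σ.reg j - σ.reg l) :=
  .of_write σ rfl (max_le (max_le hi hj) hl) rfl

theorem Upd.mul {i j l : ℕ} (hi : i ≤ T) (hj : j ≤ T) (hl : l ≤ T) :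
    Upd T σ ((Instr.mul i j l).eff σ) i (σ.reg j * σ.reg l) :=
  .of_write σ rfl (max_le (max_le hi hj) hl) rfl

theorem Upd.le {σ σ' : St} {d v V : ℕ} (u : Upd T σ σ' d v) (h : ∀ a, σ.reg a ≤ V) (hv : v ≤ V)
    (a : ℕ) : σ'.reg a ≤ V := by
  by_cases ha : a = d
  · rw [ha, u.self]; exact hv
  · rw [u.ne a ha]; exact h a

theorem top_output {i j : ℕ} (hi : i ≤ T) (hj : j ≤ T) (h : σ.reg i ≤ σ.reg j → σ.reg j ≤ T)
    (htop : σ.top ≤ T) : ((Instr.output i j).eff σ).top ≤ T := by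
  refine max_le htop ?_
  simp only [Instr.maxAccess]
  split_ifs with hh
  · exact max_le (max_le hi hj) (h hh)
  · exact max_le hi hj

end Upd

/-- The instructions `L` are found in `M` from line `a` on. -/
def CodeAt (M : Machine) (a : ℕ) (L : List Instr) : Prop :=
  ∃ L₁ L₂, M = L₁ ++ L ++ L₂ ∧ L₁.length = a

theorem CodeAt.left {M : Machine} {a : ℕ} {L L' : List Instr} (h : CodeAt M a (L ++ L')) :
    CodeAt M a L := by
  obtain ⟨L₁, L₂, h, rfl⟩ := h
  exact ⟨L₁, L' ++ L₂, by simp [h], rfl⟩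

theorem CodeAt.right {M : Machine} {a : ℕ} {L L' : List Instr} (h : CodeAt M a (L ++ L')) :
    CodeAt M (a + L.length) L' := by
  obtain ⟨L₁, L₂, h, rfl⟩ := h
  exact ⟨L₁ ++ L, L₂, by simp [h], by simp⟩

theorem CodeAt.get {M : Machine} {a : ℕ} {I : Instr} {L : List Instr} (h : CodeAt M a (I :: L)) :
    M[a]? = some I := by
  obtain ⟨L₁, L₂, rfl, rfl⟩ := h
  simp

theorem CodeAt.tail {M : Machine} {a : ℕ} {I : Instr} {L : List Instr} (h : CodeAt M a (I :: L)) :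
    CodeAt M (a + 1) L := CodeAt.right (L := [I]) h

theorem CodeAt.seq_left {M : Machine} {a : ℕ} {P Q : Prog} (h : CodeAt M a ((P.seq Q).code a)) :
    CodeAt M a (P.code a) := CodeAt.left h

theorem CodeAt.seq_right {M : Machine} {a : ℕ} {P Q : Prog} (h : CodeAt M a ((P.seq Q).code a)) :
    CodeAt M (a + P.size) (Q.code (a + P.size)) := by
  have := CodeAt.right h
  rwa [Prog.length_code] at this

theorem step_of_get {M : Machine} {c : Config} {I : Instr} (h : M[c.pc]? = some I) :
    M.step c = I.exec c := by
  simp [Machine.step, h]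

/-- `M` gets from `c` to `c'` in at most `n` steps; the outputs made on the way carry times between
those of `c` and `c'`. -/
def Moves (M : Machine) (n : ℕ) (c c' : Config) : Prop :=
  (∃ m ≤ n, M.step^[m] c = c') ∧ c.time ≤ c'.time ∧
    ∃ ts, c'.out = c.out ++ ts ∧ ∀ p ∈ ts, c.time ≤ p.2 ∧ p.2 ≤ c'.time

theorem Moves.refl (M : Machine) (c : Config) : Moves M 0 c c :=
  ⟨⟨0, le_rfl, rfl⟩, le_rfl, [], by simp, by simp⟩

theorem Moves.trans {M : Machine} {n n' : ℕ} {c c' c'' : Config} (h : Moves M n c c')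
    (h' : Moves M n' c' c'') : Moves M (n + n') c c'' := by
  obtain ⟨⟨m, hm, e⟩, ht, ts, ho, hts⟩ := h
  obtain ⟨⟨m', hm', e'⟩, ht', ts', ho', hts'⟩ := h'
  refine ⟨⟨m' + m, by omega, by rw [Function.iterate_add_apply, e, e']⟩, ht.trans ht',
    ts ++ ts', by simp [ho, ho'], ?_⟩
  intro p hp
  rcases List.mem_append.1 hp with hp | hp
  · exact ⟨(hts p hp).1, (hts p hp).2.trans ht'⟩
  · exact ⟨ht.trans (hts' p hp).1, (hts' p hp).2⟩

theorem Moves.mono {M : Machine} {n n' : ℕ} {c c' : Config} (h : Moves M n c c') (hn : n ≤ n') :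
    Moves M n' c c' := by
  obtain ⟨⟨m, hm, e⟩, h⟩ := h
  exact ⟨⟨m, hm.trans hn, e⟩, h⟩

theorem Moves.single {M : Machine} {c : Config} {I : Instr} (h : M[c.pc]? = some I) :
    Moves M 1 c (I.exec c) := by
  refine ⟨⟨1, le_rfl, by simp [step_of_get h]⟩, by simp [Instr.exec], _, rfl, ?_⟩
  simp only [List.mem_map]
  rintro p ⟨w, -, rfl⟩
  simp [Instr.exec]

theorem st_exec (I : Instr) (c : Config) : (I.exec c).st = I.eff c.st := by
  simp [Instr.exec, Instr.eff, Config.st, Config.words, Function.comp_def]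

theorem exec_pc (I : Instr) (c : Config) : (I.exec c).pc = I.next c.reg c.pc := rfl

/-- Compiled loop-free programs do what `Prog.eval` says. -/
theorem Prog.run_eval {M : Machine} (P : Prog) (hP : P.Flat) :
    ∀ (a : ℕ) (c : Config), CodeAt M a (P.code a) → c.pc = a →
      ∃ c', Moves M P.size c c' ∧ c'.pc = a + P.size ∧ c'.st = P.eval c.st := by
  induction P with
  | nop => exact fun a c _ hc => ⟨c, Moves.refl M c, by simpa [size] using hc, rfl⟩
  | ins I =>
    intro a c h hc
    refine ⟨I.exec c, Moves.single (by rw [hc]; exact h.get), ?_, st_exec I c⟩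
    rw [exec_pc, hc]
    cases I <;> first | rfl | exact hP.elim
  | seq P Q ihP ihQ =>
    intro a c h hc
    obtain ⟨c₁, m₁, p₁, e₁⟩ := ihP hP.1 a c h.seq_left hc
    obtain ⟨c₂, m₂, p₂, e₂⟩ := ihQ hP.2 (a + P.size) c₁ h.seq_right p₁
    exact ⟨c₂, m₁.trans m₂, by simp [size, p₂, add_assoc], by rw [e₂, e₁, eval]⟩
  | ite i j P Q ihP ihQ =>
    intro a c h hc
    have g₀ := h.get
    have hQ := h.tail.left
    have h₂ := h.tail.right
    rw [length_code] at h₂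
    have g₁ := h₂.get
    have hP' := h₂.tail
    have m₀ : Moves M 1 c _ := Moves.single (by rw [hc]; exact g₀)
    have e₀ := st_exec (.jle i j (a + 1 + Q.size + 1)) c
    have p₀ := exec_pc (.jle i j (a + 1 + Q.size + 1)) c
    generalize (Instr.jle i j (a + 1 + Q.size + 1)).exec c = c₀ at m₀ e₀ p₀
    have e₀' : c₀.st = c.st.touch i j := by
      rw [e₀]; simp [Instr.eff, St.touch, Instr.write, Instr.emit, Instr.maxAccess]
    simp only [Instr.next] at p₀
    by_cases hij : c.reg i ≤ c.reg j
    · rw [if_pos hij] at p₀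
      obtain ⟨c₁, m₁, p₁, e₁⟩ := ihP hP.1 _ c₀ hP' p₀
      refine ⟨c₁, (m₀.trans m₁).mono (by simp [size]; omega), by simp [size, p₁]; omega, ?_⟩
      rw [e₁, e₀', eval]
      exact (if_pos hij).symm
    · rw [if_neg hij, hc] at p₀
      obtain ⟨c₁, m₁, p₁, e₁⟩ := ihQ hP.2 _ c₀ hQ p₀
      have m₂ : Moves M 1 c₁ _ := Moves.single (by rw [p₁]; exact g₁)
      refine ⟨_, ((m₀.trans m₁).trans m₂).mono (by simp [size]; omega), ?_, ?_⟩
      · simp [exec_pc, Instr.next, size]; omega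
      · rw [st_exec, e₁, e₀', eval]
        refine Eq.trans ?_ (if_neg hij).symm
        simp [Instr.eff, Instr.write, Instr.emit, Instr.maxAccess]
  | rep P i j ih => exact hP.elim

/-- One round of a loop: the body is executed, and the test decides where to continue. -/
theorem Prog.run_rep {M : Machine} (P : Prog) (hP : P.Flat) (i j a : ℕ) (c : Config)
    (h : CodeAt M a ((P.rep i j).code a)) (hc : c.pc = a) :
    ∃ c', Moves M (P.size + 1) c c' ∧ c'.st = (P.eval c.st).touch i j ∧
      c'.pc = if c'.reg i ≤ c'.reg j then a else a + (P.rep i j).size := by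
  obtain ⟨c₁, m₁, p₁, e₁⟩ := P.run_eval hP a c (CodeAt.left h) hc
  have h₂ := CodeAt.right h
  rw [length_code] at h₂
  have m₂ : Moves M 1 c₁ _ := Moves.single (by rw [p₁]; exact h₂.get)
  refine ⟨_, m₁.trans m₂, ?_, ?_⟩
  · rw [st_exec, e₁]; simp [Instr.eff, Instr.write, Instr.emit, Instr.maxAccess, St.touch]
  · simp [Instr.next, Instr.exec, Instr.write, p₁, size, add_assoc]

/-! ### Bounded growth between checkpoints -/

/-- All registers hold numbers at most `V`, and no register beyond `T` has been accessed. -/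
def Good (V T : ℕ) (σ : St) : Prop := (∀ i, σ.reg i ≤ V) ∧ σ.top ≤ T

/-- All constants in the program are at most `V`. -/
def Machine.ConstLE (M : Machine) (V : ℕ) : Prop := ∀ i v, Instr.const i v ∈ M → v ≤ V

theorem Machine.exists_constLE (M : Machine) : ∃ V, M.ConstLE V := by
  induction M with
  | nil => exact ⟨0, by simp [ConstLE]⟩
  | cons I M ih =>
    obtain ⟨V, hV⟩ := ih
    cases I with
    | const i v =>
      refine ⟨max v V, fun i' v' h => ?_⟩
      rcases List.mem_cons.1 h with h | h
      · cases h; simp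
      · exact (hV i' v' h).trans (le_max_right _ _)
    | _ => exact ⟨V, fun i' v' h => hV i' v' (by simpa using h)⟩

theorem reg_step_le {M : Machine} {U V : ℕ} (hM : M.ConstLE U) (hU : U ≤ V) (h2 : 2 ≤ V)
    {c : Config} (h : ∀ i, c.reg i ≤ V) (i : ℕ) : (M.step c).reg i ≤ V ^ 2 := by
  have hV : V ≤ V ^ 2 := by nlinarith
  unfold Machine.step
  split
  case h_2 => exact (h i).trans hV
  case h_1 I hI =>
    have hmem := List.mem_of_getElem? hI
    cases I <;> simp only [Instr.exec, Instr.write, Function.update_apply] <;>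
      try exact (h i).trans hV
    case const a v =>
      split_ifs
      · exact ((hM _ _ hmem).trans hU).trans hV
      · exact (h i).trans hV
    case copy => split_ifs <;> exact (h _).trans hV
    case load => split_ifs <;> exact (h _).trans hV
    case store => split_ifs <;> exact (h _).trans hV
    case add a j l =>
      split_ifs
      · have := h j; have := h l; nlinarith
      · exact (h i).trans hV
    case sub a j l =>
      split_ifs
      · exact (Nat.sub_le _ _).trans ((h _).trans hV)
      · exact (h i).trans hV
    case mul a j l =>
      split_ifs
      · rw [sq]; exact Nat.mul_le_mul (h j) (h l)
      · exact (h i).trans hV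

/-- Each step at most squares the largest number in a register. -/
theorem reg_iterate_le {M : Machine} {V : ℕ} (hM : M.ConstLE V) (h2 : 2 ≤ V)
    {c : Config} (h : ∀ i, c.reg i ≤ V) (s : ℕ) :
    ∀ i, (M.step^[s] c).reg i ≤ V ^ 2 ^ s := by
  induction s with
  | zero => simpa using h
  | succ s ih =>
    intro i
    have hV : V ≤ V ^ 2 ^ s := Nat.le_self_pow (by positivity) V
    have := reg_step_le hM hV (h2.trans hV) ih i
    rw [Function.iterate_succ_apply', pow_succ, pow_mul]
    exact this

theorem len_mono {a b : ℕ} (h : a ≤ b) : len a ≤ len b := by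
  unfold len; have := Nat.log_mono_right (b := 2) h; omega

theorem one_le_len (a : ℕ) : 1 ≤ len a := by simp [len]

theorem cost_pos (R : ℕ → ℕ) (I : Instr) : 1 ≤ I.cost R := by
  cases I <;> simp [Instr.cost, len]

theorem cost_le {R : ℕ → ℕ} {V : ℕ} (h : ∀ i, R i ≤ V) (I : Instr) : I.cost R ≤ len (2 * V) := by
  cases I <;> simp only [Instr.cost] <;> first
    | exact one_le_len _
    | exact len_mono (by rw [two_mul]; exact add_le_add (h _) (h _))

theorem time_step_le {M : Machine} {V : ℕ} {c : Config} (h : ∀ i, c.reg i ≤ V) :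
    (M.step c).time ≤ c.time + len (2 * V) := by
  unfold Machine.step
  split
  · exact Nat.add_le_add_left (cost_le h _) _
  · simp

/-- An upper bound for the time of `q` steps from registers holding numbers at most `V`. -/
def hopTime (V q : ℕ) : ℕ := q * len (2 * V ^ 2 ^ q)

theorem time_iterate_le {M : Machine} {V : ℕ} (hM : M.ConstLE V) (h2 : 2 ≤ V)
    {c : Config} (h : ∀ i, c.reg i ≤ V) {m q : ℕ} (hm : m ≤ q) :
    (M.step^[m] c).time ≤ c.time + hopTime V q := by
  have key : ∀ m ≤ q, (M.step^[m] c).time ≤ c.time + m * len (2 * V ^ 2 ^ q) := by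
    intro m
    induction m with
    | zero => simp
    | succ m ih =>
      intro hm
      have h₁ : ∀ i, (M.step^[m] c).reg i ≤ V ^ 2 ^ q := fun i =>
        (reg_iterate_le hM h2 h m i).trans
          (Nat.pow_le_pow_right (by omega) (Nat.pow_le_pow_right (by omega) (by omega)))
      rw [Function.iterate_succ_apply']
      have := time_step_le (M := M) h₁
      have := ih (by omega)
      rw [Nat.succ_mul]
      omega
  exact (key m hm).trans (Nat.add_le_add_left (Nat.mul_le_mul_right _ hm) _)

theorem top_step (M : Machine) (c : Config) : c.top ≤ (M.step c).top := by
  unfold Machine.step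
  split
  · exact le_max_left _ _
  · exact le_rfl

theorem top_iterate (M : Machine) (c : Config) (s : ℕ) : c.top ≤ (M.step^[s] c).top := by
  induction s with
  | zero => exact le_rfl
  | succ s ih => rw [Function.iterate_succ_apply']; exact ih.trans (top_step _ _)

theorem space_le {c : Config} {V T : ℕ} (hr : ∀ i, c.reg i ≤ V) (ht : c.top ≤ T) :
    c.space ≤ (T + 1) * len V := by
  unfold Config.space
  calc _ ≤ ∑ i ∈ Finset.range (c.top + 1), len V := Finset.sum_le_sum fun i _ => len_mono (hr i)
    _ = (c.top + 1) * len V := by simp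
    _ ≤ _ := Nat.mul_le_mul_right _ (by omega)

/-- `M` gets from `c` to `c'` while passing, at least every `q` steps, through a configuration with
numbers at most `V` in the registers; registers beyond `T` are not accessed. -/
inductive Path (M : Machine) (V T q : ℕ) : Config → Config → Prop
  | refl (c : Config) : Good V T c.st → Path M V T q c c
  | head {c c₁ c' : Config} : Good V T c.st → Moves M q c c₁ → Path M V T q c₁ c' → Path M V T q c
    c'

section Path
variable {M : Machine} {V T q : ℕ} {c c' c'' : Config}

theorem Path.good_left (h : Path M V T q c c') : Good V T c.st := by
  cases h <;> assumption

theorem Path.trans (h : Path M V T q c c') (h' : Path M V T q c' c'') : Path M V T q c c'' := by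
  induction h with
  | refl => exact h'
  | head g m _ ih => exact .head g m (ih h')

theorem Path.of_moves (h : Moves M q c c') (g : Good V T c.st) (g' : Good V T c'.st) :
    Path M V T q c c' := .head g h (.refl _ g')

/-- A hop takes a time that is bounded in terms of its number of steps and of the numbers in the
registers at its beginning. -/
theorem Moves.time_le {n : ℕ} (hM : M.ConstLE V) (h2 : 2 ≤ V) (h : Moves M n c c') (hn : n ≤ q)
    (g : Good V T c.st) : c'.time ≤ c.time + hopTime V q := by
  obtain ⟨⟨m, hm, rfl⟩, -⟩ := h
  exact time_iterate_le hM h2 g.1 (hm.trans hn)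

theorem Path.reaches (h : Path M V T q c c') : ∃ t, M.step^[t] c = c' := by
  induction h with
  | refl c _ => exact ⟨0, rfl⟩
  | head _ m _ ih =>
    obtain ⟨⟨m, -, e⟩, -⟩ := m
    obtain ⟨t, e'⟩ := ih
    exact ⟨t + m, by rw [Function.iterate_add_apply, e, e']⟩

theorem step_of_halted (h : M.Halted c) : M.step c = c := by
  simp [Machine.step, List.getElem?_eq_none h]

theorem iterate_of_halted (h : M.Halted c) (t : ℕ) : M.step^[t] c = c :=
  Function.iterate_fixed (step_of_halted h) t

/-- The space bound along a path that ends with the machine halted. -/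
theorem Path.space_le (hM : M.ConstLE V) (h2 : 2 ≤ V) (h : Path M V T q c c') (hc : M.Halted c')
    (t : ℕ) : (M.step^[t] c).space ≤ (T + 1) * len (V ^ 2 ^ q) := by
  have big : V ≤ V ^ 2 ^ q := Nat.le_self_pow (by positivity) V
  induction h generalizing t with
  | refl c g =>
    rw [iterate_of_halted hc]
    exact EnumRAM.space_le (fun i => (g.1 i).trans big) g.2
  | @head c c₁ c' g m p ih =>
    obtain ⟨⟨m, hm, e⟩, -⟩ := m
    by_cases htm : m ≤ t
    · obtain ⟨s, rfl⟩ := Nat.exists_eq_add_of_le' htm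
      rw [Function.iterate_add_apply, e]
      exact ih hc s
    · refine EnumRAM.space_le (fun i => (reg_iterate_le hM h2 g.1 t i).trans ?_) ?_
      · exact Nat.pow_le_pow_right (by omega) (Nat.pow_le_pow_right (by omega) (by omega))
      · have h1 := top_iterate M (M.step^[t] c) (m - t)
        rw [← Function.iterate_add_apply, Nat.sub_add_cancel (by omega), e] at h1
        exact h1.trans p.good_left.2

/-- `M` gets from `c` to `c'` without output along a path of at most `k` hops. -/
structure Leads (M : Machine) (V T q k : ℕ) (c c' : Config) : Prop where
  path : Path M V T q c c'
  out : c'.out = c.out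
  time : c'.time ≤ c.time + k * hopTime V q

theorem Leads.trans {k k' : ℕ} (h : Leads M V T q k c c') (h' : Leads M V T q k' c' c'') :
    Leads M V T q (k + k') c c'' where
  path := h.path.trans h'.path
  out := h'.out.trans h.out
  time := by have := h.time; have := h'.time; rw [Nat.add_mul]; omega

theorem Leads.mono {k k' : ℕ} (h : Leads M V T q k c c') (hk : k ≤ k') : Leads M V T q k' c c' where
  path := h.path
  out := h.out
  time := h.time.trans (Nat.add_le_add_left (Nat.mul_le_mul_right _ hk) _)

theorem Leads.of_moves {n : ℕ} (hM : M.ConstLE V) (h2 : 2 ≤ V) (h : Moves M n c c') (hn : n ≤ q)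
    (g : Good V T c.st) (g' : Good V T c'.st) (ho : c'.st.out = c.st.out) :
    Leads M V T q 1 c c' := by
  refine ⟨.of_moves (h.mono hn) g g', ?_, by simpa using h.time_le hM h2 hn g⟩
  obtain ⟨-, -, ts, e, -⟩ := h
  have : ts = [] := by simpa [Config.st, Config.words, e] using ho
  simpa [this] using e

/-- A loop-free program without output is a single hop. -/
theorem Leads.flat (hM : M.ConstLE V) (h2 : 2 ≤ V) {P : Prog} (hP : P.Flat) {a : ℕ}
    (h : CodeAt M a (P.code a)) (hq : P.size ≤ q) (hc : c.pc = a) (g : Good V T c.st)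
    (g' : Good V T (P.eval c.st)) (ho : (P.eval c.st).out = c.st.out) :
    ∃ c', Leads M V T q 1 c c' ∧ c'.pc = a + P.size ∧ c'.st = P.eval c.st := by
  obtain ⟨c', m, p, e⟩ := P.run_eval hP a c h hc
  exact ⟨c', .of_moves hM h2 m hq g (e ▸ g') (e ▸ ho), p, e⟩

/-- A loop with an invariant `I`, indexed by the number of rounds made, that exits after `K`
rounds. -/
theorem Leads.rep (hM : M.ConstLE V) (h2 : 2 ≤ V) {P : Prog} (hP : P.Flat) {a i j : ℕ}
    (h : CodeAt M a ((P.rep i j).code a)) (hq : P.size + 1 ≤ q) (I : ℕ → St → Prop) (K : ℕ)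
    (hI : ∀ n < K, ∀ σ, I n σ → I (n + 1) ((P.eval σ).touch i j) ∧ (P.eval σ).out = σ.out ∧
      ((P.eval σ).reg i ≤ (P.eval σ).reg j ↔ n + 1 < K))
    (hg : ∀ n σ, I n σ → Good V T σ) :
    ∀ n < K, ∀ c : Config, c.pc = a → I n c.st →
      ∃ c', Leads M V T q (K - n) c c' ∧ c'.pc = a + (P.rep i j).size ∧ I K c'.st := by
  intro n hn
  induction hd : K - n generalizing n with
  | zero => omega
  | succ d ih =>
    intro c hc hIc
    obtain ⟨c₁, m, e, p⟩ := P.run_rep hP i j a c h hc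
    obtain ⟨i₁, o₁, b₁⟩ := hI n hn c.st hIc
    rw [← e] at i₁
    have l₁ : Leads M V T q 1 c c₁ :=
      .of_moves hM h2 m hq (hg _ _ hIc) (hg _ _ i₁) (by rw [e]; exact o₁)
    have hr : c₁.reg = (P.eval c.st).reg := congrArg St.reg e
    rw [hr] at p
    by_cases hK : n + 1 < K
    · rw [if_pos (b₁.2 hK)] at p
      obtain ⟨c', l, p', i'⟩ := ih (n + 1) hK (by omega) c₁ p i₁
      exact ⟨c', (l₁.trans l).mono (by omega), p', i'⟩
    · rw [if_neg (fun hh => hK (b₁.1 hh))] at p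
      have : n + 1 = K := by omega
      exact ⟨c₁, l₁.mono (by omega), p, this ▸ i₁⟩

end Path

/-! ### Runs of a machine -/

section Runs
variable {M : Machine} {w : List ℕ}

theorem run_succ (M : Machine) (w : List ℕ) (t : ℕ) : M.run w (t + 1) = M.step (M.run w t) :=
  Function.iterate_succ_apply' _ _ _

theorem run_add (M : Machine) (w : List ℕ) (s t : ℕ) :
    M.run w (s + t) = M.step^[t] (M.run w s) := by
  rw [add_comm]; exact Function.iterate_add_apply _ _ _ _

theorem run_of_halted {s t : ℕ} (h : M.Halted (M.run w s)) (hst : s ≤ t) :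
    M.run w t = M.run w s := by
  obtain ⟨d, rfl⟩ := Nat.exists_eq_add_of_le hst
  rw [run_add, iterate_of_halted h]

theorem HaltsOn.unique {c c' : Config} (h : M.HaltsOn w c) (h' : M.HaltsOn w c') : c = c' := by
  obtain ⟨t, rfl, ht⟩ := h
  obtain ⟨t', rfl, ht'⟩ := h'
  rcases le_total t t' with hh | hh
  · exact (run_of_halted ht hh).symm
  · exact run_of_halted ht' hh

/-- The kind of the next step: `1` if there is none, since `M` has halted, `2` if it is an output,
and `0` otherwise. -/
def Machine.flag (M : Machine) (c : Config) : ℕ :=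
  match M[c.pc]? with
  | none => 1
  | some (.output _ _) => 2
  | some _ => 0

/-- The words (none or one) output in the next step. -/
def Machine.emits (M : Machine) (c : Config) : List (List ℕ) :=
  match M[c.pc]? with
  | none => []
  | some I => I.emit c.reg

/-- The word output in the next step (empty if there is none). -/
def Machine.word (M : Machine) (c : Config) : List ℕ := (M.emits c).headD []

theorem flag_eq_one {c : Config} : M.flag c = 1 ↔ M.Halted c := by
  unfold Machine.flag Machine.Halted
  rw [← List.getElem?_eq_none_iff]
  split <;> simp_all

theorem emits_of_flag {c : Config} (h : M.flag c = 2) : M.emits c = [M.word c] := by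
  unfold Machine.flag at h
  unfold Machine.word Machine.emits
  split at h <;> simp_all [Instr.emit]

theorem emits_of_not_flag {c : Config} (h : M.flag c ≠ 2) : M.emits c = [] := by
  unfold Machine.flag at h
  unfold Machine.emits
  split at h
  case h_1 e => simp [e]
  case h_2 => simp at h
  case h_3 I hI e =>
    rw [e]
    cases I <;> first | rfl | exact (hI _ _ rfl).elim

theorem words_step (c : Config) : (M.step c).words = c.words ++ M.emits c := by
  unfold Machine.step Machine.emits
  split <;> simp_all [Instr.exec, Config.words, Function.comp_def]

/-- The words output after step `s₁`, by the steps at which they are output. -/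
theorem words_run_add (M : Machine) (w : List ℕ) (s₁ s : ℕ) :
    (M.run w (s₁ + s)).words = (M.run w s₁).words ++
      ((List.range s).filter fun s => M.flag (M.run w (s₁ + s)) = 2).map
        fun s => M.word (M.run w (s₁ + s)) := by
  induction s with
  | zero => simp
  | succ s ih =>
    rw [← add_assoc, run_succ, words_step, ih, List.range_succ, List.filter_append, List.map_append,
      List.append_assoc]
    congr 2
    by_cases h : M.flag (M.run w (s₁ + s)) = 2
    · simp [h, emits_of_flag h]
    · simp [h, emits_of_not_flag h]

theorem time_step_lt {c : Config} (h : ¬ M.Halted c) : c.time < (M.step c).time := by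
  unfold Machine.Halted at h
  push Not at h
  rw [step_of_get (List.getElem?_eq_getElem h)]
  have := cost_pos c.reg M[c.pc]
  simp only [Instr.exec]
  omega

theorem time_step_ge (c : Config) : c.time ≤ (M.step c).time := by
  by_cases h : M.Halted c
  · rw [step_of_halted h]
  · exact (time_step_lt h).le

theorem time_mono {s t : ℕ} (h : s ≤ t) : (M.run w s).time ≤ (M.run w t).time :=
  monotone_nat_of_le_succ (f := fun s => (M.run w s).time)
    (fun s => by simp only [run_succ]; exact time_step_ge _) h

theorem time_lt {s t : ℕ} (h : s < t) (hs : ¬ M.Halted (M.run w s)) :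
    (M.run w s).time < (M.run w t).time := by
  have := time_step_lt hs
  rw [← run_succ] at this
  exact this.trans_le (time_mono h)

theorem le_time {s : ℕ} (h : ¬ M.Halted (M.run w s)) : s ≤ (M.run w s).time := by
  induction s with
  | zero => simp
  | succ s ih =>
    have hs : ¬ M.Halted (M.run w s) := fun hh => h (by rwa [run_of_halted hh (Nat.le_succ s)])
    have := ih hs
    have := time_lt (show s < s + 1 by omega) hs
    omega

/-- Later outputs are appended, with later times. -/
theorem out_mono {s t : ℕ} (h : s ≤ t) : ∃ ts, (M.run w t).out = (M.run w s).out ++ ts ∧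
    ∀ p ∈ ts, (M.run w s).time < p.2 := by
  induction t, h using Nat.le_induction with
  | base => exact ⟨[], by simp, by simp⟩
  | succ t h ih =>
    obtain ⟨ts, e, hts⟩ := ih
    rw [run_succ]
    by_cases hh : M.Halted (M.run w t)
    · exact ⟨ts, by rw [step_of_halted hh, e], hts⟩
    · have hlt := time_mono (M := M) (w := w) h
      unfold Machine.Halted at hh
      push Not at hh
      rw [step_of_get (List.getElem?_eq_getElem hh)]
      refine ⟨ts ++ _, by simp only [Instr.exec]; rw [e, List.append_assoc], ?_⟩
      intro p hp
      rcases List.mem_append.1 hp with hp | hp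
      · exact hts p hp
      · obtain ⟨u, -, rfl⟩ := List.mem_map.1 hp
        have := cost_pos (M.run w t).reg M[(M.run w t).pc]
        show _ < _ + _
        omega

theorem out_time_le {s : ℕ} : ∀ p ∈ (M.run w s).out, p.2 ≤ (M.run w s).time := by
  induction s with
  | zero => simp [Machine.run, init]
  | succ s ih =>
    have hlt := time_step_ge (M := M) (M.run w s)
    rw [run_succ]
    unfold Machine.step at hlt ⊢
    split at hlt
    case h_2 e => simpa using ih
    case h_1 I e =>
      intro p hp
      rcases List.mem_append.1 hp with hp | hp
      · exact (ih p hp).trans hlt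
      · obtain ⟨u, -, rfl⟩ := List.mem_map.1 hp
        exact le_rfl

/-- If the `i`th output is completed in time `i * D`, then the number of steps made is bounded in
terms of the number of outputs made, as long as the machine is running. -/
theorem steps_lt {c : Config} {D : ℕ} (hc : M.HaltsOn w c)
    (hlast : ∀ u t, (u, t) ∈ c.out.getLast? → t = c.time) (h1 : c.T 1 ≤ D)
    (hT : ∀ i, 1 ≤ i → i ≤ c.out.length → c.T i ≤ i * D) (s : ℕ) (hs : ¬ M.Halted (M.run w s)) :
    s < ((M.run w s).out.length + 1) * D := by
  obtain ⟨t, rfl, ht⟩ := hc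
  have hst : s < t := by
    by_contra! h
    exact hs (by rwa [run_of_halted ht h])
  have hle := le_time hs
  have hlt := time_lt hst hs
  obtain ⟨ts, e, hts⟩ := out_mono (M := M) (w := w) hst.le
  rcases ts with _ | ⟨p, ts⟩
  · rw [List.append_nil] at e
    rcases List.eq_nil_or_concat (M.run w t).out with h0 | ⟨L, ⟨u, τ⟩, h0⟩
    · have : (M.run w s).out = [] := by rw [← e, h0]
      simp only [Config.T, h0, List.map_nil, List.getD_nil] at h1
      simp only [this, List.length_nil]
      omega
    · have h3 := hlast u τ (by simp [h0])
      have h4 := out_time_le (M := M) (w := w) (s := s) (u, τ) (by rw [← e, h0]; simp)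
      simp only at h4
      omega
  · have := hT ((M.run w s).out.length + 1) (by omega) (by simp [e])
    have h5 := hts p (by simp)
    have h6 : (M.run w t).T ((M.run w s).out.length + 1) = p.2 := by
      simp [Config.T, e, List.getD_eq_getElem?_getD]
    omega

theorem reg_eq_zero_of_top_lt (s i : ℕ) (h : (M.run w s).top < i) : (M.run w s).reg i = 0 := by
  induction s generalizing i with
  | zero =>
    simp only [Machine.run, Function.iterate_zero, id, init] at h ⊢
    rw [if_neg (by omega), List.getD_eq_default _ _ (by omega)]
  | succ s ih =>
    rw [run_succ] at h ⊢
    unfold Machine.step at h ⊢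
    split at h
    case h_2 e => simpa using ih i h
    case h_1 I e =>
      simp only [Instr.exec, max_lt_iff] at h
      obtain ⟨h, h'⟩ := h
      have := ih i h
      cases I <;> simp only [Instr.exec, Instr.write, Instr.maxAccess, max_lt_iff] at h' ⊢ <;>
        first
        | assumption
        | rw [Function.update_of_ne (by omega)]; assumption

theorem lt_two_pow_len (v : ℕ) : v < 2 ^ len v := Nat.lt_pow_succ_log_self (by norm_num) v

theorem top_lt_space (c : Config) : c.top < c.space := by
  unfold Config.space
  calc c.top < ∑ i ∈ Finset.range (c.top + 1), 1 := by simp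
    _ ≤ _ := Finset.sum_le_sum fun i _ => one_le_len _

theorem reg_run_lt (s i : ℕ) : (M.run w s).reg i < 2 ^ (M.run w s).space := by
  by_cases h : i ≤ (M.run w s).top
  · refine (lt_two_pow_len _).trans_le (Nat.pow_le_pow_right (by norm_num) ?_)
    exact Finset.single_le_sum (f := fun i => len ((M.run w s).reg i)) (fun _ _ => Nat.zero_le _)
      (Finset.mem_range.2 (by omega))
  · rw [reg_eq_zero_of_top_lt s i (by omega)]
    positivity

/-- The line numbers that occur in runs of a machine are bounded. -/
theorem exists_pc_le (M : Machine) : ∃ U, ∀ w s, (M.run w s).pc ≤ U := by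
  have key : ∀ L : List Instr, ∃ U, ∀ I ∈ L, ∀ R pc, I.next R pc ≤ max (pc + 1) U := by
    intro L
    induction L with
    | nil => exact ⟨0, by simp⟩
    | cons I L ih =>
      obtain ⟨U, hU⟩ := ih
      obtain ⟨t, ht⟩ : ∃ t, ∀ R pc, I.next R pc ≤ max (pc + 1) t := by
        cases I with
        | goto t => exact ⟨t, fun R pc => le_max_right _ _⟩
        | jle i j t =>
          refine ⟨t, fun R pc => ?_⟩
          simp only [Instr.next]
          split_ifs <;> simp
        | _ => exact ⟨0, fun R pc => le_max_left _ _⟩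
      refine ⟨max t U, fun J hJ R pc => ?_⟩
      rcases List.mem_cons.1 hJ with rfl | hJ
      · exact (ht R pc).trans (by omega)
      · exact (hU J hJ R pc).trans (by omega)
  obtain ⟨U, hU⟩ := key M
  refine ⟨max M.length U, fun w s => ?_⟩
  induction s with
  | zero => simp [Machine.run, init]
  | succ s ih =>
    rw [run_succ]
    by_cases h : M.Halted (M.run w s)
    · rwa [step_of_halted h]
    · unfold Machine.Halted at h
      push Not at h
      rw [step_of_get (List.getElem?_eq_getElem h), exec_pc]
      exact (hU _ (List.getElem_mem h) _ _).trans (by omega)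

end Runs

/-! ### Simulating a single step -/

/-- A sequence of instructions as a structured program. -/
def Prog.block : List Instr → Prog
  | [] => .nop
  | I :: L => .seq (.ins I) (block L)

@[simp] theorem Prog.eval_block_nil (σ : St) : (Prog.block []).eval σ = σ := rfl

@[simp] theorem Prog.eval_block_cons (I : Instr) (L : List Instr) (σ : St) :
    (Prog.block (I :: L)).eval σ = (Prog.block L).eval (I.eff σ) := rfl

@[simp] theorem Prog.eval_block_append (L L' : List Instr) (σ : St) :
    (Prog.block (L ++ L')).eval σ = (Prog.block L').eval ((Prog.block L).eval σ) := by
  induction L generalizing σ with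
  | nil => rfl
  | cons I L ih => exact ih _

/-- `R d :=` the simulated register `i`, where `R 3` holds the address of the simulated register
`0`. -/
def readCode (d i : ℕ) : List Instr := [.const d i, .add d d 3, .load d d]

/-- Write `R 0` to the simulated register `i`. -/
def writeCode (i : ℕ) : List Instr := [.const 2 i, .add 2 2 3, .store 2 0]

/-- The simulation of an instruction. `R 0`, `R 1`, `R 2` are auxiliary, `R 3` holds the address
of the simulated register `0`, `R 4` the simulated program line (already set to the following
line), and `R 5` the flag that tells whether there is an output, whose bounds are then in `R 6`
and `R 7`, as addresses. -/
def simInstr : Instr → Prog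
  | .const i c => .block (.const 0 c :: writeCode i)
  | .copy i j => .block (readCode 0 j ++ writeCode i)
  | .load i j => .block (readCode 0 j ++ ([.add 0 0 3, .load 0 0] ++ writeCode i))
  | .store i j => .block (readCode 0 i ++ ([.add 0 0 3] ++ (readCode 1 j ++ [.store 0 1])))
  | .add i j l => .block (readCode 0 j ++ (readCode 1 l ++ (.add 0 0 1 :: writeCode i)))
  | .sub i j l => .block (readCode 0 j ++ (readCode 1 l ++ (.sub 0 0 1 :: writeCode i)))
  | .mul i j l => .block (readCode 0 j ++ (readCode 1 l ++ (.mul 0 0 1 :: writeCode i)))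
  | .goto t => .block [.const 4 t]
  | .jle i j t => .seq (.block (readCode 0 i ++ readCode 1 j)) (.ite 0 1 (.block [.const 4 t]) .nop)
  | .output i j =>
      .block (readCode 6 i ++ (readCode 7 j ++ [.add 6 6 3, .add 7 7 3, .const 5 2]))

/-- The state `σ` holds the registers `R 0, …, R (S - 1)` of a simulated machine at the addresses
from `b` on; outside of this area and the first eight registers it agrees with `ρ`. -/
structure Sim (b S T : ℕ) (ρ : ℕ → ℕ) (o : List (List ℕ)) (R : ℕ → ℕ) (σ : St) : Prop where
  base : σ.reg 3 = b
  mem : ∀ i < S, σ.reg (b + i) = R i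
  frame : ∀ a, 8 ≤ a → ¬ (b ≤ a ∧ a < b + S) → σ.reg a = ρ a
  top : σ.top ≤ T
  out : σ.out = o

section Sim
variable {b S T : ℕ} {ρ : ℕ → ℕ} {o : List (List ℕ)} {R : ℕ → ℕ} {σ : St}

/-- Writing to an auxiliary register. -/
theorem Sim.scratch (h : Sim b S T ρ o R σ) (hb : 8 ≤ b) {I : Instr} {d v : ℕ} (hd : d < 8)
    (h3 : d ≠ 3) (hw : I.write σ.reg = Function.update σ.reg d v) (ha : I.maxAccess σ.reg ≤ T)
    (he : I.emit σ.reg = []) :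
    Sim b S T ρ o R (I.eff σ) ∧ (I.eff σ).reg d = v ∧
      ∀ e, e ≠ d → (I.eff σ).reg e = σ.reg e := by
  have hr : (I.eff σ).reg = Function.update σ.reg d v := hw
  have hn : ∀ e, e ≠ d → (I.eff σ).reg e = σ.reg e := fun e he => by
    rw [hr, Function.update_of_ne he]
  refine ⟨⟨?_, ?_, ?_, ?_, ?_⟩, by rw [hr, Function.update_self], hn⟩
  · rw [hn _ h3.symm, h.base]
  · intro i hi
    rw [hn _ (by omega), h.mem i hi]
  · intro a ha hb
    rw [hn _ (by omega), h.frame a ha hb]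
  · exact max_le h.top ha
  · simp [Instr.eff, he, h.out]

/-- Writing to a simulated register. -/
theorem Sim.update (h : Sim b S T ρ o R σ) (hb : 8 ≤ b) {I : Instr} {i v : ℕ} (hi : i < S)
    (hw : I.write σ.reg = Function.update σ.reg (b + i) v) (ha : I.maxAccess σ.reg ≤ T)
    (he : I.emit σ.reg = []) :
    Sim b S T ρ o (Function.update R i v) (I.eff σ) ∧
      ∀ e < 8, (I.eff σ).reg e = σ.reg e := by
  have hr : (I.eff σ).reg = Function.update σ.reg (b + i) v := hw
  have hn : ∀ e, e ≠ b + i → (I.eff σ).reg e = σ.reg e := fun e he => by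
    rw [hr, Function.update_of_ne he]
  refine ⟨⟨?_, ?_, ?_, ?_, ?_⟩, fun e he => hn e (by omega)⟩
  · rw [hn _ (by omega), h.base]
  · intro k hk
    rw [hr, Function.update_apply, Function.update_apply, h.mem k hk]
    simp
  · intro a ha hb
    rw [hn _ (by omega), h.frame a ha hb]
  · exact max_le h.top ha
  · simp [Instr.eff, he, h.out]

theorem Sim.read (h : Sim b S T ρ o R σ) (hb : 8 ≤ b) (hT : b + S ≤ T) {d i : ℕ} (hd : d < 8)
    (h3 : d ≠ 3) (hi : i < S) :
    Sim b S T ρ o R ((Prog.block (readCode d i)).eval σ) ∧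
      ((Prog.block (readCode d i)).eval σ).reg d = R i ∧
      ∀ e, e ≠ d → ((Prog.block (readCode d i)).eval σ).reg e = σ.reg e := by
  simp only [readCode, Prog.eval_block_cons, Prog.eval_block_nil]
  obtain ⟨h₁, v₁, e₁⟩ := h.scratch hb hd h3 (I := .const d i) (v := i) rfl
    (by simp [Instr.maxAccess]; omega) rfl
  obtain ⟨h₂, v₂, e₂⟩ := h₁.scratch hb hd h3 (I := .add d d 3) (v := i + b)
    (by simp [Instr.write, v₁, h₁.base]) (by simp [Instr.maxAccess]; omega) rfl
  obtain ⟨h₃, v₃, e₃⟩ := h₂.scratch hb hd h3 (I := .load d d) (v := R i)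
    (by simp only [Instr.write, v₂]; rw [add_comm, h₂.mem i hi])
    (by simp [Instr.maxAccess, v₂]; omega) rfl
  exact ⟨h₃, v₃, fun e he => by rw [e₃ e he, e₂ e he, e₁ e he]⟩

theorem Sim.write (h : Sim b S T ρ o R σ) (hb : 8 ≤ b) (hT : b + S ≤ T) {i v : ℕ} (hi : i < S)
    (hv : σ.reg 0 = v) :
    Sim b S T ρ o (Function.update R i v) ((Prog.block (writeCode i)).eval σ) ∧
      ∀ e, e ≠ 2 → e < 8 → ((Prog.block (writeCode i)).eval σ).reg e = σ.reg e := by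
  simp only [writeCode, Prog.eval_block_cons, Prog.eval_block_nil]
  obtain ⟨h₁, v₁, e₁⟩ := h.scratch hb (by norm_num) (by norm_num) (I := .const 2 i) (d := 2) (v :=
      i)
    rfl (by simp [Instr.maxAccess]; omega) rfl
  obtain ⟨h₂, v₂, e₂⟩ := h₁.scratch hb (by norm_num) (by norm_num) (I := .add 2 2 3) (d := 2)
    (v := i + b) (by simp [Instr.write, v₁, h₁.base]) (by simp [Instr.maxAccess]; omega) rfl
  obtain ⟨h₃, e₃⟩ := h₂.update hb hi (I := .store 2 0) (v := v)
    (by simp only [Instr.write, v₂]; rw [add_comm, e₂ 0 (by norm_num), e₁ 0 (by norm_num), hv])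
    (by simp [Instr.maxAccess, v₂]; omega) rfl
  exact ⟨h₃, fun e he he' => by rw [e₃ e he', e₂ e he, e₁ e he]⟩

/-- The flag and, in case of an output, the addresses of its bounds. -/
def FlagOK (b : ℕ) (R : ℕ → ℕ) (σ σ' : St) : Instr → Prop
  | .output i j => σ'.reg 5 = 2 ∧ σ'.reg 6 = b + R i ∧ σ'.reg 7 = b + R j
  | _ => σ'.reg 5 = 0 ∧ σ'.reg 6 = σ.reg 6 ∧ σ'.reg 7 = σ.reg 7

/-- The binary arithmetic instructions, which are simulated alike. -/
theorem Sim.arith (h : Sim b S T ρ o R σ) (hb : 8 ≤ b) (hT : b + S ≤ T) (I : Instr) {i j l v : ℕ}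
    (hi : i < S) (hj : j < S) (hl : l < S)
    (hw : ∀ ρ', I.write ρ' = Function.update ρ' 0 (I.write ρ' 0))
    (hv : ∀ ρ', ρ' 0 = R j → ρ' 1 = R l → I.write ρ' 0 = v) (ha : ∀ ρ', I.maxAccess ρ' ≤ 1)
    (he : ∀ ρ', I.emit ρ' = []) :
    Sim b S T ρ o (Function.update R i v)
      ((Prog.block (readCode 0 j ++ (readCode 1 l ++ (I :: writeCode i)))).eval σ) ∧
      ∀ e, 2 < e → e < 8 →
      ((Prog.block (readCode 0 j ++ (readCode 1 l ++ (I :: writeCode i)))).eval σ).reg e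
        = σ.reg e := by
  rw [Prog.eval_block_append, Prog.eval_block_append, Prog.eval_block_cons]
  obtain ⟨h₁, v₁, e₁⟩ := h.read hb hT (d := 0) (by norm_num) (by norm_num) hj
  obtain ⟨h₂, v₂, e₂⟩ := h₁.read hb hT (d := 1) (by norm_num) (by norm_num) hl
  obtain ⟨h₃, v₃, e₃⟩ := h₂.scratch hb (d := 0) (by norm_num) (by norm_num) (I := I)
    (hw _) ((ha _).trans (by omega)) (he _)
  obtain ⟨h₄, e₄⟩ := h₃.write hb hT hi (v₃.trans (hv _ (by rw [e₂ 0 (by norm_num), v₁]) v₂))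
  refine ⟨h₄, fun e h2 h8 => ?_⟩
  rw [e₄ e (by omega) h8, e₃ e (by omega), e₂ e (by omega), e₁ e (by omega)]

theorem Sim.instr (h : Sim b S T ρ o R σ) (hb : 8 ≤ b) (hT : b + S ≤ T) (I : Instr) {pc : ℕ}
    (hpc : σ.reg 4 = pc + 1) (hfl : σ.reg 5 = 0) (hI : I.maxAccess R < S) :
    Sim b S T ρ o (I.write R) ((simInstr I).eval σ) ∧
      ((simInstr I).eval σ).reg 4 = I.next R pc ∧ FlagOK b R σ ((simInstr I).eval σ) I := by
  cases I with
  | const i c =>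
    simp only [simInstr, Prog.eval_block_cons]
    simp only [Instr.maxAccess] at hI
    obtain ⟨h₁, v₁, e₁⟩ := h.scratch hb (d := 0) (by norm_num) (by norm_num) (I := .const 0 c)
      (v := c) rfl (by simp [Instr.maxAccess]) rfl
    obtain ⟨h₂, e₂⟩ := h₁.write hb hT hI v₁
    refine ⟨h₂, ?_, ?_, ?_, ?_⟩ <;> rw [e₂ _ (by norm_num) (by norm_num), e₁ _ (by norm_num)] <;>
      assumption
  | copy i j =>
    simp only [Instr.maxAccess, max_lt_iff] at hI
    simp only [simInstr, Prog.eval_block_append]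
    obtain ⟨h₁, v₁, e₁⟩ := h.read hb hT (d := 0) (by norm_num) (by norm_num) hI.2
    obtain ⟨h₂, e₂⟩ := h₁.write hb hT hI.1 v₁
    refine ⟨h₂, ?_, ?_, ?_, ?_⟩ <;> rw [e₂ _ (by norm_num) (by norm_num), e₁ _ (by norm_num)] <;>
      assumption
  | load i j =>
    simp only [Instr.maxAccess, max_lt_iff] at hI
    simp only [simInstr, Prog.eval_block_append, Prog.eval_block_cons, Prog.eval_block_nil]
    obtain ⟨h₁, v₁, e₁⟩ := h.read hb hT (d := 0) (by norm_num) (by norm_num) hI.1.2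
    obtain ⟨h₂, v₂, e₂⟩ := h₁.scratch hb (d := 0) (by norm_num) (by norm_num) (I := .add 0 0 3)
      (v := R j + b) (by simp [Instr.write, v₁, h₁.base]) (by simp [Instr.maxAccess]; omega) rfl
    obtain ⟨h₃, v₃, e₃⟩ := h₂.scratch hb (d := 0) (by norm_num) (by norm_num) (I := .load 0 0)
      (v := R (R j)) (by simp only [Instr.write, v₂]; rw [add_comm, h₂.mem _ hI.2])
      (by simp [Instr.maxAccess, v₂]; omega) rfl
    obtain ⟨h₄, e₄⟩ := h₃.write hb hT hI.1.1 v₃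
    refine ⟨h₄, ?_, ?_, ?_, ?_⟩ <;>
      rw [e₄ _ (by norm_num) (by norm_num), e₃ _ (by norm_num), e₂ _ (by norm_num),
        e₁ _ (by norm_num)] <;> assumption
  | store i j =>
    simp only [Instr.maxAccess, max_lt_iff] at hI
    simp only [simInstr, Prog.eval_block_append, Prog.eval_block_cons, Prog.eval_block_nil]
    obtain ⟨h₁, v₁, e₁⟩ := h.read hb hT (d := 0) (by norm_num) (by norm_num) hI.1.1
    obtain ⟨h₂, v₂, e₂⟩ := h₁.scratch hb (d := 0) (by norm_num) (by norm_num) (I := .add 0 0 3)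
      (v := R i + b) (by simp [Instr.write, v₁, h₁.base]) (by simp [Instr.maxAccess]; omega) rfl
    obtain ⟨h₃, v₃, e₃⟩ := h₂.read hb hT (d := 1) (by norm_num) (by norm_num) hI.1.2
    have h0 := (e₃ 0 (by norm_num)).trans v₂
    obtain ⟨h₄, e₄⟩ := h₃.update hb hI.2 (I := .store 0 1) (v := R j)
      (by simp only [Instr.write, v₃, h0]; rw [add_comm])
      (by simp [Instr.maxAccess, h0]; omega) rfl
    refine ⟨h₄, ?_, ?_, ?_, ?_⟩ <;>
      rw [e₄ _ (by norm_num), e₃ _ (by norm_num), e₂ _ (by norm_num), e₁ _ (by norm_num)] <;>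
      assumption
  | add i j l =>
    simp only [Instr.maxAccess, max_lt_iff] at hI
    obtain ⟨h₁, e₁⟩ := h.arith hb hT (.add 0 0 1) (v := R j + R l) hI.1.1 hI.1.2 hI.2
      (fun ρ' => by simp [Instr.write]) (fun ρ' a b => by simp [Instr.write, a, b])
      (fun ρ' => by simp [Instr.maxAccess]) (fun _ => rfl)
    refine ⟨h₁, ?_, ?_, ?_, ?_⟩ <;> rw [simInstr, e₁ _ (by norm_num) (by norm_num)] <;> assumption
  | sub i j l =>
    simp only [Instr.maxAccess, max_lt_iff] at hI
    obtain ⟨h₁, e₁⟩ := h.arith hb hT (.sub 0 0 1) (v := R j - R l) hI.1.1 hI.1.2 hI.2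
      (fun ρ' => by simp [Instr.write]) (fun ρ' a b => by simp [Instr.write, a, b])
      (fun ρ' => by simp [Instr.maxAccess]) (fun _ => rfl)
    refine ⟨h₁, ?_, ?_, ?_, ?_⟩ <;> rw [simInstr, e₁ _ (by norm_num) (by norm_num)] <;> assumption
  | mul i j l =>
    simp only [Instr.maxAccess, max_lt_iff] at hI
    obtain ⟨h₁, e₁⟩ := h.arith hb hT (.mul 0 0 1) (v := R j * R l) hI.1.1 hI.1.2 hI.2
      (fun ρ' => by simp [Instr.write]) (fun ρ' a b => by simp [Instr.write, a, b])
      (fun ρ' => by simp [Instr.maxAccess]) (fun _ => rfl)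
    refine ⟨h₁, ?_, ?_, ?_, ?_⟩ <;> rw [simInstr, e₁ _ (by norm_num) (by norm_num)] <;> assumption
  | goto t =>
    simp only [simInstr, Prog.eval_block_cons, Prog.eval_block_nil]
    obtain ⟨h₁, v₁, e₁⟩ := h.scratch hb (d := 4) (by norm_num) (by norm_num) (I := .const 4 t)
      (v := t) rfl (by simp [Instr.maxAccess]; omega) rfl
    refine ⟨h₁, v₁, ?_, ?_, ?_⟩ <;> rw [e₁ _ (by norm_num)]
    assumption
  | jle i j t =>
    simp only [Instr.maxAccess, max_lt_iff] at hI
    simp only [simInstr, Prog.eval, Prog.eval_block_append, Instr.write, Instr.next]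
    obtain ⟨h₁, v₁, e₁⟩ := h.read hb hT (d := 0) (by norm_num) (by norm_num) hI.1
    obtain ⟨h₂, v₂, e₂⟩ := h₁.read hb hT (d := 1) (by norm_num) (by norm_num) hI.2
    rw [v₂, e₂ 0 (by norm_num), v₁]
    generalize (Prog.block (readCode 1 j)).eval ((Prog.block (readCode 0 i)).eval σ) = σ₂ at *
    have h₃ : Sim b S T ρ o R (σ₂.touch 0 1) :=
      ⟨h₂.base, h₂.mem, h₂.frame, max_le h₂.top (by simp; omega), h₂.out⟩
    have e₃ : ∀ e, 2 < e → (σ₂.touch 0 1).reg e = σ.reg e := fun e he => by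
      show σ₂.reg e = _
      rw [e₂ e (by omega), e₁ e (by omega)]
    split_ifs with hij
    · obtain ⟨h₄, v₄, e₄⟩ := h₃.scratch hb (d := 4) (by norm_num) (by norm_num) (I := .const 4 t)
        (v := t) rfl (by simp [Instr.maxAccess]; omega) rfl
      refine ⟨h₄, v₄, ?_, ?_, ?_⟩ <;>
        rw [Prog.eval_block_cons, Prog.eval_block_nil, e₄ _ (by norm_num), e₃ _ (by norm_num)]
      assumption
    · refine ⟨h₃, ?_, ?_, ?_, ?_⟩ <;> rw [e₃ _ (by norm_num)] <;> assumption
  | output i j =>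
    have hI' : i < S ∧ j < S := by
      simp only [Instr.maxAccess] at hI
      split_ifs at hI <;> simp only [max_lt_iff] at hI <;> omega
    simp only [simInstr, Prog.eval_block_append, Prog.eval_block_cons, Prog.eval_block_nil,
      Instr.write, Instr.next]
    obtain ⟨h₁, v₁, e₁⟩ := h.read hb hT (d := 6) (by norm_num) (by norm_num) hI'.1
    obtain ⟨h₂, v₂, e₂⟩ := h₁.read hb hT (d := 7) (by norm_num) (by norm_num) hI'.2
    have h6 := (e₂ 6 (by norm_num)).trans v₁
    obtain ⟨h₃, v₃, e₃⟩ := h₂.scratch hb (d := 6) (by norm_num) (by norm_num) (I := .add 6 6 3)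
      (v := b + R i) (by simp [Instr.write, h6, h₂.base, add_comm])
      (by simp [Instr.maxAccess]; omega) rfl
    have h7 := (e₃ 7 (by norm_num)).trans v₂
    obtain ⟨h₄, v₄, e₄⟩ := h₃.scratch hb (d := 7) (by norm_num) (by norm_num) (I := .add 7 7 3)
      (v := b + R j) (by simp [Instr.write, h7, h₃.base, add_comm])
      (by simp [Instr.maxAccess]; omega) rfl
    obtain ⟨h₅, v₅, e₅⟩ := h₄.scratch hb (d := 5) (by norm_num) (by norm_num) (I := .const 5 2)
      (v := 2) rfl (by simp [Instr.maxAccess]; omega) rfl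
    refine ⟨h₅, ?_, v₅, ?_, ?_⟩
    · rw [e₅ _ (by norm_num), e₄ _ (by norm_num), e₃ _ (by norm_num), e₂ _ (by norm_num),
        e₁ _ (by norm_num), hpc]
    · rw [e₅ _ (by norm_num), e₄ _ (by norm_num), v₃]
    · rw [e₅ _ (by norm_num), v₄]

end Sim

/-- Dispatch on the program line, which is in `R 4`, for the lines from `q` on. -/
def dispatch : ℕ → List Instr → Prog
  | _, [] => .block [.const 5 1]
  | q, I :: L => .seq (.block [.const 0 q])
      (.ite 4 0 (.seq (.block [.const 4 (q + 1)]) (simInstr I)) (dispatch (q + 1) L))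

/-- One step of the simulated machine `M`.  Its registers are found at the address in `R 3`, and the
number of its program line is found two addresses before. -/
def simStep (M : Machine) : Prog :=
  .seq (.block [.const 2 2, .sub 2 3 2, .load 4 2, .const 5 0])
    (.seq (dispatch 0 M) (.block [.const 2 2, .sub 2 3 2, .store 2 4, .const 0 0, .const 1 0]))

section
variable {b S T : ℕ} {ρ : ℕ → ℕ} {o : List (List ℕ)} {R : ℕ → ℕ} {σ : St}

/-- The flag after a simulated step of `M`, and, in case of an output, the addresses of its
bounds. -/
def StepFlag (M : Machine) (b : ℕ) (c : Config) (σ σ' : St) : Prop :=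
  σ'.reg 5 = M.flag c ∧
  (M.flag c ≠ 2 → σ'.reg 6 = σ.reg 6 ∧ σ'.reg 7 = σ.reg 7) ∧
  ∀ i j, M[c.pc]? = some (.output i j) → σ'.reg 6 = b + c.reg i ∧ σ'.reg 7 = b + c.reg j

/-- The dispatch on the program line carries out the current instruction, if it is among those
considered; beyond the program it signals that the machine has halted. -/
theorem Sim.dispatch {M : Machine} {c : Config} (hb : 8 ≤ b) (hT : b + S ≤ T)
    (hS : (M.step c).top < S) (L : List Instr) (q : ℕ) (hL : L = M.drop q) (hq : q ≤ c.pc) {σ : St}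
    (h : Sim b S T ρ o c.reg σ) (h4 : σ.reg 4 = c.pc) (h5 : σ.reg 5 = 0) :
    Sim b S T ρ o (M.step c).reg ((dispatch q L).eval σ) ∧
      ((EnumRAM.dispatch q L).eval σ).reg 4 = (M.step c).pc ∧
      StepFlag M b c σ ((EnumRAM.dispatch q L).eval σ) := by
  induction L generalizing q σ with
  | nil =>
    have hlen : M.length ≤ q := List.drop_eq_nil_iff.1 hL.symm
    have hn : M[c.pc]? = none := List.getElem?_eq_none (by omega)
    have hst : M.step c = c := step_of_halted (M := M) (show M.length ≤ c.pc by omega)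
    obtain ⟨h₁, v₁, e₁⟩ := h.scratch hb (d := 5) (by norm_num) (by norm_num) (I := .const 5 1)
      (v := 1) rfl (by simp [Instr.maxAccess]; omega) rfl
    simp only [EnumRAM.dispatch, Prog.eval_block_cons, Prog.eval_block_nil, hst]
    refine ⟨h₁, by rw [e₁ 4 (by norm_num), h4], by simp [v₁, Machine.flag, hn], fun _ => ?_, ?_⟩
    · exact ⟨e₁ 6 (by norm_num), e₁ 7 (by norm_num)⟩
    · simp [hn]
  | cons I L ih =>
    have hI : M[q]? = some I := by
      have := congrArg (fun l => l[0]?) hL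
      simpa using this.symm
    have hL' : L = M.drop (q + 1) := by
      rw [← List.tail_drop, ← hL]; rfl
    obtain ⟨h₁, v₁, e₁⟩ := h.scratch hb (d := 0) (by norm_num) (by norm_num) (I := .const 0 q)
      (v := q) rfl (by simp [Instr.maxAccess]) rfl
    simp only [EnumRAM.dispatch, Prog.eval_seq, Prog.eval_block_cons, Prog.eval_block_nil]
    have r0 : ((Instr.const 0 q).eff σ).reg 0 = q := v₁
    have r4 : ((Instr.const 0 q).eff σ).reg 4 = c.pc := by rw [e₁ 4 (by norm_num), h4]
    generalize (Instr.const 0 q).eff σ = σ₁ at *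
    have h₂ : Sim b S T ρ o c.reg (σ₁.touch 4 0) :=
      ⟨h₁.base, h₁.mem, h₁.frame, max_le h₁.top (by simp; omega), h₁.out⟩
    have e₂ : ∀ e, 2 < e → (σ₁.touch 4 0).reg e = σ.reg e := fun e he => e₁ e (by omega)
    by_cases hle : c.pc ≤ q
    · rw [Prog.eval_ite_pos (by rwa [r0, r4])]
      simp only [Prog.eval_seq, Prog.eval_block_cons, Prog.eval_block_nil]
      have hpc : c.pc = q := le_antisymm hle hq
      have hst : M.step c = I.exec c := step_of_get (by rw [hpc]; exact hI)
      have hma : I.maxAccess c.reg < S := by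
        rw [hst] at hS; exact (le_max_right _ _).trans_lt hS
      obtain ⟨h₃, v₃, e₃⟩ := h₂.scratch hb (d := 4) (by norm_num) (by norm_num)
        (I := .const 4 (q + 1)) (v := q + 1) rfl (by simp [Instr.maxAccess]; omega) rfl
      obtain ⟨h₄, v₄, f₄⟩ := h₃.instr hb hT I (pc := q) v₃
        (by rw [e₃ _ (by norm_num), e₂ _ (by norm_num), h5]) hma
      rw [hst]
      refine ⟨h₄, by rw [v₄, ← hpc]; rfl, ?_⟩
      have e₅ : ∀ e, 4 < e → ((Instr.const 4 (q + 1)).eff (σ₁.touch 4 0)).reg e = σ.reg e :=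
        fun e he => by rw [e₃ e (by omega), e₂ e (by omega)]
      unfold StepFlag Machine.flag
      rw [hpc, hI]
      cases I <;> simp only [FlagOK] at f₄
      case output i j => exact ⟨f₄.1, fun hh => (hh rfl).elim, fun i' j' hh => by cases hh; exact
        f₄.2⟩
      all_goals
        refine ⟨f₄.1, fun _ => ?_, fun _ _ hh => by cases hh⟩
        rw [f₄.2.1, f₄.2.2, e₅ 6 (by norm_num), e₅ 7 (by norm_num)]
        exact ⟨rfl, rfl⟩
    · rw [Prog.eval_ite_neg (by rwa [r0, r4])]
      obtain ⟨h₃, v₃, f₃⟩ := ih (q + 1) hL' (by omega) h₂ (by rw [e₂ 4 (by norm_num), h4])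
        (by rw [e₂ 5 (by norm_num), h5])
      refine ⟨h₃, v₃, f₃.1, fun hh => ?_, f₃.2.2⟩
      rw [(f₃.2.1 hh).1, (f₃.2.1 hh).2, e₂ 6 (by norm_num), e₂ 7 (by norm_num)]
      exact ⟨rfl, rfl⟩

/-- What a simulated step achieves: the configuration `c` of `M`, stored from address `b` on, is
replaced by the next one. -/
structure SimStep (M : Machine) (b S T : ℕ) (c : Config) (σ σ' : St) : Prop where
  base : σ'.reg 3 = b + 2
  pc : σ'.reg b = (M.step c).pc
  mem : ∀ i < S, σ'.reg (b + 2 + i) = (M.step c).reg i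
  frame : ∀ a, 8 ≤ a → a ≠ b → ¬ (b + 2 ≤ a ∧ a < b + 2 + S) → σ'.reg a = σ.reg a
  zero : σ'.reg 0 = 0
  one : σ'.reg 1 = 0
  two : σ'.reg 2 = b
  four : σ'.reg 4 = (M.step c).pc
  flag : StepFlag M (b + 2) c σ σ'
  top : σ'.top ≤ T
  out : σ'.out = σ.out

theorem simStep_spec {M : Machine} {c : Config} (hb : 8 ≤ b) (hT : b + 2 + S ≤ T)
    (hS : (M.step c).top < S) (h3 : σ.reg 3 = b + 2) (hpc : σ.reg b = c.pc)
    (hmem : ∀ i < S, σ.reg (b + 2 + i) = c.reg i) (htop : σ.top ≤ T) :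
    SimStep M b S T c σ ((simStep M).eval σ) := by
  have hb' : 8 ≤ b + 2 := by omega
  have h : Sim (b + 2) S T σ.reg σ.out c.reg σ := ⟨h3, hmem, fun _ _ _ => rfl, htop, rfl⟩
  obtain ⟨h₁, v₁, e₁⟩ := h.scratch hb' (d := 2) (by norm_num) (by norm_num) (I := .const 2 2)
    (v := 2) rfl (by simp [Instr.maxAccess]; omega) rfl
  obtain ⟨h₂, v₂, e₂⟩ := h₁.scratch hb' (d := 2) (by norm_num) (by norm_num) (I := .sub 2 3 2)
    (v := b) (by simp [Instr.write, v₁, h₁.base]) (by simp [Instr.maxAccess]; omega) rfl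
  obtain ⟨h₃, v₃, e₃⟩ := h₂.scratch hb' (d := 4) (by norm_num) (by norm_num) (I := .load 4 2)
    (v := c.pc) (by simp only [Instr.write, v₂]; rw [e₂ b (by omega), e₁ b (by omega), hpc])
    (by simp [Instr.maxAccess, v₂]; omega) rfl
  obtain ⟨h₄, v₄, e₄⟩ := h₃.scratch hb' (d := 5) (by norm_num) (by norm_num) (I := .const 5 0)
    (v := 0) rfl (by simp [Instr.maxAccess]; omega) rfl
  obtain ⟨h₅, v₅, f₅⟩ := Sim.dispatch hb' hT hS M 0 rfl (Nat.zero_le _) h₄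
    (by rw [e₄ 4 (by norm_num), v₃]) v₄
  simp only [simStep, Prog.eval, Prog.eval_block_cons, Prog.eval_block_nil]
  have e67 : ∀ e, 5 < e → ((Instr.const 5 0).eff ((Instr.load 4 2).eff ((Instr.sub 2 3 2).eff
      ((Instr.const 2 2).eff σ)))).reg e = σ.reg e := fun e he => by
    rw [e₄ e (by omega), e₃ e (by omega), e₂ e (by omega), e₁ e (by omega)]
  generalize (Instr.const 5 0).eff ((Instr.load 4 2).eff ((Instr.sub 2 3 2).eff
      ((Instr.const 2 2).eff σ))) = σ₄ at *
  generalize (dispatch 0 M).eval σ₄ = σ₅ at *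
  obtain ⟨h₆, v₆, e₆⟩ := h₅.scratch hb' (d := 2) (by norm_num) (by norm_num) (I := .const 2 2)
    (v := 2) rfl (by simp [Instr.maxAccess]; omega) rfl
  obtain ⟨h₇, v₇, e₇⟩ := h₆.scratch hb' (d := 2) (by norm_num) (by norm_num) (I := .sub 2 3 2)
    (v := b) (by simp [Instr.write, v₆, h₆.base]) (by simp [Instr.maxAccess]; omega) rfl
  have e₇' : ∀ e, e ≠ 2 → ((Instr.sub 2 3 2).eff ((Instr.const 2 2).eff σ₅)).reg e = σ₅.reg e :=
    fun e he => by rw [e₇ e he, e₆ e he]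
  generalize (Instr.sub 2 3 2).eff ((Instr.const 2 2).eff σ₅) = σ₇ at *
  have r : ((Instr.const 1 0).eff ((Instr.const 0 0).eff ((Instr.store 2 4).eff σ₇))).reg =
      Function.update (Function.update (Function.update σ₇.reg b (M.step c).pc) 0 0) 1 0 := by
    simp only [Instr.eff, Instr.write, v₇]
    rw [e₇' 4 (by norm_num), v₅]
  have r' : ∀ e, 1 < e → e ≠ b → ((Instr.const 1 0).eff ((Instr.const 0 0).eff
      ((Instr.store 2 4).eff σ₇))).reg e = σ₇.reg e := fun e h1 he => by
    rw [r, Function.update_of_ne (by omega), Function.update_of_ne (by omega),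
      Function.update_of_ne he]
  constructor
  · rw [r' _ (by norm_num) (by omega), h₇.base]
  · rw [r, Function.update_of_ne (by omega), Function.update_of_ne (by omega), Function.update_self]
  · intro i hi
    rw [r' _ (by omega) (by omega), h₇.mem i hi]
  · intro a h8 hne ha
    rw [r' _ (by omega) hne, h₇.frame a h8 ha]
  · rw [r, Function.update_of_ne (by omega), Function.update_self]
  · rw [r, Function.update_self]
  · rw [r' _ (by omega) (by omega), v₇]
  · rw [r' _ (by omega) (by omega), e₇' 4 (by norm_num), v₅]
  · refine ⟨?_, fun hh => ?_, fun i j hij => ?_⟩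
    · rw [r' _ (by omega) (by omega), e₇' 5 (by norm_num), f₅.1]
    · rw [r' _ (by omega) (by omega), r' _ (by omega) (by omega), e₇' 6 (by norm_num),
        e₇' 7 (by norm_num), (f₅.2.1 hh).1, (f₅.2.1 hh).2, e67 6 (by norm_num), e67 7 (by norm_num)]
      exact ⟨rfl, rfl⟩
    · rw [r' _ (by omega) (by omega), r' _ (by omega) (by omega), e₇' 6 (by norm_num),
        e₇' 7 (by norm_num)]
      exact f₅.2.2 i j hij
  · have := h₇.top
    simp only [Instr.eff, Instr.maxAccess, v₇, Instr.write]
    omega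
  · simp [Instr.eff, Instr.emit, h₇.out]

theorem Prog.flat_block {L : List Instr} (h : ∀ I ∈ L, (Prog.ins I).Flat) : (Prog.block L).Flat :=
    by
  induction L with
  | nil => trivial
  | cons I L ih =>
    exact ⟨h I (by simp), ih fun J hJ => h J (by simp [hJ])⟩

theorem flat_simInstr (I : Instr) : (simInstr I).Flat := by
  cases I <;> simp [simInstr, Prog.Flat, Prog.block, readCode, writeCode]

theorem flat_dispatch (q : ℕ) (L : List Instr) : (dispatch q L).Flat := by
  induction L generalizing q with
  | nil => exact ⟨trivial, trivial⟩
  | cons I L ih => exact ⟨⟨trivial, trivial⟩, ⟨⟨trivial, trivial⟩, flat_simInstr I⟩, ih _⟩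

theorem flat_simStep (M : Machine) : (simStep M).Flat :=
  ⟨by simp [Prog.block, Prog.Flat], flat_dispatch 0 M, by simp [Prog.block, Prog.Flat]⟩

end

/-! ### The schedule -/

/-- Process `p` is in charge of the outputs made at the steps `x` in this zone. Steps are counted
from `B` on, so that the zones of `p < B` are adjacent and the lowest one starts with step `0`. -/
def Zone (B p x : ℕ) : Prop := 2 ^ (B - 1 - p) * B ≤ x + B ∧ x + B < 2 ^ (B - p) * B

theorem Zone.unique {B p p' x : ℕ} (h : Zone B p x) (h' : Zone B p' x) (hp : p < B)
    (hp' : p' < B) : p = p' := by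
  have key : ∀ {p p'}, Zone B p x → Zone B p' x → p < p' → p' < B → False := by
    intro p p' h h' hlt hB
    have : 2 ^ (B - p') * B ≤ 2 ^ (B - 1 - p) * B :=
      Nat.mul_le_mul_right _ (Nat.pow_le_pow_right (by norm_num) (by omega))
    have := h.1
    have := h'.2
    omega
  rcases lt_trichotomy p p' with hh | hh | hh
  · exact (key h h' hh hp').elim
  · exact hh
  · exact (key h' h hh hp).elim

theorem exists_zone {B x : ℕ} (hB : 3 ≤ B) (h : x + B < 2 ^ (B - 2) * B) :
    ∃ p, 2 ≤ p ∧ p < B ∧ Zone B p x := by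
  have key : ∀ a, a ≤ B - 2 → x + B < 2 ^ a * B → ∃ p, 2 ≤ p ∧ p < B ∧ Zone B p x := by
    intro a
    induction a with
    | zero => intro _ h; simp at h
    | succ a ih =>
      intro ha h
      by_cases h' : x + B < 2 ^ a * B
      · exact ih (by omega) h'
      · refine ⟨B - 1 - a, by omega, by omega, ?_, ?_⟩
        · rw [show B - 1 - (B - 1 - a) = a by omega]; omega
        · rwa [show B - (B - 1 - a) = a + 1 by omega]
  exact key _ le_rfl h

/-- The number of events before step `x`. -/
def count (ev : ℕ → Prop) [DecidablePred ev] (x : ℕ) : ℕ := ((List.range x).filter ev).length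

/-- The state of the schedule. The processes `p = 2, …, B - 1` have made `s p` steps, the events
`em` have been output, process `r` is active and has made `e` of its `2 * B` steps; `n` bounds the
number of steps. -/
structure Sched (ev : ℕ → Prop) (B r e : ℕ) (s : ℕ → ℕ) (em : List ℕ) (n : ℕ) : Prop where
  le : 2 ≤ r ∧ r ≤ B
  lt : e < 2 * B ∧ (r = B → e = 0)
  nodup : em.Nodup
  mem : ∀ x, x ∈ em ↔ ev x ∧ ∃ p, 2 ≤ p ∧ p < B ∧ Zone B p x ∧ x < s p
  /-- Every output of an event in a lower zone has brought process `p` a full share of steps. -/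
  low : ∀ p, 2 ≤ p → p < B → 2 * B * em.countP (fun x => x + B < 2 ^ (B - 1 - p) * B)
    + (if p < r then 2 * B else if p = r then e else 0) ≤ s p
  up : ∀ p, s p ≤ n

section Sched
variable {ev : ℕ → Prop} {B r el : ℕ} {s : ℕ → ℕ} {em : List ℕ} {n : ℕ}

theorem Sched.init (hB : 3 ≤ B) : Sched ev B 2 0 (fun _ => 0) [] 0 where
  le := ⟨le_rfl, by omega⟩
  lt := by omega
  nodup := List.nodup_nil
  mem := by simp
  low p hp _ := by simp; omega
  up _ := le_rfl

theorem Sched.emit (h : Sched ev B r el s em n) (hr : r < B) (he : ev (s r))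
    (hz : Zone B r (s r)) :
    Sched ev B 2 0 (Function.update s r (s r + 1)) (em ++ [s r]) (n + 1) where
  le := ⟨le_rfl, by have := h.le; omega⟩
  lt := by omega
  nodup := by
    refine List.nodup_append.2 ⟨h.nodup, List.nodup_singleton _, ?_⟩
    rintro a ha b hb rfl
    rw [List.mem_singleton] at hb
    subst hb
    obtain ⟨-, p, -, hp, hz', hlt⟩ := (h.mem _).1 ha
    obtain rfl := hz.unique hz' hr hp
    omega
  mem x := by
    rw [List.mem_append, List.mem_singleton, h.mem]
    constructor
    · rintro (⟨hx, p, hp, hp', hz', hlt⟩ | rfl)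
      · refine ⟨hx, p, hp, hp', hz', ?_⟩
        rw [Function.update_apply]; split_ifs with hh
        · subst hh; omega
        · exact hlt
      · exact ⟨he, r, h.le.1, hr, hz, by simp⟩
    · rintro ⟨hx, p, hp, hp', hz', hlt⟩
      rw [Function.update_apply] at hlt
      split_ifs at hlt with hh
      · subst hh
        rcases Nat.lt_succ_iff_lt_or_eq.1 hlt with hlt | rfl
        · exact .inl ⟨hx, p, hp, hp', hz', hlt⟩
        · exact .inr rfl
      · exact .inl ⟨hx, p, hp, hp', hz', hlt⟩
  low p hp hp' := by
    have hl := h.low p hp hp'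
    have hs : s p ≤ Function.update s r (s r + 1) p := by
      rw [Function.update_apply]; split_ifs with hh
      · subst hh; omega
      · exact le_rfl
    refine le_trans ?_ (hl.trans hs)
    have e0 : (if p < 2 then 2 * B else if p = 2 then 0 else 0) = 0 := by split_ifs <;> omega
    rw [e0, List.countP_append, List.countP_singleton]
    by_cases hpr : p < r
    · rw [if_pos hpr]
      split_ifs <;> simp [mul_add]
    · have : 2 ^ (B - 1 - p) * B ≤ 2 ^ (B - 1 - r) * B :=
        Nat.mul_le_mul_right _ (Nat.pow_le_pow_right (by norm_num) (by omega))
      have := hz.1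
      rw [if_neg (by simp; omega)]
      simp
  up p := by
    rw [Function.update_apply]
    have := h.up p; have := h.up r
    split_ifs <;> omega

/-- The active process and the number of its steps, after a step without output. -/
def next (B r el : ℕ) : ℕ × ℕ := if el + 1 < 2 * B then (r, el + 1) else (r + 1, 0)

theorem Sched.advance (h : Sched ev B r el s em n) (hr : r < B)
    (hn : ¬ (ev (s r) ∧ Zone B r (s r))) :
    Sched ev B (next B r el).1 (next B r el).2 (Function.update s r (s r + 1)) em (n + 1) where
  le := by have := h.le; unfold next; split_ifs <;> simp <;> omega
  lt := by have := h.lt; unfold next; split_ifs <;> simp <;> omega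
  nodup := h.nodup
  mem x := by
    rw [h.mem]
    refine and_congr_right fun hx => exists_congr fun p => and_congr_right fun hp =>
      and_congr_right fun hp' => and_congr_right fun hz => ?_
    rw [Function.update_apply]
    split_ifs with hh
    · subst hh
      have : x ≠ s p := by rintro rfl; exact hn ⟨hx, hz⟩
      omega
    · rfl
  low p hp hp' := by
    have hl := h.low p hp hp'
    have := h.lt
    rw [Function.update_apply]
    unfold next
    by_cases hpr : p = r
    · subst hpr
      rw [if_neg (lt_irrefl _), if_pos rfl] at hl
      by_cases h2 : el + 1 < 2 * B
      · simp only [h2, if_true, lt_irrefl, if_false]; omega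
      · simp only [h2, if_true, if_false, Nat.lt_succ_self]; omega
    · rw [if_neg hpr] at hl ⊢
      split_ifs at hl ⊢ <;> omega
  up p := by
    rw [Function.update_apply]
    have := h.up p; have := h.up r
    split_ifs <;> omega

/-- When all processes have had their share without an output, all events have been output: once
the events below the zone of a process have been output, their number, and the share that each of
them has brought to the process, have carried it beyond its zone. -/
theorem Sched.complete [DecidablePred ev] (h : Sched ev B B el s em n) (hB : 3 ≤ B)
    (hkey : ∀ x, ev x → ∀ y ≤ x, y < (count ev y + 1) * B)
    (hb : ∀ x, ev x → x + B < 2 ^ (B - 2) * B) (x : ℕ) (hx : ev x) : x ∈ em := by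
  induction x using Nat.strong_induction_on with
  | _ x ih =>
    obtain ⟨p, hp, hp', hz⟩ := exists_zone hB (hb x hx)
    refine (h.mem x).2 ⟨hx, p, hp, hp', hz, ?_⟩
    -- Up to the start of zone `p`, all events have been output, by the induction hypothesis.
    have hl := h.low p hp hp'
    rw [if_pos hp'] at hl
    have hz1 := hz.1
    have hz2 := hz.2
    rw [show B - p = B - 1 - p + 1 by omega, pow_succ] at hz2
    generalize 2 ^ (B - 1 - p) = a at *
    have hy : (a - 1) * B ≤ x := by rw [Nat.sub_mul]; omega
    have hk := Nat.lt_of_mul_lt_mul_right (hkey x hx _ hy)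
    have hc : count ev ((a - 1) * B) ≤ em.countP (fun x => x + B < a * B) := by
      rw [List.countP_eq_length_filter]
      refine (List.subperm_of_subset (List.nodup_range.filter _) fun y hy' => ?_).length_le
      simp only [List.mem_filter, List.mem_range, decide_eq_true_eq] at hy' ⊢
      refine ⟨ih y (hy'.1.trans_le hy) hy'.2, ?_⟩
      have := hy'.1
      rw [Nat.sub_mul] at this
      omega
    generalize em.countP (fun x => x + B < a * B) = k at *
    have : 2 * B * a ≤ 2 * B * (k + 1) := Nat.mul_le_mul_left _ (by omega)
    have e : a * 2 * B = 2 * B * a := by ring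
    rw [mul_add] at this
    omega

end Sched

/-! ### The main loop -/

/-- One round of the main loop: a step of the active process, the output of the word it produces
if this is its duty, and the choice of the process that is active next.

If `r` is the active process, `R 3 = r * B + 2` is the address of its registers,
`R 10 = 2 ^ (r - 2)`, and `R 11` is the number of steps of its share that it has made. Its
counter, which starts with `B`, lies in its zone iff `R 10` times the counter is at least
`R 13 = 2 ^ (B - 3) * B` and less than `R 14 = 2 ^ (B - 2) * B`; in this form, the test needs no
division. The constants are `R 12 = 2 * B`, `R 15 = B`, `R 16 = 1`, `R 18 = 2 * B + 2` and
`R 20 = 2`. -/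
def iter (M : Machine) : Prog :=
  .seq (simStep M)
    (.seq (.block [.const 0 1, .sub 0 3 0, .load 1 0, .mul 2 10 1, .add 1 1 16, .store 0 1,
        .const 0 0])
      (.seq (.ite 20 5 (.ite 13 2 (.ite 14 2 .nop (.block [.const 0 1])) .nop) .nop)
        (.seq (.ite 16 0 (.block [.output 6 7, .copy 3 18, .const 10 1, .const 11 0])
            (.seq (.block [.add 11 11 16])
              (.ite 12 11 (.block [.const 11 0, .add 3 3 15, .add 10 10 10]) .nop)))
          (.block [.const 0 0, .const 1 0, .const 2 0]))))

theorem flat_iter (M : Machine) : (iter M).Flat :=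
  ⟨flat_simStep M, by simp [Prog.block, Prog.Flat], by simp [Prog.block, Prog.Flat],
    by simp [Prog.block, Prog.Flat], by simp [Prog.block, Prog.Flat]⟩

/-- The word output by a machine, read off from a copy of its registers. -/
theorem word_eq {M : Machine} {c : Config} {i j b S : ℕ} {ρ : ℕ → ℕ}
    (h : M[c.pc]? = some (.output i j)) (hS : (M.step c).top < S)
    (hm : ∀ k < S, ρ (b + k) = c.reg k) :
    (List.range' (b + c.reg i) (b + c.reg j + 1 - (b + c.reg i))).map ρ = M.word c ∧
      (b + c.reg i ≤ b + c.reg j → b + c.reg j < b + S) := by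
  rw [step_of_get h] at hS
  have hS' : c.reg i ≤ c.reg j → c.reg j < S := fun hh => by
    refine lt_of_le_of_lt ?_ hS
    simp [Instr.exec, Instr.maxAccess, hh]
  refine ⟨?_, fun hh => by have := hS' (by omega); omega⟩
  rw [show b + c.reg j + 1 - (b + c.reg i) = c.reg j + 1 - c.reg i by omega,
    ← List.map_add_range', List.map_map, Machine.word, Machine.emits, h]
  simp only [Instr.emit, List.headD_cons]
  refine List.map_congr_left fun k hk => ?_
  rw [List.mem_range'_1] at hk
  have := hS' (by omega)
  exact hm k (by omega)

/-- The second part of a round: the step counter, at address `b + 1`, is increased. -/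
theorem counter_spec {σ : St} {b t T : ℕ} (hb : 30 ≤ b) (hT : b + 2 ≤ T) (h3 : σ.reg 3 = b + 2)
    (h16 : σ.reg 16 = 1) (ht : σ.reg (b + 1) = t) (htop : σ.top ≤ T) :
    ∃ σ', (Prog.block [.const 0 1, .sub 0 3 0, .load 1 0, .mul 2 10 1, .add 1 1 16, .store 0 1,
        .const 0 0]).eval σ = σ' ∧ σ'.reg 0 = 0 ∧ σ'.reg 2 = σ.reg 10 * t ∧ σ'.reg (b + 1) = t + 1 ∧
      (∀ a, 2 < a → a ≠ b + 1 → σ'.reg a = σ.reg a) ∧ σ'.top ≤ T ∧ σ'.out = σ.out := by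
  simp only [Prog.eval_block_cons, Prog.eval_block_nil]
  have u₁ := Upd.const (T := T) σ (i := 0) (c := 1) (by omega)
  generalize (Instr.const 0 1).eff σ = σ₁ at u₁ ⊢
  have u₂ := Upd.sub (T := T) σ₁ (i := 0) (j := 3) (l := 0) (by omega) (by omega) (by omega)
  generalize (Instr.sub 0 3 0).eff σ₁ = σ₂ at u₂ ⊢
  have v₂ : σ₂.reg 0 = b + 1 := by rw [u₂.self, u₁.self, u₁.ne _ (by norm_num), h3]; rfl
  have u₃ := Upd.load (T := T) σ₂ (i := 1) (j := 0) (by omega) (by omega) (by omega)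
  generalize (Instr.load 1 0).eff σ₂ = σ₃ at u₃ ⊢
  have v₃ : σ₃.reg 1 = t := by
    rw [u₃.self, v₂, u₂.ne _ (by omega), u₁.ne _ (by omega), ht]
  have u₄ := Upd.mul (T := T) σ₃ (i := 2) (j := 10) (l := 1) (by omega) (by omega) (by omega)
  generalize (Instr.mul 2 10 1).eff σ₃ = σ₄ at u₄ ⊢
  have u₅ := Upd.add (T := T) σ₄ (i := 1) (j := 1) (l := 16) (by omega) (by omega) (by omega)
  generalize (Instr.add 1 1 16).eff σ₄ = σ₅ at u₅ ⊢
  have v₅ : σ₅.reg 0 = b + 1 := by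
    rw [u₅.ne _ (by norm_num), u₄.ne _ (by norm_num), u₃.ne _ (by norm_num), v₂]
  have w₅ : σ₅.reg 1 = t + 1 := by
    rw [u₅.self, u₄.ne 1 (by norm_num), v₃, u₄.ne 16 (by norm_num), u₃.ne 16 (by norm_num),
      u₂.ne 16 (by norm_num), u₁.ne 16 (by norm_num), h16]
  have u₆ := Upd.store (T := T) σ₅ (i := 0) (j := 1) (by omega) (by omega) (by omega)
  generalize (Instr.store 0 1).eff σ₅ = σ₆ at u₆ ⊢
  have u₇ := Upd.const (T := T) σ₆ (i := 0) (c := 0) (by omega)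
  generalize (Instr.const 0 0).eff σ₆ = σ₇ at u₇ ⊢
  rw [v₅, w₅] at u₆
  refine ⟨_, rfl, u₇.self, ?_, ?_, fun a ha hab => ?_, ?_, ?_⟩
  · rw [u₇.ne 2 (by omega), u₆.ne 2 (by omega), u₅.ne 2 (by omega), u₄.self, v₃,
      u₃.ne 10 (by omega), u₂.ne 10 (by omega), u₁.ne 10 (by omega)]
  · rw [u₇.ne _ (by omega), u₆.self]
  · rw [u₇.ne _ (by omega), u₆.ne _ (by omega), u₅.ne _ (by omega), u₄.ne _ (by omega),
      u₃.ne _ (by omega), u₂.ne _ (by omega), u₁.ne _ (by omega)]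
  · exact u₇.top (u₆.top (u₅.top (u₄.top (u₃.top (u₂.top (u₁.top htop))))))
  · rw [u₇.out, u₆.out, u₅.out, u₄.out, u₃.out, u₂.out, u₁.out]

/-- The third part of a round: `R 0` tells whether there is a word to be output. -/
theorem select_spec {σ : St} {T : ℕ} (hT : 30 ≤ T) (h0 : σ.reg 0 = 0) (htop : σ.top ≤ T) :
    ∃ σ', (Prog.ite 20 5 (.ite 13 2 (.ite 14 2 .nop (.block [.const 0 1])) .nop) .nop).eval σ = σ' ∧
      (σ'.reg 0 = if σ.reg 20 ≤ σ.reg 5 ∧ σ.reg 13 ≤ σ.reg 2 ∧ σ.reg 2 < σ.reg 14 then 1 else 0) ∧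
      (∀ a, a ≠ 0 → σ'.reg a = σ.reg a) ∧ σ'.top ≤ T ∧ σ'.out = σ.out := by
  refine ⟨_, rfl, ?_⟩
  have t₁ := St.touch_top htop (i := 20) (j := 5) (by omega) (by omega)
  have t₂ := St.touch_top t₁ (i := 13) (j := 2) (by omega) (by omega)
  have t₃ := St.touch_top t₂ (i := 14) (j := 2) (by omega) (by omega)
  by_cases h1 : σ.reg 20 ≤ σ.reg 5
  · rw [Prog.eval_ite_pos h1]
    by_cases h2 : σ.reg 13 ≤ σ.reg 2
    · rw [Prog.eval_ite_pos (σ := σ.touch 20 5) h2]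
      by_cases h3 : σ.reg 14 ≤ σ.reg 2
      · rw [Prog.eval_ite_pos (σ := (σ.touch 20 5).touch 13 2) h3]
        exact ⟨by simp [h0, h3], fun _ _ => rfl, t₃, rfl⟩
      · rw [Prog.eval_ite_neg (σ := (σ.touch 20 5).touch 13 2) h3, if_pos ⟨h1, h2, not_le.1 h3⟩]
        have u := Upd.const (T := T) (((σ.touch 20 5).touch 13 2).touch 14 2) (i := 0) (c := 1)
          (by omega)
        exact ⟨u.self, u.ne, u.top t₃, u.out⟩
    · rw [Prog.eval_ite_neg (σ := σ.touch 20 5) h2]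
      exact ⟨by simp [h0, h2], fun _ _ => rfl, t₂, rfl⟩
  · rw [Prog.eval_ite_neg h1]
    exact ⟨by simp [h0, h1], fun _ _ => rfl, t₁, rfl⟩

/-- At the end of a round, the auxiliary registers are cleared. -/
theorem clear_spec {T : ℕ} (hT : 30 ≤ T) (σ : St) (htop : σ.top ≤ T) :
    ∃ σ', (Prog.block [.const 0 0, .const 1 0, .const 2 0]).eval σ = σ' ∧ (∀ a < 3, σ'.reg a = 0) ∧
      (∀ a, 3 ≤ a → σ'.reg a = σ.reg a) ∧ σ'.top ≤ T ∧ σ'.out = σ.out := by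
  simp only [Prog.eval_block_cons, Prog.eval_block_nil]
  have u₁ := Upd.const (T := T) σ (i := 0) (c := 0) (by omega)
  generalize (Instr.const 0 0).eff σ = σ₁ at u₁ ⊢
  have u₂ := Upd.const (T := T) σ₁ (i := 1) (c := 0) (by omega)
  generalize (Instr.const 1 0).eff σ₁ = σ₂ at u₂ ⊢
  have u₃ := Upd.const (T := T) σ₂ (i := 2) (c := 0) (by omega)
  generalize (Instr.const 2 0).eff σ₂ = σ₃ at u₃ ⊢
  refine ⟨_, rfl, fun a ha => ?_, fun a ha => ?_, u₃.top (u₂.top (u₁.top htop)),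
    by rw [u₃.out, u₂.out, u₁.out]⟩
  · interval_cases a
    · rw [u₃.ne _ (by omega), u₂.ne _ (by omega), u₁.self]
    · rw [u₃.ne _ (by omega), u₂.self]
    · exact u₃.self
  · rw [u₃.ne _ (by omega), u₂.ne _ (by omega), u₁.ne _ (by omega)]

/-- The fourth part of a round, in the case of an output. -/
theorem output_spec {σ : St} {T : ℕ} (hT : 30 ≤ T) (h0 : σ.reg 0 = 1) (h16 : σ.reg 16 = 1)
    (htop : σ.top ≤ T) (h7 : σ.reg 6 ≤ σ.reg 7 → σ.reg 7 ≤ T) (Q : Prog) :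
    ∃ σ', (Prog.ite 16 0 (.block [.output 6 7, .copy 3 18, .const 10 1, .const 11 0]) Q).eval σ =
      σ' ∧
      σ'.reg 3 = σ.reg 18 ∧ σ'.reg 10 = 1 ∧ σ'.reg 11 = 0 ∧
      (∀ a, 3 < a → a ≠ 10 → a ≠ 11 → σ'.reg a = σ.reg a) ∧ σ'.top ≤ T ∧
      σ'.out = σ.out ++ [(List.range' (σ.reg 6) (σ.reg 7 + 1 - σ.reg 6)).map σ.reg] := by
  rw [Prog.eval_ite_pos (by rw [h0, h16])]
  simp only [Prog.eval_block_cons, Prog.eval_block_nil]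
  obtain ⟨r₁, t₁, o₁⟩ : ((Instr.output 6 7).eff (σ.touch 16 0)).reg = σ.reg ∧
      ((Instr.output 6 7).eff (σ.touch 16 0)).top ≤ T ∧
      ((Instr.output 6 7).eff (σ.touch 16 0)).out =
        σ.out ++ [(List.range' (σ.reg 6) (σ.reg 7 + 1 - σ.reg 6)).map σ.reg] := by
    exact ⟨rfl, top_output _ (by omega) (by omega) h7
      (St.touch_top htop (by omega) (by omega)), rfl⟩
  generalize (Instr.output 6 7).eff (σ.touch 16 0) = σ₁ at r₁ t₁ o₁ ⊢
  have u₂ := Upd.copy (T := T) σ₁ (i := 3) (j := 18) (by omega) (by omega)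
  generalize (Instr.copy 3 18).eff σ₁ = σ₂ at u₂ ⊢
  have u₃ := Upd.const (T := T) σ₂ (i := 10) (c := 1) (by omega)
  generalize (Instr.const 10 1).eff σ₂ = σ₃ at u₃ ⊢
  have u₄ := Upd.const (T := T) σ₃ (i := 11) (c := 0) (by omega)
  generalize (Instr.const 11 0).eff σ₃ = σ₄ at u₄ ⊢
  refine ⟨_, rfl, ?_, ?_, u₄.self, fun a h3 h10 h11 => ?_, u₄.top (u₃.top (u₂.top t₁)), ?_⟩
  · rw [u₄.ne _ (by omega), u₃.ne _ (by omega), u₂.self, r₁]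
  · rw [u₄.ne _ (by omega), u₃.self]
  · rw [u₄.ne _ (by omega), u₃.ne _ (by omega), u₂.ne _ (by omega), r₁]
  · rw [u₄.out, u₃.out, u₂.out, o₁]

/-- The fourth part of a round, without output. -/
theorem advance_spec {σ : St} {B r el T : ℕ} (hT : 30 ≤ T) (h0 : σ.reg 0 = 0) (h16 : σ.reg 16 = 1)
    (htop : σ.top ≤ T) (h3 : σ.reg 3 = r * B + 2) (h11 : σ.reg 11 = el) (h12 : σ.reg 12 = 2 * B)
    (h15 : σ.reg 15 = B) (h10 : σ.reg 10 = 2 ^ (r - 2)) (hr : 2 ≤ r) (P : Prog) :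
    ∃ σ', (Prog.ite 16 0 P (.seq (.block [.add 11 11 16])
          (.ite 12 11 (.block [.const 11 0, .add 3 3 15, .add 10 10 10]) .nop))).eval σ = σ' ∧
      σ'.reg 3 = (next B r el).1 * B + 2 ∧
      σ'.reg 10 = 2 ^ ((next B r el).1 - 2) ∧ σ'.reg 11 = (next B r el).2 ∧
      (∀ a, 3 < a → a ≠ 10 → a ≠ 11 → σ'.reg a = σ.reg a) ∧ σ'.top ≤ T ∧ σ'.out = σ.out := by
  rw [Prog.eval_ite_neg (by rw [h0, h16]; norm_num)]
  simp only [Prog.eval_seq, Prog.eval_block_cons, Prog.eval_block_nil]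
  have t₀ := St.touch_top htop (i := 16) (j := 0) (by omega) (by omega)
  have u₁ := Upd.add (T := T) (σ.touch 16 0) (i := 11) (j := 11) (l := 16) (by omega) (by omega)
    (by omega)
  generalize (Instr.add 11 11 16).eff (σ.touch 16 0) = σ₁ at u₁ ⊢
  have t₁ := u₁.top t₀
  have n₁ : ∀ a, a ≠ 11 → σ₁.reg a = σ.reg a := u₁.ne
  have e₁ : σ₁.reg 11 = el + 1 := by rw [u₁.self, St.touch_reg, h11, h16]
  have o₁ : σ₁.out = σ.out := u₁.out
  have t₂ := St.touch_top t₁ (i := 12) (j := 11) (by omega) (by omega)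
  by_cases hel : el + 1 < 2 * B
  · rw [Prog.eval_ite_neg (by rw [e₁, n₁ 12 (by omega), h12]; omega)]
    simp only [next, if_pos hel]
    refine ⟨_, rfl, ?_, ?_, e₁, fun a _ _ h => n₁ a h, t₂, o₁⟩
    · exact (n₁ 3 (by omega)).trans h3
    · exact (n₁ 10 (by omega)).trans h10
  · rw [Prog.eval_ite_pos (by rw [e₁, n₁ 12 (by omega), h12]; omega)]
    simp only [next, if_neg hel, Prog.eval_block_cons, Prog.eval_block_nil]
    have u₃ := Upd.const (T := T) (σ₁.touch 12 11) (i := 11) (c := 0) (by omega)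
    generalize (Instr.const 11 0).eff (σ₁.touch 12 11) = σ₃ at u₃ ⊢
    have n₃ : ∀ a, a ≠ 11 → σ₃.reg a = σ.reg a := fun a ha =>
      (u₃.ne a ha).trans (n₁ a ha)
    have u₄ := Upd.add (T := T) σ₃ (i := 3) (j := 3) (l := 15) (by omega) (by omega) (by omega)
    generalize (Instr.add 3 3 15).eff σ₃ = σ₄ at u₄ ⊢
    have u₅ := Upd.add (T := T) σ₄ (i := 10) (j := 10) (l := 10) (by omega) (by omega) (by omega)
    generalize (Instr.add 10 10 10).eff σ₄ = σ₅ at u₅ ⊢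
    refine ⟨_, rfl, ?_, ?_, ?_, fun a h3 h10 h11 => ?_, u₅.top (u₄.top (u₃.top t₂)), ?_⟩
    · rw [u₅.ne _ (by omega), u₄.self, n₃ _ (by omega), n₃ _ (by omega), h3, h15]; ring
    · rw [u₅.self, u₄.ne _ (by omega), n₃ _ (by omega), h10, show r + 1 - 2 = r - 2 + 1 by omega,
        pow_succ]; ring
    · rw [u₅.ne _ (by omega), u₄.ne _ (by omega), u₃.self]
    · rw [u₅.ne _ (by omega), u₄.ne _ (by omega), n₃ _ (by omega)]
    · rw [u₅.out, u₄.out, u₃.out]; exact o₁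

/-! ### The invariant of the main loop -/

/-- What is needed of the run of `M` on `w` in order to simulate it with regions of size `B` and
numbers at most `V`. -/
structure Bounds (M : Machine) (w : List ℕ) (B V : ℕ) : Prop where
  big : 30 ≤ B
  top : ∀ s, (M.run w s).top < B - 2
  reg : ∀ s i, (M.run w s).reg i ≤ 2 ^ B
  pc : ∀ s, (M.run w s).pc ≤ 2 ^ B
  le : B * B + 2 ^ B * B + 2 ≤ V

/-- The configuration in which a process starts is that after the first output, made in step `s₀`;
this is the configuration of a process after `x` steps. -/
def proc (M : Machine) (w : List ℕ) (s₀ x : ℕ) : Config := M.run w (s₀ + 1 + x)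

theorem step_proc (M : Machine) (w : List ℕ) (s₀ x : ℕ) :
    M.step (proc M w s₀ x) = proc M w s₀ (x + 1) := (run_succ _ _ _).symm

theorem flag_le_two (M : Machine) (c : Config) : M.flag c ≤ 2 := by
  unfold Machine.flag; split <;> norm_num

theorem exists_output_of_flag {M : Machine} {c : Config} (h : M.flag c = 2) :
    ∃ i j, M[c.pc]? = some (.output i j) := by
  unfold Machine.flag at h
  split at h <;> simp_all

/-- The invariant of the main loop. Region `p`, of the cells from `p * B` to `p * B + B - 1`,
holds the program line, the counter, and the registers of process `p`, which has made `s p` steps;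
the counters start with `B`. Region `1` holds the registers at the time of the first output, whose
bounds are `a₀` and `b₀` as addresses. -/
structure Main (M : Machine) (w : List ℕ) (B V s₀ a₀ b₀ r el : ℕ) (s : ℕ → ℕ) (σ : St) : Prop where
  r3 : σ.reg 3 = r * B + 2
  r8 : σ.reg 8 = a₀
  r9 : σ.reg 9 = b₀
  r10 : σ.reg 10 = 2 ^ (r - 2)
  r11 : σ.reg 11 = el
  r12 : σ.reg 12 = 2 * B
  r13 : σ.reg 13 = 2 ^ (B - 3) * B
  r14 : σ.reg 14 = 2 ^ (B - 2) * B
  r15 : σ.reg 15 = B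
  r16 : σ.reg 16 = 1
  r17 : σ.reg 17 = B * B
  r18 : σ.reg 18 = 2 * B + 2
  r20 : σ.reg 20 = 2
  pc : ∀ p, 2 ≤ p → p < B → σ.reg (p * B) = (proc M w s₀ (s p)).pc
  counter : ∀ p, 2 ≤ p → p < B → σ.reg (p * B + 1) = B + s p
  mem : ∀ p, 2 ≤ p → p < B → ∀ i < B - 2, σ.reg (p * B + 2 + i) = (proc M w s₀ (s p)).reg i
  frozen : ∀ i < B - 2, σ.reg (B + 2 + i) = (M.run w s₀).reg i
  good : Good V (B * B) σ

section Main
variable {M : Machine} {w : List ℕ} {B V s₀ a₀ b₀ r el : ℕ} {s : ℕ → ℕ} {σ : St}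

theorem region_le {B p r : ℕ} (h : p < r) : p * B + B ≤ r * B := by
  have := Nat.mul_le_mul_right B (Nat.succ_le_of_lt h)
  rwa [Nat.succ_mul] at this

theorem Main.touch (hB : 30 ≤ B) (h : Main M w B V s₀ a₀ b₀ r el s σ) :
    Main M w B V s₀ a₀ b₀ r el s (σ.touch 3 17) where
  __ := h
  good := by
    have : B * 1 ≤ B * B := Nat.mul_le_mul_left _ (by omega)
    exact ⟨h.good.1, St.touch_top h.good.2 (by omega) (by omega)⟩

/-- The invariant after a round, from what the round has done to the registers. -/
theorem Main.update (hb : Bounds M w B V) (h : Main M w B V s₀ a₀ b₀ r el s σ) (hr : 2 ≤ r)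
    (hrB : r < B) (hsV : B + s r + 1 ≤ V) {σ₁ σ' : St} {r' el' : ℕ}
    (h₁ : SimStep M (r * B) (B - 2) (B * B) (proc M w s₀ (s r)) σ σ₁) (hr' : r' ≤ B)
    (hel' : el' ≤ 2 * B) (h0 : ∀ a < 3, σ'.reg a = 0) (h3 : σ'.reg 3 = r' * B + 2)
    (h10 : σ'.reg 10 = 2 ^ (r' - 2)) (h11 : σ'.reg 11 = el')
    (hn : ∀ a, 3 < a → a ≠ 10 → a ≠ 11 → a ≠ r * B + 1 → σ'.reg a = σ₁.reg a)
    (hc : σ'.reg (r * B + 1) = B + s r + 1) (ht : σ'.top ≤ B * B) :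
    Main M w B V s₀ a₀ b₀ r' el' (Function.update s r (s r + 1)) σ' := by
  have hB := hb.big
  have hBB : 30 * B ≤ B * B := Nat.mul_le_mul_right _ hB
  have hrr : 2 * B ≤ r * B := Nat.mul_le_mul_right _ hr
  have hr'B : r' * B ≤ B * B := Nat.mul_le_mul_right _ hr'
  have hV := hb.le
  have h2B : 2 ^ B ≤ 2 ^ B * B := Nat.le_mul_of_pos_right _ (by omega)
  have fr : ∀ a, 11 < a → ¬ (r * B ≤ a ∧ a < r * B + B) → σ'.reg a = σ.reg a := fun a ha har => by
    rw [hn a (by omega) (by omega) (by omega) (by omega),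
      h₁.frame a (by omega) (by omega) (by omega)]
  have fr' : ∀ a, 11 < a → a < 30 → σ'.reg a = σ.reg a := fun a ha har => fr a ha (by omega)
  have f8 : ∀ a, 8 ≤ a → a < 10 → σ'.reg a = σ.reg a := fun a ha har => by
    rw [hn a (by omega) (by omega) (by omega) (by omega),
      h₁.frame a (by omega) (by omega) (by omega)]
  have hpc : σ'.reg (r * B) = (proc M w s₀ (s r + 1)).pc := by
    rw [hn _ (by omega) (by omega) (by omega) (by omega), h₁.pc, step_proc]
  have hmem : ∀ i < B - 2, σ'.reg (r * B + 2 + i) = (proc M w s₀ (s r + 1)).reg i := fun i hi => by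
    rw [hn _ (by omega) (by omega) (by omega) (by omega), h₁.mem i hi, step_proc]
  have other : ∀ p, p < B → p ≠ r → ∀ a, p * B ≤ a → a < p * B + B →
      ¬ (r * B ≤ a ∧ a < r * B + B) := by
    intro p hp hpr a ha ha'
    rcases Nat.lt_or_gt_of_ne hpr with hh | hh
    · have := region_le (B := B) hh; omega
    · have := region_le (B := B) hh; omega
  constructor
  case r3 => exact h3
  case r8 => rw [f8 8 (by omega) (by omega), h.r8]
  case r9 => rw [f8 9 (by omega) (by omega), h.r9]
  case r10 => exact h10
  case r11 => exact h11
  case r12 => rw [fr' _ (by omega) (by omega), h.r12]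
  case r13 => rw [fr' _ (by omega) (by omega), h.r13]
  case r14 => rw [fr' _ (by omega) (by omega), h.r14]
  case r15 => rw [fr' _ (by omega) (by omega), h.r15]
  case r16 => rw [fr' _ (by omega) (by omega), h.r16]
  case r17 => rw [fr' _ (by omega) (by omega), h.r17]
  case r18 => rw [fr' _ (by omega) (by omega), h.r18]
  case r20 => rw [fr' _ (by omega) (by omega), h.r20]
  case pc =>
    intro p hp hp'
    by_cases hpr : p = r
    · subst hpr; rw [Function.update_self, hpc]
    · have : 2 * B ≤ p * B := Nat.mul_le_mul_right _ hp
      rw [Function.update_of_ne hpr,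
        fr _ (by omega) (other p hp' hpr _ (by omega) (by omega)), h.pc p hp hp']
  case counter =>
    intro p hp hp'
    by_cases hpr : p = r
    · subst hpr; rw [Function.update_self, hc, add_assoc]
    · have : 2 * B ≤ p * B := Nat.mul_le_mul_right _ hp
      rw [Function.update_of_ne hpr,
        fr _ (by omega) (other p hp' hpr _ (by omega) (by omega)), h.counter p hp hp']
  case mem =>
    intro p hp hp' i hi
    by_cases hpr : p = r
    · subst hpr; rw [Function.update_self, hmem i hi]
    · have : 2 * B ≤ p * B := Nat.mul_le_mul_right _ hp
      rw [Function.update_of_ne hpr,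
        fr _ (by omega) (other p hp' hpr _ (by omega) (by omega)), h.mem p hp hp' i hi]
  case frozen =>
    intro i hi
    rw [fr _ (by omega) (by omega), h.frozen i hi]
  case good =>
    refine ⟨fun a => ?_, ht⟩
    have hreg : ∀ x i, (proc M w s₀ x).reg i ≤ 2 ^ B := fun x i => hb.reg _ _
    by_cases a3 : a < 3
    · rw [h0 a a3]; omega
    by_cases a11 : a = 3 ∨ a = 10 ∨ a = 11
    · rcases a11 with rfl | rfl | rfl
      · rw [h3]; omega
      · rw [h10]
        have : 2 ^ (r' - 2) ≤ 2 ^ B := Nat.pow_le_pow_right (by norm_num) (by omega)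
        omega
      · rw [h11]; omega
    by_cases ac : a = r * B + 1
    · rw [ac, hc]; exact hsV
    by_cases ap : a = r * B
    · rw [ap, hpc]
      have := hb.pc (s₀ + 1 + (s r + 1))
      show (M.run w _).pc ≤ V
      omega
    by_cases am : r * B + 2 ≤ a ∧ a < r * B + B
    · obtain ⟨i, rfl⟩ := Nat.exists_eq_add_of_le am.1
      rw [hmem i (by omega)]
      have := hreg (s r + 1) i
      omega
    rw [hn a (by omega) (by omega) (by omega) ac]
    by_cases a8 : 8 ≤ a
    · rw [h₁.frame a a8 ap (by omega)]
      exact h.good.1 a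
    have h67 : σ₁.reg 6 ≤ V ∧ σ₁.reg 7 ≤ V := by
      by_cases hf : M.flag (proc M w s₀ (s r)) = 2
      · obtain ⟨i, j, hij⟩ := exists_output_of_flag hf
        rw [(h₁.flag.2.2 i j hij).1, (h₁.flag.2.2 i j hij).2]
        have := hreg (s r) i
        have := hreg (s r) j
        have := region_le (B := B) hrB
        omega
      · rw [(h₁.flag.2.1 hf).1, (h₁.flag.2.1 hf).2]
        exact ⟨h.good.1 6, h.good.1 7⟩
    obtain rfl | rfl | rfl | rfl : a = 4 ∨ a = 5 ∨ a = 6 ∨ a = 7 := by omega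
    · rw [h₁.four, step_proc]
      have := hb.pc (s₀ + 1 + (s r + 1))
      show (M.run w _).pc ≤ V
      omega
    · rw [h₁.flag.1]
      have := flag_le_two M (proc M w s₀ (s r))
      omega
    · exact h67.1
    · exact h67.2

/-- A round of the main loop carries out a step of the schedule. -/
theorem Main.iter (hb : Bounds M w B V) (h : Main M w B V s₀ a₀ b₀ r el s σ) (hr : 2 ≤ r)
    (hrB : r < B) (hel : el < 2 * B) (hsV : B + s r + 1 ≤ V) :
    (M.flag (proc M w s₀ (s r)) = 2 ∧ Zone B r (s r) →
      Main M w B V s₀ a₀ b₀ 2 0 (Function.update s r (s r + 1)) ((iter M).eval σ) ∧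
      ((iter M).eval σ).out = σ.out ++ [M.word (proc M w s₀ (s r))]) ∧
    (¬ (M.flag (proc M w s₀ (s r)) = 2 ∧ Zone B r (s r)) →
      Main M w B V s₀ a₀ b₀ (next B r el).1 (next B r el).2 (Function.update s r (s r + 1))
        ((EnumRAM.iter M).eval σ) ∧ ((EnumRAM.iter M).eval σ).out = σ.out) := by
  have hB := hb.big
  have hBB : 30 * B ≤ B * B := Nat.mul_le_mul_right _ hB
  have hrr : 2 * B ≤ r * B := Nat.mul_le_mul_right _ hr
  have hreg := region_le (B := B) hrB
  have hnext : (M.step (proc M w s₀ (s r))).top < B - 2 := by rw [step_proc]; exact hb.top _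
  have h₁ := simStep_spec (M := M) (b := r * B) (S := B - 2) (T := B * B) (by omega) (by omega)
    hnext h.r3 (h.pc r hr hrB) (h.mem r hr hrB) h.good.2
  simp only [EnumRAM.iter, Prog.eval_seq]
  generalize (simStep M).eval σ = σ₁ at h₁ ⊢
  have k₁ : ∀ a, 8 ≤ a → a < 30 → σ₁.reg a = σ.reg a := fun a ha ha' =>
    h₁.frame a ha (by omega) (by omega)
  obtain ⟨σ₂, q₂, z₂, v₂, c₂, n₂, t₂, o₂⟩ := counter_spec (σ := σ₁) (b := r * B) (t := B + s r)
    (T := B * B) (by omega) (by omega) h₁.base (by rw [k₁ 16 (by omega) (by omega), h.r16])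
    (by rw [h₁.frame _ (by omega) (by omega) (by omega), h.counter r hr hrB]) h₁.top
  rw [q₂]
  obtain ⟨σ₃, q₃, s₃, n₃, t₃, o₃⟩ := select_spec (σ := σ₂) (T := B * B) (by omega) z₂ t₂
  rw [q₃]
  have k₃ : ∀ a, 2 < a → a ≠ r * B + 1 → σ₃.reg a = σ₁.reg a := fun a ha ha' => by
    rw [n₃ a (by omega), n₂ a ha ha']
  have k₃' : ∀ a, 8 ≤ a → a < 30 → σ₃.reg a = σ.reg a := fun a ha ha' => by
    rw [k₃ a (by omega) (by omega), k₁ a ha ha']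
  have c₃ : σ₃.reg (r * B + 1) = B + s r + 1 := by rw [n₃ _ (by omega), c₂]
  have k₂ : ∀ a, 8 ≤ a → a < 30 → σ₂.reg a = σ.reg a := fun a ha ha' => by
    rw [n₂ a (by omega) (by omega), k₁ a ha ha']
  have hsel : (σ₂.reg 20 ≤ σ₂.reg 5 ∧ σ₂.reg 13 ≤ σ₂.reg 2 ∧ σ₂.reg 2 < σ₂.reg 14) ↔
      (M.flag (proc M w s₀ (s r)) = 2 ∧ Zone B r (s r)) := by
    rw [k₂ 20 (by omega) (by omega), k₂ 13 (by omega) (by omega), k₂ 14 (by omega) (by omega),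
      n₂ 5 (by omega) (by omega), v₂, k₁ 10 (by omega) (by omega), h.r20, h.r13, h.r14, h.r10,
      h₁.flag.1]
    -- The test multiplies the bounds of the zone by the weight `2 ^ (r - 2)` of the process.
    have e1 : 2 ^ (B - 3) * B = 2 ^ (r - 2) * (2 ^ (B - 1 - r) * B) := by
      rw [← mul_assoc, ← pow_add]; congr 2; omega
    have e2 : 2 ^ (B - 2) * B = 2 ^ (r - 2) * (2 ^ (B - r) * B) := by
      rw [← mul_assoc, ← pow_add]; congr 2; omega
    rw [e1, e2, Nat.mul_le_mul_left_iff (by positivity), Nat.mul_lt_mul_left (by positivity)]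
    have := flag_le_two M (proc M w s₀ (s r))
    unfold Zone
    rw [add_comm B]
    exact and_congr_left' ⟨fun _ => by omega, fun _ => by omega⟩
  have k16 := (k₃' 16 (by omega) (by omega)).trans h.r16
  constructor
  · intro hev
    rw [if_pos (hsel.2 hev)] at s₃
    obtain ⟨i, j, hij⟩ := exists_output_of_flag hev.1
    obtain ⟨f6, f7⟩ := h₁.flag.2.2 i j hij
    have hw := word_eq (b := r * B + 2) (ρ := σ₃.reg) hij hnext fun k hk => by
      rw [k₃ _ (by omega) (by omega), h₁.mem k hk, step_of_get hij]; rfl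
    have e6 : σ₃.reg 6 = r * B + 2 + (proc M w s₀ (s r)).reg i := by
      rw [k₃ 6 (by omega) (by omega), f6]
    have e7 : σ₃.reg 7 = r * B + 2 + (proc M w s₀ (s r)).reg j := by
      rw [k₃ 7 (by omega) (by omega), f7]
    obtain ⟨σ₄, q₄, a3, a10, a11, n₄, t₄, o₄⟩ := output_spec (σ := σ₃) (T := B * B) (by omega) s₃
        k16
      t₃ (by rw [e6, e7]; intro hh; have := hw.2 hh; omega)
      (.seq (.block [.add 11 11 16])
        (.ite 12 11 (.block [.const 11 0, .add 3 3 15, .add 10 10 10]) .nop))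
    obtain ⟨σ₅, q₅, z₅, n₅, t₅, o₅⟩ := clear_spec (T := B * B) (by omega) σ₄ t₄
    rw [q₄, q₅]
    refine ⟨Main.update hb h hr hrB hsV h₁ (by omega) (by omega) z₅ ?_ ?_ ?_ ?_ ?_ t₅, ?_⟩
    · rw [n₅ 3 (by omega), a3, k₃' 18 (by omega) (by omega), h.r18]
    · rw [n₅ 10 (by omega), a10]; rfl
    · rw [n₅ 11 (by omega), a11]
    · intro a h3 h10 h11 hc
      rw [n₅ a (by omega), n₄ a h3 h10 h11, k₃ a (by omega) hc]
    · rw [n₅ _ (by omega), n₄ _ (by omega) (by omega) (by omega), c₃]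
    · rw [o₅, o₄, o₃, o₂, h₁.out, e6, e7, hw.1]
  · intro hev
    rw [if_neg (hsel.not.2 hev)] at s₃
    obtain ⟨σ₄, q₄, a3, a10, a11, n₄, t₄, o₄⟩ := advance_spec (σ := σ₃) (T := B * B) (B := B) (r :=
        r)
      (el := el) (by omega) s₃ k16 t₃ (by rw [k₃ 3 (by omega) (by omega), h₁.base])
      (by rw [k₃' 11 (by omega) (by omega), h.r11]) (by rw [k₃' 12 (by omega) (by omega), h.r12])
      (by rw [k₃' 15 (by omega) (by omega), h.r15]) (by rw [k₃' 10 (by omega) (by omega), h.r10]) hr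
      (.block [.output 6 7, .copy 3 18, .const 10 1, .const 11 0])
    obtain ⟨σ₅, q₅, z₅, n₅, t₅, o₅⟩ := clear_spec (T := B * B) (by omega) σ₄ t₄
    rw [q₄, q₅]
    refine ⟨Main.update hb h hr hrB hsV h₁ ?_ ?_ z₅ ?_ ?_ ?_ ?_ ?_ t₅, ?_⟩
    · unfold next; split_ifs <;> simp <;> omega
    · unfold next; split_ifs <;> simp; omega
    · rw [n₅ 3 (by omega), a3]
    · rw [n₅ 10 (by omega), a10]
    · rw [n₅ 11 (by omega), a11]
    · intro a h3 h10 h11 hc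
      rw [n₅ a (by omega), n₄ a h3 h10 h11, k₃ a (by omega) hc]
    · rw [n₅ _ (by omega), n₄ _ (by omega) (by omega) (by omega), c₃]
    · rw [o₅, o₄, o₃, o₂, h₁.out]

end Main

/-! ### The delay in the main loop -/

/-- The times of the outputs made so far, preceded by `0`. -/
def Config.times (c : Config) : List ℕ := 0 :: c.out.map Prod.snd

/-- The times between successive outputs are at most `d`, and the time since the last output is at
most `g`; before the first output, this is the time since the start. -/
structure Gap (d g : ℕ) (c : Config) : Prop where
  gap : ∀ i, i < c.out.length → c.times.getD (i + 1) 0 ≤ c.times.getD i 0 + d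
  time : c.time ≤ c.times.getD c.out.length 0 + g

section Gap
variable {M : Machine} {V T q k d g g' : ℕ} {c c' : Config}

theorem Gap.mono (h : Gap d g c) (hg : g ≤ g') : Gap d g' c :=
  ⟨h.gap, h.time.trans (Nat.add_le_add_left hg _)⟩

/-- The gap grows while there is no output. -/
theorem Gap.later (h : Gap d g c) (ho : c'.out = c.out) (ht : c'.time ≤ c.time + g') :
    Gap d (g + g') c' := by
  have := h.time
  unfold Config.times at *
  refine ⟨?_, ?_⟩
  · unfold Config.times; rw [ho]; exact h.gap
  · unfold Config.times; rw [ho]; omega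

theorem Gap.output (h : Gap d g c) {u : List ℕ} {τ : ℕ} (ho : c'.out = c.out ++ [(u, τ)])
    (ht : τ ≤ c.time + g') (hd : g + g' ≤ d) (hτ : c'.time ≤ τ + k) : Gap d k c' := by
  have e : c'.times = c.times ++ [τ] := by simp [Config.times, ho]
  have l : c.times.length = c.out.length + 1 := by simp [Config.times]
  have hc := h.time
  have last : (c.times ++ [τ]).getD (c.out.length + 1) 0 = τ := by
    rw [List.getD_append_right _ _ _ _ l.le, l]; simp
  constructor
  · intro i hi
    rw [ho, List.length_append, List.length_singleton] at hi
    rw [e]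
    rcases Nat.lt_succ_iff_lt_or_eq.1 hi with hi | rfl
    · rw [List.getD_append _ _ _ _ (by omega), List.getD_append _ _ _ _ (by omega)]
      exact h.gap i hi
    · rw [last, List.getD_append _ _ _ _ (by omega)]
      omega
  · rw [e, ho, List.length_append, List.length_singleton, last]
    exact hτ

end Gap

/-- The single word output in some moves, with its time. -/
theorem Moves.output {M : Machine} {n : ℕ} {c c' : Config} {u : List ℕ} (h : Moves M n c c')
    (hu : c'.st.out = c.st.out ++ [u]) :
    ∃ τ, c'.out = c.out ++ [(u, τ)] ∧ c.time ≤ τ ∧ τ ≤ c'.time := by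
  obtain ⟨-, -, ts, e, hts⟩ := h
  simp only [Config.st, Config.words, e, List.map_append, List.append_cancel_left_eq] at hu
  obtain ⟨⟨v, τ⟩, rfl, hv⟩ := List.map_eq_singleton_iff.1 hu
  obtain rfl : v = u := hv
  exact ⟨τ, e, hts (v, τ) (by simp)⟩

theorem Moves.quiet {M : Machine} {n : ℕ} {c c' : Config} (h : Moves M n c c')
    (hu : c'.st.out = c.st.out) : c'.out = c.out := by
  obtain ⟨-, -, ts, e, -⟩ := h
  have : ts = [] := by simpa [Config.st, Config.words, e] using hu
  simpa [this] using e

section MainLoop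
variable {M M' : Machine} {w : List ℕ} {B V s₀ a₀ b₀ q a : ℕ}

/-- The number of rounds of the main loop in which all processes have their full share of steps. -/
def passLength (B : ℕ) : ℕ := (B - 2) * (2 * B)

/-- The number of steps made by the processes since the last output. -/
def elapsed (B r el : ℕ) : ℕ := (r - 2) * (2 * B) + el

theorem elapsed_lt {r el : ℕ} (hr : r < B) (h2 : 2 ≤ r) (hel : el < 2 * B) :
    elapsed B r el < passLength B := by
  have : (r - 2 + 1) * (2 * B) ≤ (B - 2) * (2 * B) := Nat.mul_le_mul_right _ (by omega)
  unfold elapsed passLength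
  rw [Nat.succ_mul] at this
  omega

theorem elapsed_next {r el : ℕ} (h2 : 2 ≤ r) (hel : el < 2 * B) :
    elapsed B (next B r el).1 (next B r el).2 = elapsed B r el + 1 := by
  unfold elapsed next
  split_ifs with h
  · simp [add_assoc]
  · simp only
    rw [show r + 1 - 2 = r - 2 + 1 by omega, Nat.succ_mul]
    omega

/-- The main loop ends, at a state of the schedule where all processes have had their share
without an output. The number `m` of outputs is bounded, and between two of them at most
`passLength B` rounds are made; this gives the bound `φ` for the number of remaining rounds, on
which the proof is by induction, and the bound `Φ` for the step counters. The time
`H * hopTime V q` is that spent before the loop. -/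
theorem main_loop (hb : Bounds M w B V) (hM' : M'.ConstLE V) (hq : (iter M).size + 1 ≤ q)
    (hcode : CodeAt M' a ((Prog.rep (iter M) 3 17).code a)) {m H d Φ : ℕ}
    (hm : ∀ em : List ℕ, em.Nodup → (∀ x ∈ em, M.flag (proc M w s₀ x) = 2) → em.length ≤ m)
    (hΦ : B + Φ + 1 ≤ V) (hd : (H + passLength B + 1) * hopTime V q ≤ d) (hH : 1 ≤ H) :
    ∀ (φ : ℕ) (c : Config) (r el : ℕ) (s : ℕ → ℕ) (em : List ℕ) (n : ℕ),
      φ = (m - em.length) * passLength B + (passLength B - elapsed B r el) → n + φ ≤ Φ → r < B →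
      c.pc = a → Main M w B V s₀ a₀ b₀ r el s c.st →
      Sched (fun x => M.flag (proc M w s₀ x) = 2) B r el s em n →
      c.words = em.map (fun x => M.word (proc M w s₀ x)) →
      Gap d ((H + elapsed B r el) * hopTime V q) c →
      ∃ (c' : Config) (s' : ℕ → ℕ) (em' : List ℕ) (n' : ℕ), Path M' V (B * B) q c c' ∧
        c'.pc = a + (Prog.rep (iter M) 3 17).size ∧ Main M w B V s₀ a₀ b₀ B 0 s' c'.st ∧
        Sched (fun x => M.flag (proc M w s₀ x) = 2) B B 0 s' em' n' ∧
        c'.words = em'.map (fun x => M.word (proc M w s₀ x)) ∧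
        Gap d ((H + passLength B) * hopTime V q) c' := by
  have hB := hb.big
  have hV2 : 2 ≤ V := by have := hb.le; omega
  intro φ
  induction φ using Nat.strong_induction_on with
  | _ φ ih =>
    intro c r el s em n hφ hn hr hpc hmain hsched hwords hgap
    have hr2 := hsched.le.1
    have hel := hsched.lt.1
    have hlt := elapsed_lt hr hr2 hel
    have hsr := hsched.up r
    obtain ⟨c', mv, est, epc⟩ := (iter M).run_rep (flat_iter M) 3 17 a c hcode hpc
    obtain ⟨hemit, hadv⟩ := hmain.iter hb hr2 hr hel (by omega)
    have htime := mv.time_le (q := q) hM' hV2 hq hmain.good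
    have hpc' : ∀ {r' el' s'}, Main M w B V s₀ a₀ b₀ r' el' s' c'.st →
        c'.pc = if r' < B then a else a + (Prog.rep (iter M) 3 17).size := by
      intro r' el' s' h
      have e3 : c'.reg 3 = r' * B + 2 := h.r3
      have e17 : c'.reg 17 = B * B := h.r17
      rw [epc, e3, e17]
      by_cases hh : r' < B
      · have := region_le (B := B) hh
        rw [if_pos (by omega), if_pos hh]
      · have : B * B ≤ r' * B := Nat.mul_le_mul_right _ (by omega)
        rw [if_neg (by omega), if_neg hh]
    by_cases hev : M.flag (proc M w s₀ (s r)) = 2 ∧ Zone B r (s r)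
    · obtain ⟨hmain', hout⟩ := hemit hev
      have hsched' := hsched.emit hr hev.1 hev.2
      replace hmain' := hmain'.touch hB
      rw [← est] at hmain'
      have hout' : c'.st.out = c.st.out ++ [M.word (proc M w s₀ (s r))] := by rw [est]; exact hout
      obtain ⟨τ, ho, hτ1, hτ2⟩ := mv.output hout'
      have hlen : em.length + 1 ≤ m := by
        have := hm _ hsched'.nodup fun x hx => ((hsched'.mem x).1 hx).1
        simpa using this
      have hgap' : Gap d ((H + elapsed B 2 0) * hopTime V q) c' := by
        refine (hgap.output (k := hopTime V q) (g' := hopTime V q) ho (hτ2.trans htime) ?_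
          (by omega)).mono (Nat.le_mul_of_pos_left _ (by omega))
        rw [← Nat.succ_mul]
        exact (Nat.mul_le_mul_right _ (by omega)).trans hd
      have e0 : elapsed B 2 0 = 0 := by simp [elapsed]
      have hdec : (m - (em ++ [s r]).length) * passLength B + (passLength B - elapsed B 2 0) < φ :=
          by
        rw [hφ, e0, List.length_append, List.length_singleton,
          show m - em.length = m - (em.length + 1) + 1 by omega, Nat.succ_mul]
        omega
      obtain ⟨c'', s', em', n', hp, hrest⟩ := ih _ hdec c' 2 0 _ _ (n + 1) rfl (by omega) (by omega)
        (by rw [hpc' hmain', if_pos (by omega)]) hmain' hsched'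
        (by rw [List.map_append, ← hwords]; exact hout') hgap'
      exact ⟨c'', s', em', n', .head hmain.good (mv.mono hq) hp, hrest⟩
    · obtain ⟨hmain', hout⟩ := hadv hev
      have hsched' := hsched.advance hr hev
      replace hmain' := hmain'.touch hB
      rw [← est] at hmain'
      have hout' : c'.st.out = c.st.out := by rw [est]; exact hout
      have en := elapsed_next (B := B) hr2 hel
      have hgap' : Gap d ((H + elapsed B (next B r el).1 (next B r el).2) * hopTime V q) c' := by
        rw [en, ← add_assoc, Nat.succ_mul]
        exact hgap.later (mv.quiet hout') htime
      by_cases hnB : (next B r el).1 < B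
      · obtain ⟨c'', s', em', n', hp, hrest⟩ := ih (φ - 1) (by omega) c' _ _ _ _ (n + 1)
          (by rw [en, hφ]; omega) (by omega) hnB
          (by rw [hpc' hmain', if_pos hnB]) hmain' hsched' (hout'.trans hwords) hgap'
        exact ⟨c'', s', em', n', .head hmain.good (mv.mono hq) hp, hrest⟩
      · have e1 : (next B r el).1 = B := by have := hsched'.le.2; omega
        have e2 : (next B r el).2 = 0 := hsched'.lt.2 e1
        have hpc'' := hpc' hmain'
        rw [if_neg hnB] at hpc''
        rw [e1, e2] at hmain' hsched' hgap'
        refine ⟨c', _, em, _, .of_moves (mv.mono hq) hmain.good hmain'.good, hpc'', hmain', hsched',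
          hout'.trans hwords, ?_⟩
        simpa [elapsed, passLength] using hgap'

end MainLoop

/-! ### Reading the input -/

/-- Save the registers `i, …, i + k - 1` to the addresses following the one in `R 0`, where `R 1`
holds `1`. -/
def saveCode : ℕ → ℕ → List Instr
  | _, 0 => []
  | i, k + 1 => .add 0 0 1 :: .store 0 i :: saveCode (i + 1) k

/-- The first instructions move the letters out of the first registers. With `n` the length and
`l` the first letter of the input, `R 0` and `R 1` become `p = 2 * n + l` and `n`; then `n` is
stored at the address `p`, which is beyond the input unless this is empty, so that `R 1` can be
used to compute further addresses. -/
def bootCode : List Instr :=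
  [.add 1 1 0, .add 0 0 1, .sub 1 0 1, .store 0 1, .const 1 25, .add 0 0 1, .const 1 1] ++
    (saveCode 2 22 ++ [.const 1 47, .sub 0 0 1, .load 1 0])

section Boot
variable {W : ℕ → ℕ} {n p B V T : ℕ} {σ : St} {o : List (List ℕ)}

/-- The invariant of the saving of registers, after `k` of them have been saved; `W` gives the
initial contents of the registers. If `p = 0`, then the input is empty, and its length need not be
saved. -/
structure Saved (W : ℕ → ℕ) (n p B V T : ℕ) (o : List (List ℕ)) (k : ℕ) (σ : St) : Prop where
  r0 : σ.reg 0 = p + 25 + k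
  r1 : σ.reg 1 = 1
  len : p ≠ 0 → σ.reg p = n
  saved : ∀ i, 2 ≤ i → i < 2 + k → i ≤ n → σ.reg (p + 24 + i) = W i
  kept : ∀ i, 2 + k ≤ i → i ≤ n → σ.reg i = W i
  zero : ∀ a, B ≤ a → σ.reg a = 0
  le : ∀ a, σ.reg a ≤ V
  top : σ.top ≤ T
  out : σ.out = o

theorem Saved.run (hp : n ≤ p) (hB : p + 48 ≤ B) (hT : B ≤ T) (hV : B ≤ V)
    (k j : ℕ) (hkj : k + j ≤ 22) (h : Saved W n p B V T o k σ) :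
    Saved W n p B V T o (k + j) ((Prog.block (saveCode (2 + k) j)).eval σ) := by
  induction j generalizing k σ with
  | zero => exact h
  | succ j ih =>
    simp only [saveCode, Prog.eval_block_cons]
    have u₁ := Upd.add (T := T) σ (i := 0) (j := 0) (l := 1) (by omega) (by omega) (by omega)
    generalize (Instr.add 0 0 1).eff σ = σ₁ at u₁ ⊢
    rw [h.r0, h.r1] at u₁
    have u₂ := Upd.store (T := T) σ₁ (i := 0) (j := 2 + k) (by omega) (by omega)
      (by rw [u₁.self]; omega)
    generalize (Instr.store 0 (2 + k)).eff σ₁ = σ₂ at u₂ ⊢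
    rw [u₁.self, u₁.ne _ (by omega)] at u₂
    have := ih (k + 1) (σ := σ₂) (by omega) ?_
    · rwa [show k + 1 + j = k + (j + 1) by omega, ← add_assoc] at this
    · constructor
      · rw [u₂.ne _ (by omega), u₁.self]; omega
      · rw [u₂.ne _ (by omega), u₁.ne _ (by omega), h.r1]
      · intro h0
        rw [u₂.ne _ (by omega), u₁.ne _ (by omega), h.len h0]
      · intro i h2 hi hn
        by_cases hik : i = 2 + k
        · subst hik
          rw [show p + 24 + (2 + k) = p + 25 + k + 1 by omega, u₂.self, h.kept _ le_rfl hn]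
        · rw [u₂.ne _ (by omega), u₁.ne _ (by omega), h.saved i h2 (by omega) hn]
      · intro i hi hn
        rw [u₂.ne _ (by omega), u₁.ne _ (by omega), h.kept i (by omega) hn]
      · intro a ha
        rw [u₂.ne _ (by omega), u₁.ne _ (by omega), h.zero a ha]
      · exact u₂.le (u₁.le h.le (by omega)) (h.le _)
      · exact u₂.top (u₁.top h.top)
      · rw [u₂.out, u₁.out, h.out]

/-- The result of the first instructions. -/
structure Booted (W : ℕ → ℕ) (n p B V T : ℕ) (o : List (List ℕ)) (σ : St) : Prop where
  r0 : σ.reg 0 = p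
  r1 : σ.reg 1 = n
  saved : ∀ i, 2 ≤ i → i < 24 → i ≤ n → σ.reg (p + 24 + i) = W i
  kept : ∀ i, 24 ≤ i → i ≤ n → σ.reg i = W i
  zero : ∀ a, B ≤ a → σ.reg a = 0
  le : ∀ a, σ.reg a ≤ V
  top : σ.top ≤ T
  out : σ.out = o

theorem boot_spec (h0 : σ.reg 0 = n) (hn : ∀ i, n < i → σ.reg i = 0) (hp : p = 2 * n + σ.reg 1)
    (hB : p + 48 ≤ B) (hT : B ≤ T) (hV : B ≤ V) (hW : ∀ i, σ.reg i ≤ V) (ht : σ.top ≤ T) :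
    Booted σ.reg n p B V T σ.out ((Prog.block bootCode).eval σ) := by
  have hp1 : n = 0 ∧ p = 0 ∨ 1 ≤ n ∧ 2 ≤ p := by
    rcases Nat.eq_zero_or_pos n with h | h
    · left
      have := hn 1 (by omega)
      omega
    · right; omega
  simp only [bootCode, Prog.eval_block_append, Prog.eval_block_cons, Prog.eval_block_nil]
  have u₁ := Upd.add (T := T) σ (i := 1) (j := 1) (l := 0) (by omega) (by omega) (by omega)
  generalize (Instr.add 1 1 0).eff σ = σ₁ at u₁ ⊢
  have u₂ := Upd.add (T := T) σ₁ (i := 0) (j := 0) (l := 1) (by omega) (by omega) (by omega)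
  generalize (Instr.add 0 0 1).eff σ₁ = σ₂ at u₂ ⊢
  rw [u₁.self, u₁.ne 0 (by omega), show σ.reg 0 + (σ.reg 1 + σ.reg 0) = p by omega] at u₂
  have u₃ := Upd.sub (T := T) σ₂ (i := 1) (j := 0) (l := 1) (by omega) (by omega) (by omega)
  generalize (Instr.sub 1 0 1).eff σ₂ = σ₃ at u₃ ⊢
  rw [u₂.self, u₂.ne 1 (by omega), u₁.self, show p - (σ.reg 1 + σ.reg 0) = n by omega] at u₃
  have v₃ : σ₃.reg 0 = p := by rw [u₃.ne _ (by omega), u₂.self]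
  have u₄ := Upd.store (T := T) σ₃ (i := 0) (j := 1) (by omega) (by omega) (by omega)
  generalize (Instr.store 0 1).eff σ₃ = σ₄ at u₄ ⊢
  rw [v₃, u₃.self] at u₄
  have v₄ : σ₄.reg 0 = p := by
    by_cases hp0 : p = 0
    · have e := u₄.self
      rw [hp0] at e
      omega
    · rw [u₄.ne _ (by omega), v₃]
  have u₅ := Upd.const (T := T) σ₄ (i := 1) (c := 25) (by omega)
  generalize (Instr.const 1 25).eff σ₄ = σ₅ at u₅ ⊢
  have u₆ := Upd.add (T := T) σ₅ (i := 0) (j := 0) (l := 1) (by omega) (by omega) (by omega)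
  generalize (Instr.add 0 0 1).eff σ₅ = σ₆ at u₆ ⊢
  rw [u₅.self, u₅.ne 0 (by omega), v₄] at u₆
  have u₇ := Upd.const (T := T) σ₆ (i := 1) (c := 1) (by omega)
  generalize (Instr.const 1 1).eff σ₆ = σ₇ at u₇ ⊢
  have far : ∀ a, 2 ≤ a → a ≠ p → σ₇.reg a = σ.reg a := fun a ha hap => by
    rw [u₇.ne _ (by omega), u₆.ne _ (by omega), u₅.ne _ (by omega), u₄.ne _ (by omega),
      u₃.ne _ (by omega), u₂.ne _ (by omega), u₁.ne _ (by omega)]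
  have s₇ : Saved σ.reg n p B V T σ.out 0 σ₇ := by
    constructor
    · rw [u₇.ne _ (by omega), u₆.self]
    · exact u₇.self
    · intro hp0
      rw [u₇.ne _ (by omega), u₆.ne _ (by omega), u₅.ne _ (by omega), u₄.self]
    · intro i h2 h2'; omega
    · intro i h2 hin
      exact far i (by omega) (by omega)
    · intro a ha
      rw [far a (by omega) (by omega)]
      exact hn a (by omega)
    · refine u₇.le (u₆.le (u₅.le (u₄.le (u₃.le (u₂.le (u₁.le hW ?_) ?_) ?_) ?_) ?_) ?_) ?_ <;> omega
    · exact u₇.top (u₆.top (u₅.top (u₄.top (u₃.top (u₂.top (u₁.top ht))))))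
    · rw [u₇.out, u₆.out, u₅.out, u₄.out, u₃.out, u₂.out, u₁.out]
  have s₈ := Saved.run (by omega) hB hT hV 0 22 (by norm_num) s₇
  simp only [add_zero, zero_add] at s₈
  generalize (Prog.block (saveCode 2 22)).eval σ₇ = σ₈ at s₈ ⊢
  have u₉ := Upd.const (T := T) σ₈ (i := 1) (c := 47) (by omega)
  generalize (Instr.const 1 47).eff σ₈ = σ₉ at u₉ ⊢
  have uA := Upd.sub (T := T) σ₉ (i := 0) (j := 0) (l := 1) (by omega) (by omega) (by omega)
  generalize (Instr.sub 0 0 1).eff σ₉ = σA at uA ⊢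
  rw [u₉.self, u₉.ne 0 (by omega), s₈.r0, show p + 25 + 22 - 47 = p by omega] at uA
  have uB := Upd.load (T := T) σA (i := 1) (j := 0) (by omega) (by omega) (by rw [uA.self]; omega)
  generalize (Instr.load 1 0).eff σA = σB at uB ⊢
  have vA : σA.reg p = n := by
    by_cases hp0 : p = 0
    · have e := uA.self
      rw [hp0] at e ⊢
      omega
    · rw [uA.ne _ (by omega), u₉.ne _ (by omega), s₈.len hp0]
  rw [uA.self, vA] at uB
  have far' : ∀ a, 2 ≤ a → σB.reg a = σ₈.reg a := fun a ha => by
    rw [uB.ne _ (by omega), uA.ne _ (by omega), u₉.ne _ (by omega)]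
  constructor
  · rw [uB.ne _ (by omega), uA.self]
  · exact uB.self
  · intro i h2 hi hin
    rw [far' _ (by omega), s₈.saved i h2 (by omega) hin]
  · intro i hi hin
    rw [far' _ (by omega), s₈.kept i (by omega) hin]
  · intro a ha
    rw [far' _ (by omega), s₈.zero a ha]
  · refine uB.le (uA.le (u₉.le s₈.le ?_) ?_) ?_ <;> omega
  · exact uB.top (uA.top (u₉.top s₈.top))
  · rw [uB.out, uA.out, u₉.out, s₈.out]

/-- The constants that are kept during the whole computation. -/
structure Consts (B n p : ℕ) (ρ : ℕ → ℕ) : Prop where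
  r12 : ρ 12 = 2 * B
  r15 : ρ 15 = B
  r16 : ρ 16 = 1
  r17 : ρ 17 = B * B
  r18 : ρ 18 = 2 * B + 2
  r19 : ρ 19 = 0
  r20 : ρ 20 = 2
  r21 : ρ 21 = n
  r22 : ρ 22 = p + 24

theorem Consts.congr {ρ ρ' : ℕ → ℕ} (h : Consts B n p ρ)
    (e : ∀ a, 12 ≤ a → a < 23 → a ≠ 13 → a ≠ 14 → ρ' a = ρ a) : Consts B n p ρ' := by
  constructor <;> rw [e _ (by norm_num) (by norm_num) (by norm_num) (by norm_num)]
  exacts [h.r12, h.r15, h.r16, h.r17, h.r18, h.r19, h.r20, h.r21, h.r22]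

/-- The computation of the parameter `c * (n + 1) ^ b` and of the other constants. -/
def setupCode (c b : ℕ) : List Instr :=
  [.add 2 1 1, .sub 2 0 2, .const 3 25, .add 3 0 3, .store 3 2, .const 4 24, .add 22 0 4, .copy 21
    1,
    .const 16 1, .const 19 0, .const 20 2, .add 4 21 16, .const 15 c] ++
  (List.replicate b (.mul 15 15 4) ++
  [.mul 17 15 15, .add 12 15 15, .copy 13 15, .add 18 12 20, .add 3 15 20, .store 3 21, .add 2 15
    16,
    .store 2 15, .const 11 1, .const 10 23])

theorem eval_replicate_mul {σ : St} {y b : ℕ} (hT : 30 ≤ T) (h4 : σ.reg 4 = y) :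
    ∃ σ', (Prog.block (List.replicate b (.mul 15 15 4))).eval σ = σ' ∧
      Upd T σ σ' 15 (σ.reg 15 * y ^ b) := by
  refine ⟨_, rfl, ?_⟩
  induction b generalizing σ with
  | zero => exact ⟨by simp, fun _ _ => rfl, id, rfl⟩
  | succ b ih =>
    rw [List.replicate_succ, Prog.eval_block_cons]
    have u₁ := Upd.mul (T := T) σ (i := 15) (j := 15) (l := 4) (by omega) (by omega) (by omega)
    generalize (Instr.mul 15 15 4).eff σ = σ₁ at u₁ ⊢
    have u₂ := ih (σ := σ₁) (by rw [u₁.ne _ (by norm_num), h4])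
    refine ⟨?_, fun e he => ?_, fun h => u₂.top (u₁.top h), u₂.out.trans u₁.out⟩
    · rw [u₂.self, u₁.self, h4, pow_succ']; ring
    · rw [u₂.ne e he, u₁.ne e he]

/-- The state when the copying of the input starts; region `1` is filled except for the letters of
the input, of which `k` have been copied. -/
structure Input (W : ℕ → ℕ) (n p B V : ℕ) (k : ℕ) (σ : St) : Prop where
  consts : Consts B n p σ.reg
  r3 : σ.reg 3 = B + 2
  r10 : σ.reg 10 = 23
  r11 : σ.reg 11 = k + 1
  r13 : σ.reg 13 = B
  saved : ∀ i, 1 ≤ i → i < 24 → i ≤ max n 1 → σ.reg (p + 24 + i) = W i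
  kept : ∀ i, 24 ≤ i → i ≤ n → σ.reg i = W i
  line : σ.reg B = 0
  counter : σ.reg (B + 1) = B
  length : σ.reg (B + 2) = n
  copied : ∀ i, 1 ≤ i → i ≤ k → σ.reg (B + 2 + i) = W i
  zero : ∀ a, B + 2 + k < a → σ.reg a = 0
  good : Good V (B * B) σ

theorem setup_spec {c b : ℕ} (h : Booted W n p B V (B * B) o σ) (hB : B = c * (n + 1) ^ b)
    (hp : p = 2 * n + W 1) (h48 : p + 48 ≤ B) (hV : B * B + 2 ≤ V) :
    Input W n p B V 0 ((Prog.block (setupCode c b)).eval σ) ∧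
      ((Prog.block (setupCode c b)).eval σ).out = o := by
  have hBB : 48 * B ≤ B * B := Nat.mul_le_mul_right _ (by omega)
  simp only [setupCode, Prog.eval_block_append, Prog.eval_block_cons, Prog.eval_block_nil]
  have u₁ := Upd.add (T := B * B) σ (i := 2) (j := 1) (l := 1) (by omega) (by omega) (by omega)
  generalize (Instr.add 2 1 1).eff σ = σ₁ at u₁ ⊢
  have u₂ := Upd.sub (T := B * B) σ₁ (i := 2) (j := 0) (l := 2) (by omega) (by omega) (by omega)
  generalize (Instr.sub 2 0 2).eff σ₁ = σ₂ at u₂ ⊢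
  rw [u₁.self, u₁.ne 0 (by omega), h.r0, h.r1, show p - (n + n) = W 1 by omega] at u₂
  have u₃ := Upd.const (T := B * B) σ₂ (i := 3) (c := 25) (by omega)
  generalize (Instr.const 3 25).eff σ₂ = σ₃ at u₃ ⊢
  have u₄ := Upd.add (T := B * B) σ₃ (i := 3) (j := 0) (l := 3) (by omega) (by omega) (by omega)
  generalize (Instr.add 3 0 3).eff σ₃ = σ₄ at u₄ ⊢
  have v₃ : ∀ a, a ≠ 2 → a ≠ 3 → σ₃.reg a = σ.reg a := fun a h2 h3 => by
    rw [u₃.ne _ h3, u₂.ne _ h2, u₁.ne _ h2]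
  rw [u₃.self, v₃ 0 (by omega) (by omega), h.r0] at u₄
  have u₅ := Upd.store (T := B * B) σ₄ (i := 3) (j := 2) (by omega) (by omega)
    (by rw [u₄.self]; omega)
  generalize (Instr.store 3 2).eff σ₄ = σ₅ at u₅ ⊢
  rw [u₄.self, u₄.ne 2 (by omega), u₃.ne 2 (by omega), u₂.self] at u₅
  have v₅ : ∀ a, a ≠ 2 → a ≠ 3 → a ≠ p + 25 → σ₅.reg a = σ.reg a := fun a h2 h3 ha => by
    rw [u₅.ne _ ha, u₄.ne _ h3, v₃ a h2 h3]
  have u₆ := Upd.const (T := B * B) σ₅ (i := 4) (c := 24) (by omega)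
  generalize (Instr.const 4 24).eff σ₅ = σ₆ at u₆ ⊢
  have u₇ := Upd.add (T := B * B) σ₆ (i := 22) (j := 0) (l := 4) (by omega) (by omega) (by omega)
  generalize (Instr.add 22 0 4).eff σ₆ = σ₇ at u₇ ⊢
  rw [u₆.self, u₆.ne 0 (by omega), v₅ 0 (by omega) (by omega) (by omega), h.r0] at u₇
  have u₈ := Upd.copy (T := B * B) σ₇ (i := 21) (j := 1) (by omega) (by omega)
  generalize (Instr.copy 21 1).eff σ₇ = σ₈ at u₈ ⊢
  rw [u₇.ne 1 (by omega), u₆.ne 1 (by omega), v₅ 1 (by omega) (by omega) (by omega), h.r1] at u₈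
  have u₉ := Upd.const (T := B * B) σ₈ (i := 16) (c := 1) (by omega)
  generalize (Instr.const 16 1).eff σ₈ = σ₉ at u₉ ⊢
  have u₁₀ := Upd.const (T := B * B) σ₉ (i := 19) (c := 0) (by omega)
  generalize (Instr.const 19 0).eff σ₉ = σ₁₀ at u₁₀ ⊢
  have u₁₁ := Upd.const (T := B * B) σ₁₀ (i := 20) (c := 2) (by omega)
  generalize (Instr.const 20 2).eff σ₁₀ = σ₁₁ at u₁₁ ⊢
  have u₁₂ := Upd.add (T := B * B) σ₁₁ (i := 4) (j := 21) (l := 16) (by omega) (by omega) (by omega)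
  generalize (Instr.add 4 21 16).eff σ₁₁ = σ₁₂ at u₁₂ ⊢
  have v₁₁ : σ₁₁.reg 16 = 1 := by rw [u₁₁.ne _ (by omega), u₁₀.ne _ (by omega), u₉.self]
  have w₁₁ : σ₁₁.reg 21 = n := by
    rw [u₁₁.ne _ (by omega), u₁₀.ne _ (by omega), u₉.ne _ (by omega), u₈.self]
  rw [v₁₁, w₁₁] at u₁₂
  have u₁₃ := Upd.const (T := B * B) σ₁₂ (i := 15) (c := c) (by omega)
  generalize (Instr.const 15 c).eff σ₁₂ = σ₁₃ at u₁₃ ⊢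
  obtain ⟨σ₁₄, q₁₄, u₁₄⟩ := eval_replicate_mul (T := B * B) (σ := σ₁₃) (y := n + 1) (b := b)
    (by omega) (by rw [u₁₃.ne _ (by omega), u₁₂.self])
  rw [q₁₄]
  rw [u₁₃.self, ← hB] at u₁₄
  have n₁₄ : ∀ a, a ≠ 2 → a ≠ 3 → a ≠ 4 → a ≠ 15 → a ≠ 16 → a ≠ 19 → a ≠ 20 → a ≠ 21 → a ≠ 22 →
      a ≠ p + 25 → σ₁₄.reg a = σ.reg a := by
    intro a h2 h3 h4 h15 h16 h19 h20 h21 h22 hp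
    rw [u₁₄.ne _ h15, u₁₃.ne _ h15, u₁₂.ne _ h4, u₁₁.ne _ h20, u₁₀.ne _ h19, u₉.ne _ h16,
      u₈.ne _ h21, u₇.ne _ h22, u₆.ne _ h4, v₅ a h2 h3 hp]
  have p₁₄ : σ₁₄.reg (p + 25) = W 1 := by
    rw [u₁₄.ne _ (by omega), u₁₃.ne _ (by omega), u₁₂.ne _ (by omega), u₁₁.ne _ (by omega),
      u₁₀.ne _ (by omega), u₉.ne _ (by omega), u₈.ne _ (by omega), u₇.ne _ (by omega),
      u₆.ne _ (by omega), u₅.self]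
  have v16 : σ₁₄.reg 16 = 1 := by
    rw [u₁₄.ne _ (by omega), u₁₃.ne _ (by omega), u₁₂.ne _ (by omega), v₁₁]
  have v19 : σ₁₄.reg 19 = 0 := by
    rw [u₁₄.ne _ (by omega), u₁₃.ne _ (by omega), u₁₂.ne _ (by omega), u₁₁.ne _ (by omega),
        u₁₀.self]
  have v20 : σ₁₄.reg 20 = 2 := by
    rw [u₁₄.ne _ (by omega), u₁₃.ne _ (by omega), u₁₂.ne _ (by omega), u₁₁.self]
  have v21 : σ₁₄.reg 21 = n := by
    rw [u₁₄.ne _ (by omega), u₁₃.ne _ (by omega), u₁₂.ne _ (by omega), w₁₁]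
  have v22 : σ₁₄.reg 22 = p + 24 := by
    rw [u₁₄.ne _ (by omega), u₁₃.ne _ (by omega), u₁₂.ne _ (by omega), u₁₁.ne _ (by omega),
      u₁₀.ne _ (by omega), u₉.ne _ (by omega), u₈.ne _ (by omega), u₇.self]
  have hc : c ≤ V := by
    have : c * 1 ≤ c * (n + 1) ^ b := Nat.mul_le_mul_left _ (Nat.one_le_pow _ _ (by omega))
    omega
  have l₁₄ : ∀ a, σ₁₄.reg a ≤ V := by
    have hW1 : W 1 ≤ V := by omega
    have l₃ : ∀ a, σ₃.reg a ≤ V := by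
      refine u₃.le (u₂.le (u₁.le h.le ?_) ?_) ?_
      · rw [h.r1]; omega
      · omega
      · omega
    refine u₁₄.le (u₁₃.le (u₁₂.le (u₁₁.le (u₁₀.le (u₉.le (u₈.le (u₇.le (u₆.le (u₅.le (u₄.le l₃
      ?_) ?_) ?_) ?_) ?_) ?_) ?_) ?_) ?_) ?_) ?_ <;> omega
  have t₁₄ : σ₁₄.top ≤ B * B := u₁₄.top (u₁₃.top (u₁₂.top (u₁₁.top (u₁₀.top (u₉.top (u₈.top
    (u₇.top (u₆.top (u₅.top (u₄.top (u₃.top (u₂.top (u₁.top h.top)))))))))))))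
  have o₁₄ : σ₁₄.out = o := by
    rw [u₁₄.out, u₁₃.out, u₁₂.out, u₁₁.out, u₁₀.out, u₉.out, u₈.out, u₇.out, u₆.out, u₅.out, u₄.out,
      u₃.out, u₂.out, u₁.out, h.out]
  have v15 := u₁₄.self
  clear q₁₄ u₁₄ u₁₃ u₁₂ u₁₁ u₁₀ u₉ u₈ u₇ u₆ u₅ u₄ u₃ u₂ u₁ v₃ v₅ v₁₁ w₁₁
  have u₁ := Upd.mul (T := B * B) σ₁₄ (i := 17) (j := 15) (l := 15) (by omega) (by omega) (by omega)
  generalize (Instr.mul 17 15 15).eff σ₁₄ = τ₁ at u₁ ⊢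
  rw [v15] at u₁
  have u₂ := Upd.add (T := B * B) τ₁ (i := 12) (j := 15) (l := 15) (by omega) (by omega) (by omega)
  generalize (Instr.add 12 15 15).eff τ₁ = τ₂ at u₂ ⊢
  rw [u₁.ne 15 (by omega), v15] at u₂
  have u₃ := Upd.copy (T := B * B) τ₂ (i := 13) (j := 15) (by omega) (by omega)
  generalize (Instr.copy 13 15).eff τ₂ = τ₃ at u₃ ⊢
  have v₂ : τ₂.reg 15 = B := by rw [u₂.ne 15 (by omega), u₁.ne 15 (by omega), v15]
  rw [v₂] at u₃
  have u₄ := Upd.add (T := B * B) τ₃ (i := 18) (j := 12) (l := 20) (by omega) (by omega) (by omega)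
  generalize (Instr.add 18 12 20).eff τ₃ = τ₄ at u₄ ⊢
  have w₃ : τ₃.reg 20 = 2 := by
    rw [u₃.ne _ (by omega), u₂.ne _ (by omega), u₁.ne _ (by omega), v20]
  rw [u₃.ne 12 (by omega), u₂.self, w₃] at u₄
  have u₅ := Upd.add (T := B * B) τ₄ (i := 3) (j := 15) (l := 20) (by omega) (by omega) (by omega)
  generalize (Instr.add 3 15 20).eff τ₄ = τ₅ at u₅ ⊢
  rw [u₄.ne 15 (by omega), u₃.ne 15 (by omega), v₂, u₄.ne 20 (by omega), w₃] at u₅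
  have u₆ := Upd.store (T := B * B) τ₅ (i := 3) (j := 21) (by omega) (by omega)
    (by rw [u₅.self]; omega)
  generalize (Instr.store 3 21).eff τ₅ = τ₆ at u₆ ⊢
  rw [u₅.self, u₅.ne 21 (by omega), u₄.ne 21 (by omega), u₃.ne 21 (by omega), u₂.ne 21 (by omega),
    u₁.ne 21 (by omega), v21] at u₆
  have v₆ : τ₆.reg 15 = B := by
    rw [u₆.ne 15 (by omega), u₅.ne 15 (by omega), u₄.ne 15 (by omega), u₃.ne 15 (by omega), v₂]
  have w₆ : τ₆.reg 16 = 1 := by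
    rw [u₆.ne 16 (by omega), u₅.ne 16 (by omega), u₄.ne 16 (by omega), u₃.ne 16 (by omega),
      u₂.ne 16 (by omega), u₁.ne 16 (by omega), v16]
  have u₇ := Upd.add (T := B * B) τ₆ (i := 2) (j := 15) (l := 16) (by omega) (by omega) (by omega)
  generalize (Instr.add 2 15 16).eff τ₆ = τ₇ at u₇ ⊢
  rw [v₆, w₆] at u₇
  have u₈ := Upd.store (T := B * B) τ₇ (i := 2) (j := 15) (by omega) (by omega)
    (by rw [u₇.self]; omega)
  generalize (Instr.store 2 15).eff τ₇ = τ₈ at u₈ ⊢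
  rw [u₇.self, u₇.ne 15 (by omega), v₆] at u₈
  have u₉ := Upd.const (T := B * B) τ₈ (i := 11) (c := 1) (by omega)
  generalize (Instr.const 11 1).eff τ₈ = τ₉ at u₉ ⊢
  have uA := Upd.const (T := B * B) τ₉ (i := 10) (c := 23) (by omega)
  generalize (Instr.const 10 23).eff τ₉ = τA at uA ⊢
  have nA : ∀ a, a ≠ 2 → a ≠ 3 → a ≠ 10 → a ≠ 11 → a ≠ 12 → a ≠ 13 → a ≠ 17 → a ≠ 18 →
      a ≠ B + 1 → a ≠ B + 2 → τA.reg a = σ₁₄.reg a := by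
    intro a h2 h3 h10 h11 h12 h13 h17 h18 hb1 hb2
    rw [uA.ne _ h10, u₉.ne _ h11, u₈.ne _ hb1, u₇.ne _ h2, u₆.ne _ hb2, u₅.ne _ h3, u₄.ne _ h18,
      u₃.ne _ h13, u₂.ne _ h12, u₁.ne _ h17]
  have m8 : ∀ a, 11 < a → a < 30 → τA.reg a = τ₅.reg a := fun a ha ha' => by
    rw [uA.ne _ (by omega), u₉.ne _ (by omega), u₈.ne _ (by omega), u₇.ne _ (by omega),
      u₆.ne _ (by omega)]
  have far : ∀ a, 23 ≤ a → a ≠ p + 25 → a ≠ B + 1 → a ≠ B + 2 → τA.reg a = σ.reg a := by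
    intro a ha hap h1 h2
    rw [nA a (by omega) (by omega) (by omega) (by omega) (by omega) (by omega) (by omega) (by omega)
      h1 h2, n₁₄ a (by omega) (by omega) (by omega) (by omega) (by omega) (by omega) (by omega)
      (by omega) (by omega) hap]
  refine ⟨⟨⟨?_, ?_, ?_, ?_, ?_, ?_, ?_, ?_, ?_⟩, ?_, uA.self, ?_, ?_, ?_, ?_, ?_, ?_, ?_, ?_, ?_,
    ?_⟩, ?_⟩
  · rw [m8 _ (by omega) (by omega), u₅.ne _ (by omega), u₄.ne _ (by omega), u₃.ne _ (by omega),
      u₂.self]; ring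
  · rw [m8 _ (by omega) (by omega), u₅.ne _ (by omega), u₄.ne _ (by omega), u₃.ne _ (by omega), v₂]
  · rw [m8 _ (by omega) (by omega), u₅.ne _ (by omega), u₄.ne _ (by omega), u₃.ne _ (by omega),
      u₂.ne _ (by omega), u₁.ne _ (by omega), v16]
  · rw [m8 _ (by omega) (by omega), u₅.ne _ (by omega), u₄.ne _ (by omega), u₃.ne _ (by omega),
      u₂.ne _ (by omega), u₁.self]
  · rw [m8 _ (by omega) (by omega), u₅.ne _ (by omega), u₄.self]; ring
  · rw [m8 _ (by omega) (by omega), u₅.ne _ (by omega), u₄.ne _ (by omega), u₃.ne _ (by omega),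
      u₂.ne _ (by omega), u₁.ne _ (by omega), v19]
  · rw [m8 _ (by omega) (by omega), u₅.ne _ (by omega), u₄.ne _ (by omega), w₃]
  · rw [m8 _ (by omega) (by omega), u₅.ne _ (by omega), u₄.ne _ (by omega), u₃.ne _ (by omega),
      u₂.ne _ (by omega), u₁.ne _ (by omega), v21]
  · rw [m8 _ (by omega) (by omega), u₅.ne _ (by omega), u₄.ne _ (by omega), u₃.ne _ (by omega),
      u₂.ne _ (by omega), u₁.ne _ (by omega), v22]
  · rw [uA.ne _ (by omega), u₉.ne _ (by omega), u₈.ne _ (by omega), u₇.ne _ (by omega),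
      u₆.ne _ (by omega), u₅.self]
  · rw [uA.ne _ (by omega), u₉.self]
  · rw [m8 _ (by omega) (by omega), u₅.ne _ (by omega), u₄.ne _ (by omega), u₃.self]
  · intro i h1 hi hin
    by_cases hi1 : i = 1
    · subst hi1
      rw [nA _ (by omega) (by omega) (by omega) (by omega) (by omega) (by omega) (by omega)
        (by omega) (by omega) (by omega), p₁₄]
    · rw [far _ (by omega) (by omega) (by omega) (by omega), h.saved i (by omega) hi (by omega)]
  · intro i hi hin
    rw [far _ (by omega) (by omega) (by omega) (by omega), h.kept i hi hin]
  · rw [far _ (by omega) (by omega) (by omega) (by omega), h.zero _ le_rfl]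
  · rw [uA.ne _ (by omega), u₉.ne _ (by omega), u₈.self]
  · rw [uA.ne _ (by omega), u₉.ne _ (by omega), u₈.ne _ (by omega), u₇.ne _ (by omega), u₆.self]
  · intro i h1 h2; omega
  · intro a ha
    rw [far _ (by omega) (by omega) (by omega) (by omega), h.zero _ (by omega)]
  · refine ⟨?_, ?_⟩
    · refine uA.le (u₉.le (u₈.le (u₇.le (u₆.le (u₅.le (u₄.le (u₃.le (u₂.le (u₁.le l₁₄ ?_) ?_) ?_)
        ?_) ?_) ?_) ?_) ?_) ?_) ?_ <;> omega
    · exact uA.top (u₉.top (u₈.top (u₇.top (u₆.top (u₅.top (u₄.top (u₃.top (u₂.top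
        (u₁.top t₁₄)))))))))
  · rw [uA.out, u₉.out, u₈.out, u₇.out, u₆.out, u₅.out, u₄.out, u₃.out, u₂.out, u₁.out, o₁₄]

end Boot

/-- The copying of a letter of the input to region `1`; letter `i` is found at the address
`R 22 + i` if `i ≤ 23` and in register `i` otherwise. -/
def inputBody : Prog :=
  .seq (.block [.copy 0 11]) (.seq (.ite 11 10 (.block [.add 0 0 22]) .nop)
    (.block [.load 1 0, .add 2 3 11, .store 2 1, .add 11 11 16]))

section Prelude
variable {W : ℕ → ℕ} {n p B V : ℕ} {σ : St}

theorem input_step {k : ℕ} (h : Input W n p B V k σ) (hk : k < max n 1) (hp : 2 * n ≤ p)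
    (h48 : p + 48 ≤ B) (hV : B * B ≤ V) (hW : ∀ i, W i ≤ V) :
    Input W n p B V (k + 1) ((inputBody.eval σ).touch 11 21) ∧ (inputBody.eval σ).out = σ.out ∧
      ((inputBody.eval σ).reg 11 ≤ (inputBody.eval σ).reg 21 ↔ k + 1 < max n 1) := by
  have hBB : 48 * B ≤ B * B := Nat.mul_le_mul_right _ (by omega)
  simp only [inputBody, Prog.eval_seq, Prog.eval_block_cons, Prog.eval_block_nil]
  have u₁ := Upd.copy (T := B * B) σ (i := 0) (j := 11) (by omega) (by omega)
  generalize (Instr.copy 0 11).eff σ = σ₁ at u₁ ⊢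
  rw [h.r11] at u₁
  have n₁ : ∀ a, a ≠ 0 → σ₁.reg a = σ.reg a := u₁.ne
  obtain ⟨σ₂, e₂, v₂, n₂, l₂, t₂, o₂⟩ : ∃ σ₂, (Prog.ite 11 10 (.block [.add 0 0 22]) .nop).eval σ₁
      = σ₂ ∧
      (∃ x ≤ B, σ₂.reg 0 = x ∧ σ.reg x = W (k + 1)) ∧ (∀ a, a ≠ 0 → σ₂.reg a = σ.reg a) ∧
      (∀ a, σ₂.reg a ≤ V) ∧ σ₂.top ≤ B * B ∧ σ₂.out = σ.out := by
    have l₁ := u₁.le h.good.1 (by omega)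
    have t₁ := St.touch_top (u₁.top h.good.2) (i := 11) (j := 10) (by omega) (by omega)
    refine ⟨_, rfl, ?_⟩
    by_cases hk2 : k + 1 ≤ 23
    · rw [Prog.eval_ite_pos (by rwa [n₁ 11 (by omega), n₁ 10 (by omega), h.r11, h.r10])]
      simp only [Prog.eval_block_cons, Prog.eval_block_nil]
      have u := Upd.add (T := B * B) (σ₁.touch 11 10) (i := 0) (j := 0) (l := 22) (by omega) (by
          omega)
        (by omega)
      rw [St.touch_reg, u₁.self, n₁ 22 (by omega), h.consts.r22] at u
      refine ⟨⟨_, ?_, u.self, ?_⟩, fun a ha => (u.ne a ha).trans (n₁ a ha), u.le l₁ (by omega),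
        u.top t₁, u.out.trans u₁.out⟩
      · omega
      · rw [← h.saved (k + 1) (by omega) (by omega) (by omega)]; congr 1; omega
    · rw [Prog.eval_ite_neg (by rwa [n₁ 11 (by omega), n₁ 10 (by omega), h.r11, h.r10])]
      exact ⟨⟨_, by omega, u₁.self, h.kept _ (by omega) (by omega)⟩, n₁, l₁, t₁, u₁.out⟩
  rw [e₂]
  obtain ⟨x, hx, v₂, wx⟩ := v₂
  -- The letter is read from the address `x` in `R 0`; `x = 0` would mean that it is in `R 0`
  -- itself, which has been overwritten, but this does not happen.
  have hxx : σ₂.reg x = W (k + 1) := by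
    by_cases hx0 : x = 0
    · have : n = 0 ∨ k + 1 ≤ n := by omega
      by_cases hk2 : k + 1 ≤ 23
      · by_contra
        subst hx0
        rw [Prog.eval_ite_pos (by rwa [n₁ 11 (by omega), n₁ 10 (by omega), h.r11, h.r10])] at e₂
        have u := Upd.add (T := B * B) (σ₁.touch 11 10) (i := 0) (j := 0) (l := 22) (by omega)
          (by omega) (by omega)
        have e₂' : (Instr.add 0 0 22).eff (σ₁.touch 11 10) = σ₂ := e₂
        rw [e₂', St.touch_reg, u₁.self] at u
        have := u.self
        omega
      · rw [hx0, v₂]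
        rw [Prog.eval_ite_neg (by rwa [n₁ 11 (by omega), n₁ 10 (by omega), h.r11, h.r10])] at e₂
        have e₂' : (σ₁.touch 11 10) = σ₂ := e₂
        rw [← e₂', St.touch_reg, u₁.self] at v₂
        omega
    · rw [n₂ x hx0, wx]
  have u₃ := Upd.load (T := B * B) σ₂ (i := 1) (j := 0) (by omega) (by omega) (by omega)
  generalize (Instr.load 1 0).eff σ₂ = σ₃ at u₃ ⊢
  rw [v₂, hxx] at u₃
  have u₄ := Upd.add (T := B * B) σ₃ (i := 2) (j := 3) (l := 11) (by omega) (by omega) (by omega)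
  generalize (Instr.add 2 3 11).eff σ₃ = σ₄ at u₄ ⊢
  rw [u₃.ne 3 (by omega), u₃.ne 11 (by omega), n₂ 3 (by omega), n₂ 11 (by omega), h.r3, h.r11] at u₄
  have u₅ := Upd.store (T := B * B) σ₄ (i := 2) (j := 1) (by omega) (by omega)
    (by rw [u₄.self]; omega)
  generalize (Instr.store 2 1).eff σ₄ = σ₅ at u₅ ⊢
  rw [u₄.self, u₄.ne 1 (by omega), u₃.self] at u₅
  have u₆ := Upd.add (T := B * B) σ₅ (i := 11) (j := 11) (l := 16) (by omega) (by omega) (by omega)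
  generalize (Instr.add 11 11 16).eff σ₅ = σ₆ at u₆ ⊢
  have n₅ : ∀ a, 2 < a → a ≠ B + 2 + (k + 1) → σ₅.reg a = σ.reg a := fun a h2 ha => by
    rw [u₅.ne _ (by omega), u₄.ne _ (by omega), u₃.ne _ (by omega), n₂ _ (by omega)]
  rw [n₅ 11 (by omega) (by omega), n₅ 16 (by omega) (by omega), h.r11, h.consts.r16] at u₆
  have n₆ : ∀ a, 2 < a → a ≠ 11 → a ≠ B + 2 + (k + 1) → σ₆.reg a = σ.reg a := fun a h2 h11 ha => by
    rw [u₆.ne _ h11, n₅ a h2 ha]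
  refine ⟨⟨?_, ?_, ?_, u₆.self, ?_, ?_, ?_, ?_, ?_, ?_, ?_, ?_, ?_, ?_⟩, ?_, ?_⟩
  · exact h.consts.congr fun a h1 h2 _ _ => n₆ a (by omega) (by omega) (by omega)
  · exact (n₆ 3 (by omega) (by omega) (by omega)).trans h.r3
  · exact (n₆ 10 (by omega) (by omega) (by omega)).trans h.r10
  · exact (n₆ 13 (by omega) (by omega) (by omega)).trans h.r13
  · exact fun i h1 h24 hi => (n₆ _ (by omega) (by omega) (by omega)).trans (h.saved i h1 h24 hi)
  · exact fun i h24 hi => (n₆ _ (by omega) (by omega) (by omega)).trans (h.kept i h24 hi)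
  · exact (n₆ _ (by omega) (by omega) (by omega)).trans h.line
  · exact (n₆ _ (by omega) (by omega) (by omega)).trans h.counter
  · exact (n₆ _ (by omega) (by omega) (by omega)).trans h.length
  · intro i h1 hi
    by_cases hik : i = k + 1
    · subst hik
      exact (u₆.ne _ (by omega)).trans u₅.self
    · exact (n₆ _ (by omega) (by omega) (by omega)).trans (h.copied i h1 (by omega))
  · exact fun a ha => (n₆ _ (by omega) (by omega) (by omega)).trans (h.zero a (by omega))
  · exact u₆.le (u₅.le (u₄.le (u₃.le l₂ (hW _)) (by omega)) (hW _)) (by omega)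
  · exact St.touch_top (u₆.top (u₅.top (u₄.top (u₃.top t₂)))) (by omega) (by omega)
  · rw [u₆.out, u₅.out, u₄.out, u₃.out, o₂]
  · rw [u₆.self, n₆ 21 (by omega) (by omega) (by omega), h.consts.r21]
    omega

/-- The state when region `1` has been filled, with `x` in `R 11` and `y` in `R 13`. -/
structure Filled (W : ℕ → ℕ) (n p B V x y : ℕ) (σ : St) : Prop where
  consts : Consts B n p σ.reg
  r3 : σ.reg 3 = B + 2
  r11 : σ.reg 11 = x
  r13 : σ.reg 13 = y
  line : σ.reg B = 0
  counter : σ.reg (B + 1) = B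
  mem : ∀ i < B - 2, σ.reg (B + 2 + i) = W i
  good : Good V (B * B) σ

theorem Input.filled (h : Input W n p B V (max n 1) σ) (h0 : W 0 = n) (hn : ∀ i, n < i → W i = 0) :
    Filled W n p B V (max n 1 + 1) B σ where
  consts := h.consts
  r3 := h.r3
  r11 := h.r11
  r13 := h.r13
  line := h.line
  counter := h.counter
  mem i _ := by
    by_cases hi : i = 0
    · rw [hi, h0]; exact h.length
    by_cases hi' : i ≤ max n 1
    · exact h.copied i (by omega) hi'
    · rw [hn i (by omega)]; exact h.zero _ (by omega)
  good := h.good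

/-- Changes of `R 11` and `R 13` only. -/
theorem Filled.congr {x y x' y' : ℕ} {σ' : St} (h : Filled W n p B V x y σ) (hB : 30 ≤ B)
    (hn : ∀ a, a ≠ 11 → a ≠ 13 → σ'.reg a = σ.reg a) (h11 : σ'.reg 11 = x') (h13 : σ'.reg 13 = y')
    (hg : Good V (B * B) σ') : Filled W n p B V x' y' σ' where
  consts := h.consts.congr fun a _ _ h13 _ => hn a (by omega) h13
  r3 := (hn 3 (by omega) (by omega)).trans h.r3
  r11 := h11
  r13 := h13
  line := (hn _ (by omega) (by omega)).trans h.line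
  counter := (hn _ (by omega) (by omega)).trans h.counter
  mem i hi := (hn _ (by omega) (by omega)).trans (h.mem i hi)
  good := hg

theorem filled_start {x y : ℕ} (h : Filled W n p B V x y σ) (hB : 30 ≤ B) (hV : B * B ≤ V) :
    Filled W n p B V 4 y ((Prog.block [.const 11 4]).eval σ) ∧
      ((Prog.block [.const 11 4]).eval σ).out = σ.out := by
  have hBB : 30 * B ≤ B * B := Nat.mul_le_mul_right _ hB
  have u := Upd.const (T := B * B) σ (i := 11) (c := 4) (by omega)
  exact ⟨h.congr hB (fun a ha _ => u.ne a ha) u.self ((u.ne _ (by norm_num)).trans h.r13)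
    ⟨u.le h.good.1 (by omega), u.top h.good.2⟩, u.out⟩

/-- The body of the loop that computes a power of two. -/
def doubleBody : Prog := .block [.add 13 13 13, .add 11 11 16]

theorem double_step {k : ℕ} (h : Filled W n p B V (k + 4) (2 ^ k * B) σ) (hk : k < B - 3)
    (hB : 30 ≤ B) (hV : B * B + 2 ^ B * B ≤ V) :
    Filled W n p B V (k + 1 + 4) (2 ^ (k + 1) * B) ((doubleBody.eval σ).touch 11 15) ∧
      (doubleBody.eval σ).out = σ.out ∧
      ((doubleBody.eval σ).reg 11 ≤ (doubleBody.eval σ).reg 15 ↔ k + 1 < B - 3) := by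
  have hBB : 30 * B ≤ B * B := Nat.mul_le_mul_right _ hB
  have h2 : 2 ^ (k + 1) * B ≤ 2 ^ B * B :=
    Nat.mul_le_mul_right _ (Nat.pow_le_pow_right (by norm_num) (by omega))
  simp only [doubleBody, Prog.eval_block_cons, Prog.eval_block_nil]
  have u₁ := Upd.add (T := B * B) σ (i := 13) (j := 13) (l := 13) (by omega) (by omega) (by omega)
  generalize (Instr.add 13 13 13).eff σ = σ₁ at u₁ ⊢
  rw [h.r13, show 2 ^ k * B + 2 ^ k * B = 2 ^ (k + 1) * B by ring] at u₁
  have u₂ := Upd.add (T := B * B) σ₁ (i := 11) (j := 11) (l := 16) (by omega) (by omega) (by omega)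
  generalize (Instr.add 11 11 16).eff σ₁ = σ₂ at u₂ ⊢
  rw [u₁.ne 11 (by omega), u₁.ne 16 (by omega), h.r11, h.consts.r16] at u₂
  have hn : ∀ a, a ≠ 11 → a ≠ 13 → σ₂.reg a = σ.reg a := fun a h11 h13 => by
    rw [u₂.ne a h11, u₁.ne a h13]
  refine ⟨h.congr hB hn ?_ ?_ ⟨u₂.le (u₁.le h.good.1 (by omega)) (by omega),
    St.touch_top (u₂.top (u₁.top h.good.2)) (by omega) (by omega)⟩, u₂.out.trans u₁.out, ?_⟩
  · rw [St.touch_reg, u₂.self]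
  · rw [St.touch_reg, u₂.ne _ (by omega), u₁.self]
  · rw [u₂.self, hn 15 (by omega) (by omega), h.consts.r15]; omega

end Prelude

/-! ### The search for the first output -/

section First
variable {M : Machine} {w : List ℕ} {n p B V : ℕ} {σ : St}

/-- The state after `k` steps of the search for the first output of `M`. -/
structure First (M : Machine) (w : List ℕ) (n p B V k : ℕ) (σ : St) : Prop where
  consts : Consts B n p σ.reg
  r3 : σ.reg 3 = B + 2
  r13 : σ.reg 13 = 2 ^ (B - 3) * B
  r14 : σ.reg 14 = 2 ^ (B - 2) * B
  line : σ.reg B = (M.run w k).pc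
  counter : σ.reg (B + 1) = B
  mem : ∀ i < B - 2, σ.reg (B + 2 + i) = (M.run w k).reg i
  flag : ∀ k', k = k' + 1 → σ.reg 5 = M.flag (M.run w k') ∧
    ∀ i j, M[(M.run w k').pc]? = some (.output i j) →
      σ.reg 6 = B + 2 + (M.run w k').reg i ∧ σ.reg 7 = B + 2 + (M.run w k').reg j
  good : Good V (B * B) σ

theorem Filled.first (h : Filled (init w).reg n p B V (B - 3 + 4) (2 ^ (B - 3) * B) σ) (hB : 30 ≤ B)
    (hV : B * B + 2 ^ B * B ≤ V) :
    First M w n p B V 0 ((Prog.block [.add 14 13 13]).eval σ) ∧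
      ((Prog.block [.add 14 13 13]).eval σ).out = σ.out := by
  have hBB : 30 * B ≤ B * B := Nat.mul_le_mul_right _ hB
  have h2 : 2 ^ (B - 2) * B ≤ 2 ^ B * B :=
    Nat.mul_le_mul_right _ (Nat.pow_le_pow_right (by norm_num) (by omega))
  have u := Upd.add (T := B * B) σ (i := 14) (j := 13) (l := 13) (by omega) (by omega) (by omega)
  simp only [Prog.eval_block_cons, Prog.eval_block_nil]
  generalize (Instr.add 14 13 13).eff σ = σ₁ at u ⊢
  rw [h.r13, ← two_mul, ← mul_assoc, ← pow_succ', show B - 3 + 1 = B - 2 by omega] at u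
  exact ⟨⟨h.consts.congr fun a _ _ _ h14 => u.ne a h14, (u.ne _ (by omega)).trans h.r3,
    (u.ne _ (by omega)).trans h.r13, u.self, (u.ne _ (by omega)).trans h.line,
    (u.ne _ (by omega)).trans h.counter, fun i hi => (u.ne _ (by omega)).trans (h.mem i hi),
    fun _ hk => by omega, u.le h.good.1 (by omega), u.top h.good.2⟩, u.out⟩

theorem first_step (hb : Bounds M w B V) {k s₀ : ℕ} (h : First M w n p B V k σ) (hk : k < s₀ + 1)
    (h0 : ∀ s < s₀, M.flag (M.run w s) = 0) (hs : M.flag (M.run w s₀) ≠ 0) :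
    First M w n p B V (k + 1) (((simStep M).eval σ).touch 5 19) ∧
      ((simStep M).eval σ).out = σ.out ∧
      (((simStep M).eval σ).reg 5 ≤ ((simStep M).eval σ).reg 19 ↔ k + 1 < s₀ + 1) := by
  have hB := hb.big
  have hBB : 30 * B ≤ B * B := Nat.mul_le_mul_right _ hB
  have hV := hb.le
  have h2B : 2 ^ B ≤ 2 ^ B * B := Nat.le_mul_of_pos_right _ (by omega)
  have h₁ := simStep_spec (M := M) (b := B) (S := B - 2) (T := B * B) (c := M.run w k) (by omega)
    (by omega) (by rw [← run_succ]; exact hb.top _) h.r3 h.line h.mem h.good.2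
  generalize (simStep M).eval σ = σ₁ at h₁ ⊢
  have k₁ : ∀ a, 8 ≤ a → a < 30 → σ₁.reg a = σ.reg a := fun a ha ha' =>
    h₁.frame a ha (by omega) (by omega)
  have hle : ∀ a, σ₁.reg a ≤ V := by
    intro a
    by_cases ap : a = B
    · rw [ap, h₁.pc, ← run_succ]
      have := hb.pc (k + 1)
      omega
    by_cases am : B + 2 ≤ a ∧ a < B + B
    · obtain ⟨i, rfl⟩ := Nat.exists_eq_add_of_le am.1
      rw [h₁.mem i (by omega), ← run_succ]
      have := hb.reg (k + 1) i
      omega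
    by_cases a8 : 8 ≤ a
    · rw [h₁.frame a a8 ap (by omega)]
      exact h.good.1 a
    have h67 : σ₁.reg 6 ≤ V ∧ σ₁.reg 7 ≤ V := by
      by_cases hf : M.flag (M.run w k) = 2
      · obtain ⟨i, j, hij⟩ := exists_output_of_flag hf
        rw [(h₁.flag.2.2 i j hij).1, (h₁.flag.2.2 i j hij).2]
        have := hb.reg k i
        have := hb.reg k j
        omega
      · rw [(h₁.flag.2.1 hf).1, (h₁.flag.2.1 hf).2]
        exact ⟨h.good.1 6, h.good.1 7⟩
    obtain rfl | rfl | rfl | rfl | rfl | rfl | rfl | rfl :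
        a = 0 ∨ a = 1 ∨ a = 2 ∨ a = 3 ∨ a = 4 ∨ a = 5 ∨ a = 6 ∨ a = 7 := by omega
    · rw [h₁.zero]; omega
    · rw [h₁.one]; omega
    · rw [h₁.two]; omega
    · rw [h₁.base]; omega
    · rw [h₁.four, ← run_succ]
      have := hb.pc (k + 1)
      omega
    · rw [h₁.flag.1]
      have := flag_le_two M (M.run w k)
      omega
    · exact h67.1
    · exact h67.2
  refine ⟨⟨?_, h₁.base, ?_, ?_, ?_, ?_, ?_, ?_, hle, St.touch_top h₁.top (by omega) (by omega)⟩,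
    h₁.out, ?_⟩
  · exact h.consts.congr fun a _ _ _ _ => k₁ a (by omega) (by omega)
  · exact (k₁ 13 (by omega) (by omega)).trans h.r13
  · exact (k₁ 14 (by omega) (by omega)).trans h.r14
  · rw [run_succ]; exact h₁.pc
  · exact (h₁.frame _ (by omega) (by omega) (by omega)).trans h.counter
  · rw [run_succ]; exact h₁.mem
  · intro k' hk'
    obtain rfl : k = k' := by omega
    exact ⟨h₁.flag.1, h₁.flag.2.2⟩
  · rw [h₁.flag.1, k₁ 19 (by omega) (by omega), h.consts.r19]
    rcases Nat.lt_succ_iff_lt_or_eq.1 hk with hk | rfl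
    · rw [h0 k hk]; omega
    · omega

/-! ### Starting the processes -/

/-- The preparation of the copying of region `1`. -/
def saveBounds : Prog := .block [.copy 8 6, .copy 9 7, .copy 11 12]

/-- The copying of a cell to the next region. -/
def copyBody : Prog := .block [.sub 0 11 15, .load 1 0, .store 11 1, .add 11 11 16]

/-- The last preparation of the main loop. -/
def startMain : Prog := .block [.const 11 0, .const 10 1, .copy 3 18]

/-- The state while region `1` is copied to the other regions, when `k` cells have been copied. -/
structure Spread (M : Machine) (w : List ℕ) (n p B V a₀ b₀ s₀ k : ℕ) (σ : St) : Prop where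
  consts : Consts B n p σ.reg
  r8 : σ.reg 8 = a₀
  r9 : σ.reg 9 = b₀
  r11 : σ.reg 11 = 2 * B + k
  r13 : σ.reg 13 = 2 ^ (B - 3) * B
  r14 : σ.reg 14 = 2 ^ (B - 2) * B
  line : σ.reg B = (M.run w (s₀ + 1)).pc
  counter : σ.reg (B + 1) = B
  mem : ∀ i < B - 2, σ.reg (B + 2 + i) = (M.run w (s₀ + 1)).reg i
  copied : ∀ a, 2 * B ≤ a → a < 2 * B + k → σ.reg a = σ.reg (a - B)
  good : Good V (B * B) σ

theorem First.spread {s₀ : ℕ} (h : First M w n p B V (s₀ + 1) σ) (hB : 30 ≤ B) :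
    Spread M w n p B V (σ.reg 6) (σ.reg 7) s₀ 0 (saveBounds.eval σ) ∧
      (saveBounds.eval σ).out = σ.out := by
  have hBB : 30 * B ≤ B * B := Nat.mul_le_mul_right _ hB
  simp only [saveBounds, Prog.eval_block_cons, Prog.eval_block_nil]
  have u₁ := Upd.copy (T := B * B) σ (i := 8) (j := 6) (by omega) (by omega)
  generalize (Instr.copy 8 6).eff σ = σ₁ at u₁ ⊢
  have u₂ := Upd.copy (T := B * B) σ₁ (i := 9) (j := 7) (by omega) (by omega)
  generalize (Instr.copy 9 7).eff σ₁ = σ₂ at u₂ ⊢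
  have l₂ := u₂.le (u₁.le h.good.1 (h.good.1 6)) (by rw [u₁.ne 7 (by omega)]; exact h.good.1 7)
  have u₃ := Upd.copy (T := B * B) σ₂ (i := 11) (j := 12) (by omega) (by omega)
  generalize (Instr.copy 11 12).eff σ₂ = σ₃ at u₃ ⊢
  have hn : ∀ a, a ≠ 8 → a ≠ 9 → a ≠ 11 → σ₃.reg a = σ.reg a := fun a h8 h9 h11 => by
    rw [u₃.ne a h11, u₂.ne a h9, u₁.ne a h8]
  refine ⟨⟨?_, ?_, ?_, ?_, ?_, ?_, ?_, ?_, ?_, fun a _ _ => by omega, u₃.le l₂ (l₂ 12),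
    u₃.top (u₂.top (u₁.top h.good.2))⟩, ?_⟩
  · exact h.consts.congr fun a _ _ _ _ => hn a (by omega) (by omega) (by omega)
  · rw [u₃.ne _ (by omega), u₂.ne _ (by omega), u₁.self]
  · rw [u₃.ne _ (by omega), u₂.self, u₁.ne _ (by omega)]
  · rw [u₃.self, u₂.ne _ (by omega), u₁.ne _ (by omega), h.consts.r12]; rfl
  · rw [hn _ (by omega) (by omega) (by omega), h.r13]
  · rw [hn _ (by omega) (by omega) (by omega), h.r14]
  · rw [hn _ (by omega) (by omega) (by omega), h.line]
  · rw [hn _ (by omega) (by omega) (by omega), h.counter]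
  · intro i hi
    rw [hn _ (by omega) (by omega) (by omega), h.mem i hi]
  · rw [u₃.out, u₂.out, u₁.out]

theorem spread_step {a₀ b₀ s₀ k : ℕ} (h : Spread M w n p B V a₀ b₀ s₀ k σ) (hB : 30 ≤ B)
    (hk : k < B * B - 2 * B + 1) (hV : B * B + 2 ≤ V) :
    Spread M w n p B V a₀ b₀ s₀ (k + 1) ((copyBody.eval σ).touch 11 17) ∧
      (copyBody.eval σ).out = σ.out ∧
      ((copyBody.eval σ).reg 11 ≤ (copyBody.eval σ).reg 17 ↔ k + 1 < B * B - 2 * B + 1) := by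
  have hBB : 30 * B ≤ B * B := Nat.mul_le_mul_right _ hB
  simp only [copyBody, Prog.eval_block_cons, Prog.eval_block_nil]
  have u₁ := Upd.sub (T := B * B) σ (i := 0) (j := 11) (l := 15) (by omega) (by omega) (by omega)
  generalize (Instr.sub 0 11 15).eff σ = σ₁ at u₁ ⊢
  rw [h.r11, h.consts.r15] at u₁
  have u₂ := Upd.load (T := B * B) σ₁ (i := 1) (j := 0) (by omega) (by omega)
    (by rw [u₁.self]; omega)
  generalize (Instr.load 1 0).eff σ₁ = σ₂ at u₂ ⊢
  rw [u₁.self, u₁.ne _ (by omega)] at u₂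
  have u₃ := Upd.store (T := B * B) σ₂ (i := 11) (j := 1) (by omega) (by omega)
    (by rw [u₂.ne _ (by omega), u₁.ne _ (by omega), h.r11]; omega)
  generalize (Instr.store 11 1).eff σ₂ = σ₃ at u₃ ⊢
  rw [u₂.self, u₂.ne 11 (by omega), u₁.ne 11 (by omega), h.r11] at u₃
  have u₄ := Upd.add (T := B * B) σ₃ (i := 11) (j := 11) (l := 16) (by omega) (by omega) (by omega)
  generalize (Instr.add 11 11 16).eff σ₃ = σ₄ at u₄ ⊢
  rw [u₃.ne 11 (by omega), u₃.ne 16 (by omega), u₂.ne 11 (by omega), u₂.ne 16 (by omega),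
    u₁.ne 11 (by omega), u₁.ne 16 (by omega), h.r11, h.consts.r16] at u₄
  have hn : ∀ a, 1 < a → a ≠ 11 → a ≠ 2 * B + k → σ₄.reg a = σ.reg a := fun a h1 h11 ha => by
    rw [u₄.ne a h11, u₃.ne a ha, u₂.ne a (by omega), u₁.ne a (by omega)]
  refine ⟨⟨?_, ?_, ?_, u₄.self, ?_, ?_, ?_, ?_, ?_, ?_, ?_, ?_⟩, ?_, ?_⟩
  · exact h.consts.congr fun a _ _ _ _ => hn a (by omega) (by omega) (by omega)
  · exact (hn 8 (by omega) (by omega) (by omega)).trans h.r8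
  · exact (hn 9 (by omega) (by omega) (by omega)).trans h.r9
  · exact (hn 13 (by omega) (by omega) (by omega)).trans h.r13
  · exact (hn 14 (by omega) (by omega) (by omega)).trans h.r14
  · exact (hn _ (by omega) (by omega) (by omega)).trans h.line
  · exact (hn _ (by omega) (by omega) (by omega)).trans h.counter
  · exact fun i hi => (hn _ (by omega) (by omega) (by omega)).trans (h.mem i hi)
  · intro a ha hak
    rw [St.touch_reg, hn (a - B) (by omega) (by omega) (by omega)]
    by_cases hh : a = 2 * B + k
    · subst hh
      rw [u₄.ne _ (by omega), u₃.self]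
    · rw [hn a (by omega) (by omega) hh, h.copied a ha (by omega)]
  · exact u₄.le (u₃.le (u₂.le (u₁.le h.good.1 (by omega)) (h.good.1 _)) (h.good.1 _)) (by omega)
  · exact St.touch_top (u₄.top (u₃.top (u₂.top (u₁.top h.good.2)))) (by omega) (by omega)
  · rw [u₄.out, u₃.out, u₂.out, u₁.out]
  · rw [u₄.self, hn 17 (by omega) (by omega) (by omega), h.consts.r17]; omega

/-- All regions hold the same configuration when the main loop starts. -/
theorem Spread.main {a₀ b₀ s₀ : ℕ} (h : Spread M w n p B V a₀ b₀ s₀ (B * B - 2 * B + 1) σ)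
    (hB : 30 ≤ B) (hV : B * B + 2 ≤ V) (hs : (M.run w (s₀ + 1)).reg = (M.run w s₀).reg) :
    Main M w B V s₀ a₀ b₀ 2 0 (fun _ => 0) (startMain.eval σ) ∧
      (startMain.eval σ).out = σ.out := by
  have hBB : 30 * B ≤ B * B := Nat.mul_le_mul_right _ hB
  have hcopy : ∀ r, r + 1 < B → ∀ i < B, σ.reg ((r + 1) * B + i) = σ.reg (B + i) := by
    intro r hr i hi
    induction r with
    | zero => simp
    | succ r ih =>
      have h1 : (r + 1 + 1) * B + B ≤ B * B := region_le hr
      have h2 : (r + 1 + 1) * B = (r + 1) * B + B := Nat.succ_mul _ _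
      have h3 : B ≤ (r + 1) * B := Nat.le_mul_of_pos_left _ (by omega)
      rw [h.copied _ (by omega) (by omega), ← ih (by omega), h2]
      congr 1; omega
  have hcopy' : ∀ r, 2 ≤ r → r < B → ∀ i < B, σ.reg (r * B + i) = σ.reg (B + i) := by
    intro r h2 hr i hi
    obtain ⟨r, rfl⟩ : ∃ r', r = r' + 1 := ⟨r - 1, by omega⟩
    exact hcopy r hr i hi
  simp only [startMain, Prog.eval_block_cons, Prog.eval_block_nil]
  have u₁ := Upd.const (T := B * B) σ (i := 11) (c := 0) (by omega)
  generalize (Instr.const 11 0).eff σ = σ₁ at u₁ ⊢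
  have u₂ := Upd.const (T := B * B) σ₁ (i := 10) (c := 1) (by omega)
  generalize (Instr.const 10 1).eff σ₁ = σ₂ at u₂ ⊢
  have u₃ := Upd.copy (T := B * B) σ₂ (i := 3) (j := 18) (by omega) (by omega)
  generalize (Instr.copy 3 18).eff σ₂ = σ₃ at u₃ ⊢
  rw [u₂.ne 18 (by omega), u₁.ne 18 (by omega), h.consts.r18] at u₃
  have hn : ∀ a, a ≠ 3 → a ≠ 10 → a ≠ 11 → σ₃.reg a = σ.reg a := fun a h3 h10 h11 => by
    rw [u₃.ne a h3, u₂.ne a h10, u₁.ne a h11]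
  have hc : Consts B n p σ₃.reg :=
    h.consts.congr fun a _ _ _ _ => hn a (by omega) (by omega) (by omega)
  have hreg : ∀ r, 2 ≤ r → 2 * B ≤ r * B := fun r hr => Nat.mul_le_mul_right _ hr
  refine ⟨⟨u₃.self, ?_, ?_, ?_, ?_, hc.r12, ?_, ?_, hc.r15, hc.r16, hc.r17, hc.r18, hc.r20, ?_, ?_,
      ?_,
    ?_, ?_, ?_⟩, ?_⟩
  · exact (hn 8 (by omega) (by omega) (by omega)).trans h.r8
  · exact (hn 9 (by omega) (by omega) (by omega)).trans h.r9
  · rw [u₃.ne _ (by omega), u₂.self]; rfl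
  · rw [u₃.ne _ (by omega), u₂.ne _ (by omega), u₁.self]
  · exact (hn 13 (by omega) (by omega) (by omega)).trans h.r13
  · exact (hn 14 (by omega) (by omega) (by omega)).trans h.r14
  · intro r h2 hr
    have := hreg r h2
    rw [hn _ (by omega) (by omega) (by omega)]
    exact (hcopy' r h2 hr 0 (by omega)).trans h.line
  · intro r h2 hr
    have := hreg r h2
    rw [hn _ (by omega) (by omega) (by omega), hcopy' r h2 hr 1 (by omega), h.counter]
    rfl
  · intro r h2 hr i hi
    have := hreg r h2
    rw [hn _ (by omega) (by omega) (by omega), add_assoc, hcopy' r h2 hr (2 + i) (by omega),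
      ← add_assoc, h.mem i hi]
    rfl
  · intro i hi
    rw [hn _ (by omega) (by omega) (by omega), h.mem i hi, hs]
  · exact u₃.le (u₂.le (u₁.le h.good.1 (by omega)) (by omega)) (by omega)
  · exact u₃.top (u₂.top (u₁.top h.good.2))
  · rw [u₃.out, u₂.out, u₁.out]

end First

/-! ### The whole program -/

/-- The first part of the program: the input is copied to region `1`, the numbers
`2 ^ (B - 3) * B` and `2 ^ (B - 2) * B` are computed, and `M` is simulated in region `1` until it
halts or makes its first output, which is held back. -/
def firstPart (M : Machine) (c b : ℕ) : Prog :=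
  .seq (.block (bootCode ++ setupCode c b)) (.seq (.rep inputBody 11 21)
    (.seq (.block [.const 11 4]) (.seq (.rep doubleBody 11 15)
      (.seq (.block [.add 14 13 13]) (.rep (simStep M) 5 19)))))

/-- The second part of the program: the main loop, framed by its preparation and the output of the
word that `M` outputs first. -/
def mainPart (M : Machine) : Prog :=
  .seq saveBounds (.seq (.rep copyBody 11 17) (.seq startMain
    (.seq (.rep (iter M) 3 17) (.ins (.output 8 9)))))

/-- The program that enumerates with small delay what `M` enumerates with small amortized delay; the
size of the regions is `c * (n + 1) ^ b`. -/
def amortized (M : Machine) (c b : ℕ) : Prog :=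
  .seq (firstPart M c b) (.ite 20 5 (mainPart M) .nop)

theorem flat_saveCode (i k : ℕ) : ∀ I ∈ saveCode i k, (Prog.ins I).Flat := by
  induction k generalizing i with
  | zero => simp [saveCode]
  | succ k ih =>
    intro I hI
    simp only [saveCode, List.mem_cons] at hI
    rcases hI with rfl | rfl | hI
    · trivial
    · trivial
    · exact ih _ I hI

theorem flat_start (c b : ℕ) : (Prog.block (bootCode ++ setupCode c b)).Flat := by
  refine Prog.flat_block fun I hI => ?_
  simp only [bootCode, setupCode, List.mem_append, List.mem_replicate, List.mem_cons,
    List.not_mem_nil, or_false] at hI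
  rcases hI with (hI | hI | hI) | (hI | hI | hI)
  · rcases hI with rfl | rfl | rfl | rfl | rfl | rfl | rfl <;> trivial
  · exact flat_saveCode _ _ I hI
  · rcases hI with rfl | rfl | rfl <;> trivial
  · rcases hI with rfl | rfl | rfl | rfl | rfl | rfl | rfl | rfl | rfl | rfl | rfl | rfl | rfl <;>
      trivial
  · rw [hI.2]; trivial
  · rcases hI with rfl | rfl | rfl | rfl | rfl | rfl | rfl | rfl | rfl | rfl <;> trivial

section Test
variable {M : Machine} {V T q a i j : ℕ} {P : Prog} {c : Config}

/-- The test of a conditional, when it succeeds. -/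
theorem Leads.test_pos {Q : Prog} (hM : M.ConstLE V) (h2 : 2 ≤ V)
    (h : CodeAt M a ((Prog.ite i j P Q).code a)) (hq : 1 ≤ q) (hc : c.pc = a) (g : Good V T c.st)
    (g' : Good V T (c.st.touch i j)) (hij : c.reg i ≤ c.reg j) :
    ∃ c', Leads M V T q 1 c c' ∧ c'.pc = a + (Q.size + 2) ∧ CodeAt M c'.pc (P.code c'.pc) ∧
      c'.st = c.st.touch i j := by
  have g₀ := h.get
  have h₂ := h.tail.right
  rw [Prog.length_code] at h₂
  have hP := h₂.tail
  have m : Moves M 1 c _ := Moves.single (by rw [hc]; exact g₀)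
  have e := st_exec (.jle i j (a + 1 + Q.size + 1)) c
  have p := exec_pc (.jle i j (a + 1 + Q.size + 1)) c
  generalize (Instr.jle i j (a + 1 + Q.size + 1)).exec c = c₀ at m e p
  replace e : c₀.st = c.st.touch i j := by
    rw [e]; simp [Instr.eff, St.touch, Instr.write, Instr.emit, Instr.maxAccess]
  simp only [Instr.next, if_pos hij] at p
  exact ⟨c₀, .of_moves hM h2 m hq g (e ▸ g') (by rw [e]; rfl), by rw [p]; omega, p ▸ hP, e⟩

/-- A conditional without alternative whose test fails. -/
theorem Leads.test_neg (hM : M.ConstLE V) (h2 : 2 ≤ V)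
    (h : CodeAt M a ((Prog.ite i j P .nop).code a)) (hq : 2 ≤ q) (hc : c.pc = a) (g : Good V T c.st)
    (g' : Good V T (c.st.touch i j)) (hij : ¬ c.reg i ≤ c.reg j) :
    ∃ c', Leads M V T q 1 c c' ∧ c'.pc = a + (Prog.ite i j P .nop).size := by
  have g₀ := h.get
  have g₁ : M[a + 1]? = some _ := h.tail.get
  have m : Moves M 1 c _ := Moves.single (by rw [hc]; exact g₀)
  have e := st_exec (.jle i j (a + 1 + Prog.nop.size + 1)) c
  have p := exec_pc (.jle i j (a + 1 + Prog.nop.size + 1)) c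
  generalize (Instr.jle i j (a + 1 + Prog.nop.size + 1)).exec c = c₀ at m e p
  replace e : c₀.st = c.st.touch i j := by
    rw [e]; simp [Instr.eff, St.touch, Instr.write, Instr.emit, Instr.maxAccess]
  simp only [Instr.next, if_neg hij, hc] at p
  have m₁ : Moves M 1 c₀ _ := Moves.single (by rw [p]; exact g₁)
  have e₁ := st_exec (.goto (a + 1 + Prog.nop.size + 1 + P.size)) c₀
  have p₁ := exec_pc (.goto (a + 1 + Prog.nop.size + 1 + P.size)) c₀
  generalize (Instr.goto (a + 1 + Prog.nop.size + 1 + P.size)).exec c₀ = c₁ at m₁ e₁ p₁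
  replace e₁ : c₁.st = c.st.touch i j := by
    rw [e₁, e]; simp [Instr.eff, Instr.write, Instr.emit, Instr.maxAccess, St.touch]
  refine ⟨c₁, .of_moves hM h2 (m.trans m₁) hq g (e₁ ▸ g') (by rw [e₁]; rfl), ?_⟩
  rw [p₁]
  simp only [Instr.next, Prog.size]
  omega

end Test

section Run
variable {M M' : Machine} {w : List ℕ} {B V c b s₀ q a : ℕ}

theorem run_zero (M : Machine) (w : List ℕ) : M.run w 0 = init w := rfl

/-- The run up to the first step of `M` that is an output or finds `M` halted. -/
theorem firstPart_run (hb : Bounds M w B V) (hB : B = c * (w.length + 1) ^ b)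
    (h48 : 2 * w.length + w.getD 0 0 + 48 ≤ B) (hM' : M'.ConstLE V)
    (hcode : CodeAt M' 0 ((firstPart M c b).code 0)) (hq : (firstPart M c b).size ≤ q)
    (h0 : ∀ s < s₀, M.flag (M.run w s) = 0) (hs : M.flag (M.run w s₀) ≠ 0) :
    ∃ c', Leads M' V (B * B) q (B + w.length + s₀ + 2) (init w) c' ∧
      c'.pc = (firstPart M c b).size ∧
      First M w w.length (2 * w.length + w.getD 0 0) B V (s₀ + 1) c'.st := by
  have hB30 := hb.big
  have hV := hb.le
  have hBB : 30 * B ≤ B * B := Nat.mul_le_mul_right _ hB30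
  have h2B : 2 ^ B ≤ 2 ^ B * B := Nat.le_mul_of_pos_right _ (by omega)
  have hW : ∀ i, (init w).reg i ≤ V := fun i => by
    have := hb.reg 0 i
    rw [run_zero] at this
    omega
  have hn : ∀ i, w.length < i → (init w).reg i = 0 := fun i hi =>
    reg_eq_zero_of_top_lt (M := M) 0 i hi
  have e1 : (init w).reg 1 = w.getD 0 0 := rfl
  simp only [firstPart, Prog.size] at hq
  have g₀ : Good V (B * B) (init w).st := ⟨hW, show w.length ≤ _ by omega⟩
  have boot := boot_spec (σ := (init w).st) (T := B * B) (n := w.length) (V := V) (B := B)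
    rfl hn rfl h48 (by omega) (by omega) hW g₀.2
  have setup := setup_spec boot hB rfl h48 (by omega)
  rw [← Prog.eval_block_append] at setup
  have k₁ := hcode.seq_left
  obtain ⟨c₁, l₁, p₁, e₁⟩ := Leads.flat hM' (q := q) (by omega) (flat_start c b) k₁ (by omega) rfl
      g₀
    setup.1.good setup.2
  rw [← e₁] at setup
  have r₁ := hcode.seq_right
  obtain ⟨c₂, l₂, p₂, i₂⟩ := Leads.rep hM' (by omega) (P := inputBody)
    ⟨by simp [Prog.block, Prog.Flat], by simp [Prog.block, Prog.Flat],
      by simp [Prog.block, Prog.Flat]⟩ r₁.seq_left (q := q) (T := B * B) (by omega)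
    (fun k => Input (init w).reg w.length (2 * w.length + w.getD 0 0) B V k) (max w.length 1)
    (fun k hk σ h => input_step h hk (by omega) h48 (by omega) hW) (fun k σ h => h.good)
    0 (by omega) c₁ p₁ setup.1
  have r₂ := r₁.seq_right
  have f₂ := Input.filled i₂ rfl hn
  have f₃ := filled_start f₂ hB30 (by omega)
  obtain ⟨c₃, l₃, p₃, e₃⟩ := Leads.flat hM' (q := q) (by omega) (P := .block [.const 11 4])
    (by simp [Prog.block, Prog.Flat]) r₂.seq_left (by omega) p₂ f₂.good f₃.1.good f₃.2
  rw [← e₃] at f₃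
  have r₃ := r₂.seq_right
  obtain ⟨c₄, l₄, p₄, i₄⟩ := Leads.rep hM' (by omega) (P := doubleBody)
    (by simp [doubleBody, Prog.block, Prog.Flat]) r₃.seq_left (q := q) (T := B * B) (by omega)
    (fun k => Filled (init w).reg w.length (2 * w.length + w.getD 0 0) B V (k + 4) (2 ^ k * B))
    (B - 3) (fun k hk σ h => double_step h hk hB30 (by omega)) (fun k σ h => h.good)
    0 (by omega) c₃ p₃ (by simpa using f₃.1)
  have r₄ := r₃.seq_right
  have f₅ := Filled.first (M := M) i₄ hB30 (by omega)
  obtain ⟨c₅, l₅, p₅, e₅⟩ := Leads.flat hM' (q := q) (by omega) (P := .block [.add 14 13 13])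
    (by simp [Prog.block, Prog.Flat]) r₄.seq_left (by omega) p₄ i₄.good f₅.1.good f₅.2
  rw [← e₅] at f₅
  have r₅ := r₄.seq_right
  obtain ⟨c₆, l₆, p₆, i₆⟩ := Leads.rep hM' (by omega) (P := simStep M)
    (flat_simStep M) r₅ (q := q) (T := B * B) (by omega)
    (fun k => First M w w.length (2 * w.length + w.getD 0 0) B V k)
    (s₀ + 1) (fun k hk σ h => first_step hb h hk h0 hs) (fun k σ h => h.good)
    0 (by omega) c₅ p₅ f₅.1
  refine ⟨c₆, (l₁.trans (l₂.trans (l₃.trans (l₄.trans (l₅.trans l₆))))).mono (by omega), ?_, i₆⟩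
  rw [p₆]
  simp only [firstPart, Prog.size, zero_add, add_assoc]

/-- The run when `M` outputs nothing. -/
theorem amortized_run_empty (hb : Bounds M w B V) (hB : B = c * (w.length + 1) ^ b)
    (h48 : 2 * w.length + w.getD 0 0 + 48 ≤ B) (hM' : Machine.ConstLE ((amortized M c b).code 0) V)
    (hq : (amortized M c b).size ≤ q)
    (h0 : ∀ s < s₀, M.flag (M.run w s) = 0) (hs : M.flag (M.run w s₀) = 1) (hsB : s₀ ≤ B) :
    ∃ c', Path ((amortized M c b).code 0) V (B * B) q (init w) c' ∧
      Machine.Halted ((amortized M c b).code 0) c' ∧ c'.out = [] ∧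
      c'.time ≤ 5 * (B * B) * hopTime V q := by
  have hB30 := hb.big
  have hV := hb.le
  have hBB : 30 * B ≤ B * B := Nat.mul_le_mul_right _ hB30
  have hcode : CodeAt ((amortized M c b).code 0) 0 ((amortized M c b).code 0) :=
    ⟨[], [], by simp, rfl⟩
  have hsz := hq
  simp only [amortized, Prog.size] at hsz
  obtain ⟨c₁, l₁, p₁, i₁⟩ := firstPart_run (q := q) hb hB h48 hM' hcode.seq_left (by omega) h0 (by
      omega)
  have e5 : c₁.reg 5 = 1 := (i₁.flag s₀ rfl).1.trans hs
  have e20 : c₁.reg 20 = 2 := i₁.consts.r20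
  obtain ⟨c₂, l₂, p₂⟩ := Leads.test_neg hM' (by omega) hcode.seq_right (q := q) (by omega)
    (by rw [p₁, zero_add]) i₁.good ⟨i₁.good.1, St.touch_top i₁.good.2 (by omega) (by omega)⟩
    (by omega)
  have l := l₁.trans l₂
  refine ⟨c₂, l.path, ?_, l.out, ?_⟩
  · show _ ≤ _
    rw [p₂, Prog.length_code]
    simp only [amortized, Prog.size]
    omega
  · refine l.time.trans ?_
    simp only [init, zero_add]
    exact Nat.mul_le_mul_right _ (by omega)

/-- The run when `M` makes its first output in step `s₀`; this is the last output that is made. -/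
theorem amortized_run (hb : Bounds M w B V) (hB : B = c * (w.length + 1) ^ b)
    (h48 : 2 * w.length + w.getD 0 0 + 48 ≤ B) (hM' : Machine.ConstLE ((amortized M c b).code 0) V)
    (hq : (amortized M c b).size ≤ q)
    (h0 : ∀ s < s₀, M.flag (M.run w s) = 0) (hs : M.flag (M.run w s₀) = 2) (hsB : s₀ ≤ B) {m : ℕ}
    (hm : ∀ em : List ℕ, em.Nodup → (∀ x ∈ em, M.flag (proc M w s₀ x) = 2) → em.length ≤ m)
    (hΦ : B + (m + 1) * passLength B + 1 ≤ V) :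
    ∃ (c' : Config) (s' : ℕ → ℕ) (em : List ℕ) (n : ℕ),
      Path ((amortized M c b).code 0) V (B * B) q (init w) c' ∧
      Machine.Halted ((amortized M c b).code 0) c' ∧
      Sched (fun x => M.flag (proc M w s₀ x) = 2) B B 0 s' em n ∧
      c'.words = em.map (fun x => M.word (proc M w s₀ x)) ++ [M.word (M.run w s₀)] ∧
      (∀ u t, (u, t) ∈ c'.out.getLast? → t = c'.time) ∧
      Gap (5 * (B * B) * hopTime V q) 0 c' := by
  have hB30 := hb.big
  have hV := hb.le
  have hBB : 30 * B ≤ B * B := Nat.mul_le_mul_right _ hB30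
  have hcode : CodeAt ((amortized M c b).code 0) 0 ((amortized M c b).code 0) :=
    ⟨[], [], by simp, rfl⟩
  have hsz := hq
  simp only [amortized, mainPart, Prog.size] at hsz
  obtain ⟨i, j, hij⟩ := exists_output_of_flag hs
  obtain ⟨c₁, l₁, p₁, i₁⟩ := firstPart_run (q := q) hb hB h48 hM' hcode.seq_left (by omega) h0 (by
      omega)
  have e5 : c₁.reg 5 = 2 := (i₁.flag s₀ rfl).1.trans hs
  have e20 : c₁.reg 20 = 2 := i₁.consts.r20
  have g₁ : Good V (B * B) (c₁.st.touch 20 5) :=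
    ⟨i₁.good.1, St.touch_top i₁.good.2 (by omega) (by omega)⟩
  obtain ⟨c₂, l₂, p₂, k₂, e₂⟩ := Leads.test_pos hM' (by omega) hcode.seq_right (q := q) (by omega)
    (by rw [p₁, zero_add]) i₁.good g₁ (by omega)
  have i₂ : First M w w.length (2 * w.length + w.getD 0 0) B V (s₀ + 1) c₂.st := by
    rw [e₂]; exact { i₁ with good := g₁ }
  obtain ⟨-, f67⟩ := i₂.flag s₀ rfl
  obtain ⟨e6, e7⟩ := f67 i j hij
  have s₃ := First.spread i₂ hB30
  rw [e6, e7] at s₃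
  obtain ⟨c₃, l₃, p₃, e₃⟩ := Leads.flat hM' (q := q) (by omega) (P := saveBounds)
    (by simp [saveBounds, Prog.block, Prog.Flat]) k₂.seq_left (by omega) rfl i₂.good s₃.1.good s₃.2
  rw [← e₃] at s₃
  have r₃ := k₂.seq_right
  obtain ⟨c₄, l₄, p₄, i₄⟩ := Leads.rep hM' (by omega) (P := copyBody)
    (by simp [copyBody, Prog.block, Prog.Flat]) r₃.seq_left (q := q) (T := B * B) (by omega)
    (fun k => Spread M w w.length (2 * w.length + w.getD 0 0) B V
      (B + 2 + (M.run w s₀).reg i) (B + 2 + (M.run w s₀).reg j) s₀ k)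
    (B * B - 2 * B + 1) (fun k hk σ h => spread_step h hB30 hk (by omega)) (fun k σ h => h.good)
    0 (by omega) c₃ p₃ s₃.1
  have hstep : (M.run w (s₀ + 1)).reg = (M.run w s₀).reg := by
    rw [run_succ, step_of_get hij]; rfl
  have r₄ := r₃.seq_right
  have s₅ := Spread.main i₄ hB30 (by omega) hstep
  obtain ⟨c₅, l₅, p₅, e₅⟩ := Leads.flat hM' (q := q) (by omega) (P := startMain)
    (by simp [startMain, Prog.block, Prog.Flat]) r₄.seq_left (by omega) p₄ i₄.good s₅.1.good s₅.2
  rw [← e₅] at s₅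
  have r₅ := r₄.seq_right
  have l := l₁.trans (l₂.trans (l₃.trans (l₄.trans l₅)))
  have o₅ : c₅.out = [] := l.out
  have hpass : passLength B ≤ 2 * (B * B) := by
    unfold passLength
    calc (B - 2) * (2 * B) ≤ B * (2 * B) := Nat.mul_le_mul_right _ (by omega)
      _ = _ := by ring
  have hgap : Gap (5 * (B * B) * hopTime V q) ((2 * (B * B) + elapsed B 2 0) * hopTime V q) c₅ := by
    refine ⟨by simp [o₅], ?_⟩
    refine l.time.trans (Nat.add_le_add ?_ (Nat.mul_le_mul_right _ (by omega)))
    simp [init]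
  obtain ⟨c₆, s', em, n, path, p₆, main, sched, words, gap⟩ := main_loop hb hM' (by omega)
    r₅.seq_left hm (H := 2 * (B * B)) (Φ := (m + 1) * passLength B) (q := q) hΦ
    (Nat.mul_le_mul_right _ (by omega)) (by omega) _ c₅ 2 0 _ [] 0 rfl
    (by simp [elapsed, Nat.succ_mul]) (by omega) p₅ s₅.1
    (Sched.init (by omega)) (by simp [Config.words, o₅]) hgap
  have r₆ := r₅.seq_right
  have mv : Moves ((amortized M c b).code 0) 1 c₆ _ := Moves.single (by rw [p₆]; exact r₆.get)
  have e8 : c₆.st.reg 8 = B + 2 + (M.run w s₀).reg i := main.r8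
  have e9 : c₆.st.reg 9 = B + 2 + (M.run w s₀).reg j := main.r9
  have hnext : (M.step (M.run w s₀)).top < B - 2 := by rw [← run_succ]; exact hb.top _
  have hw := word_eq (b := B + 2) (ρ := c₆.st.reg) hij hnext main.frozen
  have gf : Good V (B * B) ((Instr.output 8 9).exec c₆).st := by
    rw [st_exec]
    refine ⟨main.good.1, top_output _ (by omega) (by omega) (fun hh => ?_) main.good.2⟩
    rw [e8, e9] at hh
    have := hw.2 hh
    omega
  have htime := mv.time_le (q := q) hM' (by omega) (by omega) main.good
  have hword : ((List.range' (c₆.reg 8) (c₆.reg 9 + 1 - c₆.reg 8)).map c₆.reg) =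
      M.word (M.run w s₀) := by
    rw [← hw.1]
    show (List.range' (c₆.st.reg 8) (c₆.st.reg 9 + 1 - c₆.st.reg 8)).map c₆.st.reg = _
    rw [e8, e9]
  have hout : ((Instr.output 8 9).exec c₆).out =
      c₆.out ++ [(M.word (M.run w s₀), ((Instr.output 8 9).exec c₆).time)] := by
    rw [← hword]; rfl
  refine ⟨_, s', em, n, l.path.trans (path.trans (.of_moves (mv.mono (by omega)) main.good gf)), ?_,
    sched, ?_, ?_, ?_⟩
  · show _ ≤ _
    rw [exec_pc, p₆, Prog.length_code]
    rw [p₂]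
    simp only [amortized, mainPart, Prog.size, Instr.next]
    omega
  · rw [Config.words, hout, List.map_append, ← words]; rfl
  · intro u t hut
    rw [hout, List.getLast?_append] at hut
    simp at hut
    exact hut.2.symm
  · exact gap.output hout htime (by rw [← Nat.succ_mul]; exact Nat.mul_le_mul_right _ (by omega))
      (by omega)

end Run

/-! ### Correctness and delay on a single input -/

section Single
variable {M : Machine} {w : List ℕ} {s₀ : ℕ}

/-- The word output first by `M`, and the words output later. -/
theorem words_proc (h0 : ∀ s < s₀, M.flag (M.run w s) = 0) (hs : M.flag (M.run w s₀) = 2) (x : ℕ) :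
    (proc M w s₀ x).words = M.word (M.run w s₀) ::
      ((List.range x).filter fun y => M.flag (proc M w s₀ y) = 2).map
        fun y => M.word (proc M w s₀ y) := by
  have e₀ : (M.run w s₀).words = [] := by
    have := words_run_add M w 0 s₀
    rw [zero_add] at this
    rw [this, List.filter_eq_nil_iff.2]
    · rfl
    · intro s hs
      rw [zero_add, h0 s (List.mem_range.1 hs)]
      simp
  have e₁ : (M.run w (s₀ + 1)).words = [M.word (M.run w s₀)] := by
    rw [run_succ, words_step, e₀, emits_of_flag hs]
    rfl
  have := words_run_add M w (s₀ + 1) x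
  rw [e₁] at this
  exact this

theorem length_proc_out (h0 : ∀ s < s₀, M.flag (M.run w s) = 0) (hs : M.flag (M.run w s₀) = 2)
    (x : ℕ) :
    (proc M w s₀ x).out.length = count (fun y => M.flag (proc M w s₀ y) = 2) x + 1 := by
  have := congrArg List.length (words_proc h0 hs x)
  simpa [Config.words, count] using this

theorem length_out_le {c₀ : Config} (hc : M.HaltsOn w c₀) (s : ℕ) :
    (M.run w s).out.length ≤ c₀.out.length := by
  obtain ⟨t, rfl, ht⟩ := hc
  rcases le_total s t with h | h
  · obtain ⟨ts, e, -⟩ := out_mono (M := M) (w := w) h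
    simp [e]
  · rw [run_of_halted ht h]

theorem not_halted_mono {s t : ℕ} (hst : s ≤ t) (h : ¬ M.Halted (M.run w t)) :
    ¬ M.Halted (M.run w s) := fun hs => h (by rwa [run_of_halted hs hst])

theorem not_halted_of_flag {c : Config} (h : M.flag c ≠ 1) : ¬ M.Halted c := fun hh =>
  h (flag_eq_one.2 hh)

variable {B V D c b q : ℕ} {c₀ : Config}

/-- The run of the new machine on an input on which `M` has amortized delay at most `D`. -/
theorem exists_run (hc : M.HaltsOn w c₀) (hlast : ∀ u t, (u, t) ∈ c₀.out.getLast? → t = c₀.time)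
    (h1 : c₀.T 1 ≤ D) (hT : ∀ i, 1 ≤ i → i ≤ c₀.out.length → c₀.T i ≤ i * D)
    (hb : Bounds M w B V) (hB : B = c * (w.length + 1) ^ b)
    (h48 : 2 * w.length + w.getD 0 0 + 48 ≤ B) (hD : 2 * D ≤ B)
    (hlen : c₀.out.length ≤ 2 ^ (B - 3))
    (hM' : Machine.ConstLE ((amortized M c b).code 0) V) (hq : (amortized M c b).size ≤ q)
    (hV : B + (2 ^ B + 1) * passLength B + 1 ≤ V) :
    ∃ c', Path ((amortized M c b).code 0) V (B * B) q (init w) c' ∧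
      Machine.Halted ((amortized M c b).code 0) c' ∧ c'.words.Perm c₀.words ∧
      (∀ u t, (u, t) ∈ c'.out.getLast? → t = c'.time) ∧
      Gap (5 * (B * B) * hopTime V q) (5 * (B * B) * hopTime V q) c' := by
  have hB30 := hb.big
  have hsteps := fun s hs => steps_lt hc hlast h1 hT s hs
  obtain ⟨t, ht, ht'⟩ := id hc
  have hex : ∃ s, M.flag (M.run w s) ≠ 0 := ⟨t, by rw [ht, flag_eq_one.2 ht']; norm_num⟩
  obtain ⟨s₀, hs, h0⟩ : ∃ s₀, M.flag (M.run w s₀) ≠ 0 ∧ ∀ s < s₀, M.flag (M.run w s) = 0 :=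
    ⟨Nat.find hex, Nat.find_spec hex, fun s h => by simpa using Nat.find_min hex h⟩
  have e₀ : ∀ s ≤ s₀, (M.run w s).out = [] := by
    intro s hs
    have := words_run_add M w 0 s
    rw [zero_add, List.filter_eq_nil_iff.2] at this
    · simpa [Config.words, run_zero, init] using this
    · intro s' hs'
      rw [zero_add, h0 s' ((List.mem_range.1 hs').trans_le hs)]
      simp
  have hsD : s₀ ≤ D := by
    rcases Nat.eq_zero_or_pos s₀ with h | h
    · omega
    · have := hsteps (s₀ - 1) (not_halted_of_flag (by rw [h0 _ (by omega)]; norm_num))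
      rw [e₀ _ (by omega), List.length_nil] at this
      omega
  by_cases hs2 : M.flag (M.run w s₀) = 2
  case neg =>
    have hs1 : M.flag (M.run w s₀) = 1 := by
      have := flag_le_two M (M.run w s₀)
      omega
    obtain ⟨c', path, halted, out, time⟩ := amortized_run_empty hb hB h48 hM' hq h0 hs1 (by omega)
    have ec : c₀ = M.run w s₀ := HaltsOn.unique hc ⟨s₀, rfl, flag_eq_one.1 hs1⟩
    refine ⟨c', path, halted, ?_, by simp [out], ⟨by simp [out], ?_⟩⟩
    · rw [Config.words, Config.words, out, ec, e₀ _ le_rfl]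
    · exact time.trans (Nat.le_add_left _ _)
  case pos =>
    -- The first output is not among those counted.
    have hlen' : ∀ x, count (fun y => M.flag (proc M w s₀ y) = 2) x < c₀.out.length := fun x => by
      have := length_out_le hc (s₀ + 1 + x)
      have h : (M.run w (s₀ + 1 + x)).out.length = _ := length_proc_out h0 hs2 x
      omega
    have hpow : 2 ^ (B - 3) ≤ 2 ^ B := Nat.pow_le_pow_right (by norm_num) (by omega)
    have hm : ∀ em : List ℕ, em.Nodup → (∀ x ∈ em, M.flag (proc M w s₀ x) = 2) →
        em.length ≤ 2 ^ B := by
      intro em hem hev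
      obtain ⟨X, hX⟩ : ∃ X, ∀ x ∈ em, x < X :=
        ⟨em.toFinset.sup id + 1, fun x hx =>
          Nat.lt_succ_of_le (Finset.le_sup (f := id) (List.mem_toFinset.2 hx))⟩
      have : em.length ≤ count (fun y => M.flag (proc M w s₀ y) = 2) X :=
        (List.subperm_of_subset hem fun x hx => by simp [hX x hx, hev x hx]).length_le
      have := hlen' X
      omega
    obtain ⟨c', s', em, n, path, halted, sched, words, last, gap⟩ :=
      amortized_run hb hB h48 hM' hq h0 hs2 (by omega) hm hV
    refine ⟨c', path, halted, ?_, last, gap.mono (Nat.zero_le _)⟩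
    have hkey : ∀ x, M.flag (proc M w s₀ x) = 2 → ∀ y ≤ x,
        y < (count (fun y => M.flag (proc M w s₀ y) = 2) y + 1) * B := by
      intro x hx y hy
      have := hsteps (s₀ + 1 + y)
        (not_halted_mono (t := s₀ + 1 + x) (by omega) (not_halted_of_flag (by
          show M.flag (proc M w s₀ x) ≠ 1
          omega)))
      have h : (M.run w (s₀ + 1 + y)).out.length = _ := length_proc_out h0 hs2 y
      rw [h] at this
      generalize count (fun y => M.flag (proc M w s₀ y) = 2) y = k at *
      -- The first output, which is not counted, is compensated by the factor in `2 * D ≤ B`.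
      calc y < (k + 1 + 1) * D := by omega
        _ ≤ (k + 1) * (2 * D) := by ring_nf; nlinarith
        _ ≤ _ := Nat.mul_le_mul_left _ hD
    have hall : ∀ x, M.flag (proc M w s₀ x) = 2 → x ∈ em := by
      refine Sched.complete sched (by omega) hkey fun x hx => ?_
      have h := hkey x hx x le_rfl
      have h' := hlen' x
      generalize count (fun y => M.flag (proc M w s₀ y) = 2) x = k at *
      have e : 2 ^ (B - 2) = 2 * 2 ^ (B - 3) := by
        rw [← pow_succ', show B - 3 + 1 = B - 2 by omega]
      have : 2 ^ 1 ≤ 2 ^ (B - 3) := Nat.pow_le_pow_right (by norm_num) (by omega)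
      calc x + B < (k + 1 + 1) * B := by rw [Nat.succ_mul (k + 1)]; omega
        _ ≤ _ := Nat.mul_le_mul_right _ (by omega)
    -- The words output by `M` after the first one belong to the events, in increasing order.
    have hst : s₀ + 1 ≤ t := by
      by_contra! h
      have : M.Halted (M.run w s₀) := by
        rw [run_of_halted (s := t) (by rwa [ht]) (by omega), ht]; exact ht'
      have := flag_eq_one.2 this
      omega
    obtain ⟨X, rfl⟩ := Nat.exists_eq_add_of_le hst
    have e := words_proc h0 hs2 X
    rw [show proc M w s₀ X = c₀ from ht] at e
    rw [words, e]
    refine (List.perm_append_singleton _ _).trans (List.Perm.cons _ (List.Perm.map _ ?_))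
    rw [List.perm_ext_iff_of_nodup sched.nodup (List.nodup_range.filter _)]
    intro x
    simp only [List.mem_filter, List.mem_range, decide_eq_true_eq]
    refine ⟨fun hx => ?_, fun hx => hall x hx.2⟩
    have hx2 := ((sched.mem x).1 hx).1
    refine ⟨?_, hx2⟩
    by_contra! h
    have : M.Halted (proc M w s₀ x) := by
      unfold proc
      rw [run_of_halted (s := s₀ + 1 + X) (by rwa [ht]) (by omega), ht]; exact ht'
    have := flag_eq_one.2 this
    omega

end Single

/-! ### Polynomial bounds -/

theorem exists_eval_le (p : Polynomial ℕ) : ∃ c b : ℕ, ∀ n, p.eval n ≤ c * (n + 1) ^ b := by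
  refine ⟨∑ i ∈ Finset.range (p.natDegree + 1), p.coeff i, p.natDegree, fun n => ?_⟩
  rw [Polynomial.eval_eq_sum_range, Finset.sum_mul]
  refine Finset.sum_le_sum fun i hi => Nat.mul_le_mul_left _ ?_
  rw [Finset.mem_range] at hi
  exact (Nat.pow_le_pow_left (Nat.le_succ n) i).trans
    (Nat.pow_le_pow_right (by omega) (by omega))

theorem len_two_pow (e : ℕ) : len (2 ^ e) = e + 1 := by
  rw [len, Nat.log_pow (by norm_num)]

theorem hopTime_two_pow (e q : ℕ) : hopTime (2 ^ e) q = q * (e * 2 ^ q + 2) := by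
  rw [hopTime, ← pow_mul, ← pow_succ', len_two_pow]

theorem code_injective (k : ℕ) : Function.Injective (code (k := k)) :=
  List.map_injective_iff.2 Fin.val_injective

theorem ncard_eq_length {k : ℕ} {S : Set (Word k)} {c : Config} (hn : c.words.Nodup)
    (hS : {w | w ∈ c.words} = code '' S) : S.ncard = c.out.length := by
  rw [← Set.ncard_image_of_injective S (code_injective k), ← hS]
  have : {w | w ∈ c.words} = (c.words.toFinset : Set (List ℕ)) := by ext; simp
  rw [this, Set.ncard_coe_finset, List.toFinset_card_of_nodup hn]
  simp [Config.words]

/-- A word of length at most `L` is a function from `Fin L` to letters and blanks. -/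
theorem ncard_words_le {k L : ℕ} {S : Set (Word k)} (h : ∀ y ∈ S, y.length ≤ L) :
    S.ncard ≤ 2 ^ (k * L) := by
  have hinj : Set.InjOn (fun (y : Word k) (i : Fin L) => y[(i : ℕ)]?) S := by
    intro y hy z hz hyz
    refine List.ext_getElem? fun i => ?_
    by_cases hi : i < L
    · exact congrFun hyz ⟨i, hi⟩
    · have := h y hy
      have := h z hz
      rw [List.getElem?_eq_none (by omega), List.getElem?_eq_none (by omega)]
  have := Set.ncard_le_ncard_of_injOn _ (fun _ _ => Set.mem_univ _) hinj
  rw [Set.ncard_univ, Nat.card_eq_fintype_card, Fintype.card_fun, Fintype.card_option,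
    Fintype.card_fin, Fintype.card_fin] at this
  rw [pow_mul]
  exact this.trans (Nat.pow_le_pow_left Nat.lt_two_pow_self _)

theorem T_eq_times {c : Config} {i : ℕ} (h1 : 1 ≤ i) (h : i ≤ c.out.length) :
    c.T i = c.times.getD i 0 := by
  obtain ⟨i, rfl⟩ := Nat.exists_eq_add_of_le' h1
  simp [Config.T, Config.times, List.getD_eq_getElem?_getD, List.getElem?_eq_getElem
    (show i < c.out.length by omega)]

theorem Gap.delay {d g i : ℕ} {c : Config} (h : Gap d g c) (h1 : 1 ≤ i) (hi : i < c.out.length) :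
    c.T (i + 1) ≤ c.T i + d := by
  rw [T_eq_times (by omega) hi, T_eq_times h1 hi.le]
  exact h.gap i hi

theorem Gap.T_one_le {d : ℕ} {c : Config} (h : Gap d d c) : c.T 1 ≤ d := by
  rcases Nat.eq_zero_or_pos c.out.length with h0 | h0
  · have e := List.length_eq_zero_iff.1 h0
    have := h.time
    simpa [Config.T, Config.times, e] using this
  · rw [T_eq_times le_rfl h0]
    have := h.gap 0 h0
    simpa [Config.times] using this

/-! ### The two inclusions -/

theorem delayPPoly_subset (k : ℕ) : DelayPPoly k ⊆ IncPPoly k 1 := by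
  rintro A ⟨hA, M, hM, hp, ⟨d, hd⟩, hs⟩
  refine ⟨hA, M, hM, hp, ?_, hs⟩
  obtain ⟨c, b, hcb⟩ := exists_eval_le d
  refine ⟨b, c, fun x f hf i hi hin => ?_⟩
  have key : ∀ i, i + 1 ≤ (A x).ncard → f.T (i + 1) ≤ f.T 1 + i * d.eval x.length := by
    intro i
    induction i with
    | zero => simp
    | succ i ih =>
      intro h
      have := ih (by omega)
      have := hd x f hf (i + 1) (by omega) (by omega)
      rw [Nat.succ_mul]
      omega
  obtain ⟨i, rfl⟩ := Nat.exists_eq_add_of_le' hi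
  refine (key i hin).trans (Nat.add_le_add_left ?_ _)
  calc i * d.eval x.length ≤ (i + 1) * (c * (x.length + 1) ^ b) :=
        Nat.mul_le_mul (Nat.le_succ i) (hcb _)
    _ = _ := by ring

/-- The bound `V` for the registers is large enough for the contents of the regions, for the
number of rounds of the main loop, and for the constants of the program. -/
theorem bounds_arith {B U V : ℕ} (hB : 30 ≤ B) (hV : V = 2 ^ (U + 5 * B)) :
    B * B + 2 ^ B * B + 2 ≤ V ∧ B + (2 ^ B + 1) * passLength B + 1 ≤ V ∧ U ≤ V := by
  have h1 : B < 2 ^ B := Nat.lt_two_pow_self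
  have hU : U < 2 ^ U := Nat.lt_two_pow_self
  have e : V = 2 ^ U * (2 ^ B) ^ 5 := by rw [hV, pow_add, ← pow_mul, mul_comm 5]
  have h2 : 2 ^ 5 ≤ 2 ^ B := Nat.pow_le_pow_right (by norm_num) (by omega)
  have hp : passLength B ≤ 2 * (B * B) := by
    unfold passLength
    calc (B - 2) * (2 * B) ≤ B * (2 * B) := Nat.mul_le_mul_right _ (by omega)
      _ = _ := by ring
  generalize 2 ^ B = X at *
  have hX5 : X ^ 5 ≤ V := by rw [e]; exact Nat.le_mul_of_pos_left _ (by omega)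
  have hUV : U ≤ V := by
    rw [e]
    exact hU.le.trans (Nat.le_mul_of_pos_right _ (by positivity))
  have hBB : B * B ≤ X * X := Nat.mul_le_mul h1.le h1.le
  have h3 : (X + 1) * passLength B ≤ (X + 1) * (2 * (X * X)) :=
    Nat.mul_le_mul_left _ (hp.trans (by omega))
  have h4 : X * B ≤ X * X := Nat.mul_le_mul_left _ h1.le
  have hX2 : 32 * X ≤ X * X := Nat.mul_le_mul_right _ (by omega)
  have hX3 : 32 * (X * X) ≤ X * (X * X) := Nat.mul_le_mul_right _ (by omega)
  have hX4 : 32 * (X * (X * X)) ≤ X ^ 5 := by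
    calc 32 * (X * (X * X)) ≤ X * (X * (X * X)) := Nat.mul_le_mul_right _ (by omega)
      _ ≤ X * (X * (X * X)) * X := Nat.le_mul_of_pos_right _ (by omega)
      _ = _ := by ring
  have h5 : (X + 1) * (2 * (X * X)) = 2 * (X * (X * X)) + 2 * (X * X) := by ring
  refine ⟨?_, ?_, hUV⟩ <;> omega

/-- Geometric amortization. -/
theorem incPPoly_subset (k : ℕ) : IncPPoly k 1 ⊆ DelayPPoly k := by
  rintro A ⟨hA, M, hM, ⟨p, hp⟩, ⟨b₁, C, hinc⟩, ⟨s, hs⟩⟩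
  refine ⟨hA, ?_⟩
  obtain ⟨l, hl⟩ := hA.1
  obtain ⟨U, hU⟩ := exists_pc_le M
  obtain ⟨c, b, hcb⟩ := exists_eval_le (2 * (p + Polynomial.C C * (Polynomial.X + 1) ^ b₁) + s +
    Polynomial.C k * l + 2 * Polynomial.X + Polynomial.C (U + k + 100))
  simp only [Polynomial.eval_add, Polynomial.eval_mul, Polynomial.eval_C, Polynomial.eval_X,
    Polynomial.eval_pow, Polynomial.eval_one, Polynomial.eval_ofNat] at hcb
  -- The new machine depends on `c` and `b`, and so does the bound `W` for its constants; therefore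
  -- `W` enters `V`, but not `B`.
  set M' : Machine := (amortized M c b).code 0 with hM'
  obtain ⟨W, hW⟩ := Machine.exists_constLE M'
  set q := (amortized M c b).size with hq
  set V : ℕ → ℕ := fun n => 2 ^ (W + 5 * (c * (n + 1) ^ b)) with hV
  set δ : ℕ → ℕ := fun n =>
    5 * (c * (n + 1) ^ b * (c * (n + 1) ^ b)) * hopTime (V n) q with hδ
  have main : ∀ x : Word k, ∃ c' f : Config,
      Path M' (V x.length) (c * (x.length + 1) ^ b * (c * (x.length + 1) ^ b)) q (init (code x)) c'
          ∧
      M'.ConstLE (V x.length) ∧ 2 ≤ V x.length ∧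
      M'.HaltsOn (code x) c' ∧ M'.Halted c' ∧ c'.words.Nodup ∧ {w | w ∈ c'.words} = code '' A x ∧
      (∀ u t, (u, t) ∈ c'.out.getLast? → t = c'.time) ∧
      Gap (δ x.length) (δ x.length) c' := by
    intro x
    obtain ⟨f, hf, hnd, hset, hlast⟩ := hM x
    have hB := hcb x.length
    set B := c * (x.length + 1) ^ b with hBdef
    have hlx : (code x).length = x.length := List.length_map _
    obtain ⟨a1, a2, a3⟩ := bounds_arith (B := B) (U := W) (V := V x.length) (by omega) rfl
    have hcard := ncard_eq_length hnd hset
    have hspace : ∀ t, (M.run (code x) t).space ≤ s.eval x.length := hs x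
    have hb : Bounds M (code x) B (V x.length) := by
      refine ⟨by omega, fun t => ?_, fun t i => ?_, fun t => ?_, a1⟩
      · have := top_lt_space (M.run (code x) t)
        have := hspace t
        omega
      · exact (reg_run_lt t i).le.trans (Nat.pow_le_pow_right (by norm_num)
          ((hspace t).trans (by omega)))
      · have := hU (code x) t
        have : B < 2 ^ B := Nat.lt_two_pow_self
        omega
    have h1 : f.T 1 ≤ p.eval x.length + C * (x.length + 1) ^ b₁ := (hp x f hf).trans (by omega)
    have hT : ∀ i, 1 ≤ i → i ≤ f.out.length →
        f.T i ≤ i * (p.eval x.length + C * (x.length + 1) ^ b₁) := by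
      intro i hi hi'
      refine (hinc x f hf i hi (by omega)).trans ?_
      have := hp x f hf
      have : p.eval x.length ≤ i * p.eval x.length := Nat.le_mul_of_pos_left _ hi
      rw [pow_one, mul_add]
      have e : C * (i * (x.length + 1) ^ b₁) = i * (C * (x.length + 1) ^ b₁) := by ring
      omega
    have hletter : (code x).getD 0 0 ≤ k := by
      unfold code
      rw [List.getD_eq_getElem?_getD, List.getElem?_map]
      cases h : x[0]? with
      | none => simp
      | some y => simp
    have hlen : f.out.length ≤ 2 ^ (B - 3) := by
      rw [← hcard]
      exact (ncard_words_le (hl x)).trans (Nat.pow_le_pow_right (by norm_num) (by omega))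
    have hML : M'.ConstLE (V x.length) := fun i v h => (hW i v h).trans a3
    obtain ⟨c', path, halted, perm, last, gap⟩ := exists_run (c := c) (b := b) (q := q) hf hlast h1
        hT
      hb (by rw [hlx]) (by rw [hlx]; omega) (by omega) hlen hML le_rfl a2
    refine ⟨c', f, path, hML, by omega, ?_, halted, perm.nodup_iff.2 hnd, ?_, last, gap⟩
    · obtain ⟨t, ht⟩ := path.reaches
      exact ⟨t, ht, halted⟩
    · rw [← hset]
      ext u
      exact perm.mem_iff
  obtain ⟨d, hd⟩ : ∃ d : Polynomial ℕ, ∀ n, δ n = d.eval n := by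
    refine ⟨5 * ((Polynomial.C c * (Polynomial.X + 1) ^ b) *
      (Polynomial.C c * (Polynomial.X + 1) ^ b)) * (Polynomial.C q * ((Polynomial.C W +
        5 * (Polynomial.C c * (Polynomial.X + 1) ^ b)) * Polynomial.C (2 ^ q) + 2)), fun n => ?_⟩
    simp only [hδ, hV, hopTime_two_pow, Polynomial.eval_add, Polynomial.eval_mul, Polynomial.eval_C,
      Polynomial.eval_X, Polynomial.eval_pow, Polynomial.eval_one, Polynomial.eval_ofNat]
  refine ⟨M', ?_, ⟨d, fun x f hf => ?_⟩, ⟨d, fun x f hf i hi hin => ?_⟩,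
    ⟨(Polynomial.C c * (Polynomial.X + 1) ^ b * (Polynomial.C c * (Polynomial.X + 1) ^ b) + 1) *
      ((Polynomial.C W + 5 * (Polynomial.C c * (Polynomial.X + 1) ^ b)) * Polynomial.C (2 ^ q) + 1),
      fun x t => ?_⟩⟩
  · intro x
    obtain ⟨c', -, -, -, -, h, -, h1, h2, h3, -⟩ := main x
    exact ⟨c', h, h1, h2, h3⟩
  · obtain ⟨c', -, -, -, -, h, -, -, -, -, gap⟩ := main x
    rw [HaltsOn.unique hf h, ← hd]
    exact gap.T_one_le
  · obtain ⟨c', -, -, -, -, h, -, h1, h2, -, gap⟩ := main x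
    rw [HaltsOn.unique hf h, ← hd]
    exact gap.delay hi (by rwa [ncard_eq_length h1 h2] at hin)
  · obtain ⟨c', -, path, hML, h2, -, halted, -⟩ := main x
    refine (path.space_le hML h2 halted t).trans ?_
    rw [hV, ← pow_mul, len_two_pow]
    simp only [Polynomial.eval_add, Polynomial.eval_mul, Polynomial.eval_C, Polynomial.eval_X,
      Polynomial.eval_pow, Polynomial.eval_one, Polynomial.eval_ofNat]
    exact le_rfl

end EnumRAM

theorem mainTheorem3 (k : ℕ) : EnumRAM.IncPPoly k 1 = EnumRAM.DelayPPoly k :=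
  (EnumRAM.incPPoly_subset k).antisymm (EnumRAM.delayPPoly_subset k)
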